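/- Let $\beta\in\mathbb R$ and $R\ge 0$. Let $w_0=\log|\cdot|$ and, for $R>0$, $w_R=\log|\cdot| * \frac{\mathbb 1_{B(0,R)}}{\pi R^2}$ on $\mathbb R^2$; write $(x,y)^\perp=(-y,x)$, $\nabla^\perp w_R=(\nabla w_R)^\perp$, $\mathbf A^R[|u|^2]=\nabla^\perp w_R*|u|^2$ and $J[u]=\mathrm i(u\nabla\overline u-\overline u\nabla u)$. For $\varphi_0\in H^2(\mathbb R^2)$, a solution of $\mathrm{CSS}(R,\varphi_0)$ on $[0,T]$ is a $u\in C([0,T],H^2(\mathbb R^2))$ with $u_0=\varphi_0$ that is differentiable in time with values in $L^2(\mathbb R^2)$ and satisfies, for all $t\in[0,T]$, $$\mathrm i\,\partial_t u=\big(-\mathrm i\nabla+\beta\mathbf A^R[|u|^2]\big)^2u-\beta\Big[\nabla^\perp w_R*\big(2\beta\mathbf A^R[|u|^2]\,|u|^2+J[u]\big)\Big]u .$$ Put $\mathrm{CSS}(\varphi_0)=\mathrm{CSS}(0,\varphi_0)$. **Lemma.** For every $M_1$ there is $c'>0$, and for every $M_2$ there are then $c,T,C>0$, such that the following holds for all $\varphi_0\in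 H^2(\mathbb R^2)$ with $\|\varphi_0\|_{H^1}\le M_1$ and $\|\varphi_0\|_{H^2}\le M_2$ and all $\beta$ with $|\beta|\le c'$. For every $0\le R\le c$ the problem $\mathrm{CSS}(R,\varphi_0)$ has exactly one solution on $[0,T]$. For every $0<R\le c$, the solutions $\varphi_t$ of $\mathrm{CSS}(\varphi_0)$ and $\varphi^R_t$ of $\mathrm{CSS}(R,\varphi_0)$ on $[0,T]$ are such that, for all $0\le t<T$, the function $t\mapsto\|\varphi_t-\varphi_t^R\|_2^2$ is differentiable (from the right at $t=0$), $$\partial_t\|\varphi_t-\varphi_t^R\|_2^2\le CR^2+C\|\varphi_t-\varphi_t^R\|_2^2,\qquad\text{and}\qquad \|\varphi_t-\varphi_t^R\|_2^2\le CR^2e^{Ct}.$$ -/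

import Mathlib

namespace CSS

noncomputable section

open MeasureTheory Complex
open scoped LineDeriv SchwartzMap ComplexConjugate

/-- The plane `ℝ²` with its Euclidean structure. -/
abbrev Plane : Type := EuclideanSpace ℝ (Fin 2)

/-- The complex Hilbert space `L²(ℝ²)`. -/
abbrev L2 : Type := Lp ℂ 2 (volume : Measure Plane)

/-! ### Sobolev spaces -/

/-- The partial derivative `∂ⱼ f`, as a tempered distribution, of `f ∈ L²(ℝ²)`. -/
def distDeriv (j : Fin 2) (f : L2) : 𝓢'(Plane, ℂ) :=
  ∂_{(EuclideanSpace.single j (1 : ℝ) : Plane)} (f : 𝓢'(Plane, ℂ))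

open Classical in
/-- The weak partial derivative `∂ⱼ f` of `f ∈ L²(ℝ²)`, as an element of `L²(ℝ²)`
(by convention `0` if the distributional derivative is not in `L²`; it always is for `f ∈ H¹`). -/
def weakDeriv (j : Fin 2) (f : L2) : L2 :=
  if h : ∃ g : L2, (g : 𝓢'(Plane, ℂ)) = distDeriv j f then h.choose else 0

/-- `f ∈ H²(ℝ²)`. -/
def MemH2 (f : L2) : Prop :=
  TemperedDistribution.MemSobolev 2 2 (f : 𝓢'(Plane, ℂ))

/-- The norm of `H¹(ℝ²)`, used for `f ∈ H²(ℝ²)`. -/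
def h1Norm (f : L2) : ℝ :=
  Real.sqrt (‖f‖ ^ 2 + ∑ j, ‖weakDeriv j f‖ ^ 2)

/-- The norm of `H²(ℝ²)`, used for `f ∈ H²(ℝ²)`. -/
def h2Norm (f : L2) : ℝ :=
  Real.sqrt (‖f‖ ^ 2 + ∑ j, ‖weakDeriv j f‖ ^ 2
    + ∑ j, ∑ k, ‖weakDeriv j (weakDeriv k f)‖ ^ 2)

/-! ### The smeared Coulomb potential -/

/-- The two-dimensional Coulomb potential `w_R` of a unit charge smeared over the disc of radius
`R`: the convolution of `log |·|` with `1_{B(0,R)} / (π R²)`, and `w_0 = log |·|`. -/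
def coulomb (R : ℝ) (x : Plane) : ℝ :=
  if R = 0 then Real.log ‖x‖
  else (Real.pi * R ^ 2)⁻¹ * ∫ y in Metric.ball (0 : Plane) R, Real.log ‖x - y‖

/-- The rotation `(x, y)^⊥ = (-y, x)`. -/
def perp (v : Plane) : Plane := !₂[-(v 1), v 0]

/-- The vector field `∇^⊥ w_R`. -/
def gradPerp (R : ℝ) (x : Plane) : Plane := perp (gradient (coulomb R) x)

/-! ### The Chern–Simons–Schrödinger equation -/

/-- The self-generated vector potential `A^R[|u|²] = ∇^⊥ w_R ∗ |u|²`. -/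
def gaugeField (R : ℝ) (u : L2) (x : Plane) : Plane :=
  ∫ y, (‖u y‖ ^ 2) • gradPerp R (x - y)

/-- The components of the current `J[u] = i (u ∇ū - ū ∇u)`. -/
def current (u : L2) (j : Fin 2) (x : Plane) : ℂ :=
  I * (u x * conj (weakDeriv j u x) - conj (u x) * weakDeriv j u x)

/-- The function `∇^⊥ w_R ∗ (2 β A^R[|u|²] |u|² + J[u])`, where the convolution of two vector
fields is taken with the scalar product of `ℝ²`. -/
def scalarPotential (β R : ℝ) (u : L2) (x : Plane) : ℂ :=
  ∫ y, ∑ j, (gradPerp R (x - y) j : ℂ) *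
    (2 * β * (gaugeField R u y j : ℂ) * (‖u y‖ : ℂ) ^ 2 + current u j y)

/-- `F ∈ L²(ℝ²)` is the right-hand side
`(-i∇ + β A^R[|u|²])² u - β [∇^⊥ w_R ∗ (2 β A^R[|u|²] |u|² + J[u])] u`
of the equation at `u ∈ H²(ℝ²)`.

Here `D j = (-i∂ⱼ + β Aⱼ) u`; the square of the magnetic gradient is
`∑ⱼ (-i∂ⱼ + β Aⱼ) (D j)`, with the outer `∂ⱼ` in the sense of distributions, and `N` collects the
remaining terms, those without an outer derivative. -/
def IsRHS (β R : ℝ) (u F : L2) : Prop :=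
  ∃ (D : Fin 2 → L2) (N : L2),
    (∀ j, ∀ᵐ x : Plane,
      D j x = -I * weakDeriv j u x + β * (gaugeField R u x j : ℂ) * u x) ∧
    (∀ᵐ x : Plane,
      N x = ∑ j, β * (gaugeField R u x j : ℂ) * D j x - β * scalarPotential β R u x * u x) ∧
    (F : 𝓢'(Plane, ℂ)) = ∑ j, (-I) • distDeriv j (D j) + (N : 𝓢'(Plane, ℂ))

/-- `u` is a solution of `CSS(R, φ₀)` with coupling `β` on the time interval `[0, T]`:
`u ∈ C([0, T], H²)`, `u(0) = φ₀`, and `u` is differentiable in time with values in `L²` and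
satisfies `i ∂ₜ u = RHS(u)` at all times (one-sided derivatives at the end points). The values of
`u` outside `[0, T]` play no role. -/
structure IsSolution (β R T : ℝ) (φ₀ : L2) (u : ℝ → L2) : Prop where
  memH2 : ∀ t ∈ Set.Icc 0 T, MemH2 (u t)
  continuous_h2 : ∀ t ∈ Set.Icc 0 T,
    Filter.Tendsto (fun s => h2Norm (u s - u t)) (nhdsWithin t (Set.Icc 0 T)) (nhds 0)
  initial : u 0 = φ₀
  equation : ∀ t ∈ Set.Icc 0 T, ∃ u' : L2,
    HasDerivWithinAt u u' (Set.Icc 0 T) t ∧ IsRHS β R (u t) (I • u')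

end

end CSS

open MeasureTheory Complex Filter Topology Set
open scoped LineDeriv SchwartzMap ComplexConjugate

namespace CSS

/-! ### Differential inequalities -/

/-! Write `S` for the resolvent `(1 - Δ/(4π²))⁻¹`. Its range is `H²`, so every state is `u = S f`
with `f` in `L²`, and the equation becomes `i ∂ₜ (S f) = H f f`. Here `H f` is the Hamiltonian with
the potentials generated by `S f`, composed with `S`.

Three properties of `H` carry the argument. (1) Symmetry (`ham_symm`): the scalar coefficients are
real and the vector potential is divergence free. (2) `H f - H f'` is Lipschitz in the `L²` norm of
`S f - S f'` alone, on bounded sets of `f` (`norm_pert_sub_le`). By Newton's theorem `∇^⊥ w_R = x^⊥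
/ max(|x|², R²)`, so the kernels are at most `1/|x|` and divergence free. Hardy's inequality `∫
|u|²/|x-y| dx ≤ 2 ‖u‖ ∑ ‖∂ⱼu‖` and Cauchy-Schwarz then estimate products `(k ∗ ρ) h`
(`SubCoulomb.eLpNorm_cv_mul_le`). The derivatives of `S f - S f'` in the difference of the currents
are removed because the kernels annihilate gradients (`sum_cv_curr_sub`). (3) Coercivity: when `|β|
m²` is small, the nonlinear terms at a state of mass at most `m` are at most half of the Laplacian
(`norm_pert_self_le`).

By (1) and (2), `‖S f - S g‖` obeys a Grönwall inequality for any two solutions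
(`Admissible.energy`). This gives uniqueness. Applied to a solution and its own time translate it
bounds the time derivative, and by (3) also `‖f‖`, that is, the `H²` norm. Spectral truncations
satisfy the same bounds, exist on a common time interval (`exists_galerkin_uniform`) and are Cauchy
after applying `S`; the limit is a weak solution. At time `0` the bounds hold with the sharp
constant `‖H f₀ f₀‖`, so weak convergence improves to strong convergence. Restarting the evolution
at any time and using uniqueness yields a strong solution (`Admissible.exists_strong_solution`).

All constants are independent of `R`. The kernels for radii `R` and `0` agree outside the disc of
radius `R`, and their difference has `L¹` norm at most `2πR`. Together with `H² ⊂ L^∞` this gives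
`‖H_R f f - H_0 f f‖ ≤ C R` (`norm_ham_sub_le`). Used as a source term in the energy estimate, it
gives the differential inequality, and Grönwall's lemma gives the final bound. -/

theorem gronwallBound_le {δ K ε x : ℝ} (hK : 0 ≤ K) (hε : 0 ≤ ε) :
    gronwallBound δ K ε x ≤ (δ + ε * x) * Real.exp (K * x) := by
  rcases hK.eq_or_lt with rfl | hK
  · simp [gronwallBound_K0]
  · rw [gronwallBound_of_K_ne_0 hK.ne']
    have h := Real.one_sub_le_exp_neg (K * x)
    have h1 : Real.exp (K * x) - 1 ≤ K * x * Real.exp (K * x) := by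
      have h2 := mul_le_mul_of_nonneg_right h (Real.exp_pos (K * x)).le
      rw [← Real.exp_add, neg_add_cancel, Real.exp_zero] at h2
      linarith
    have h3 : ε / K * (Real.exp (K * x) - 1) ≤ ε / K * (K * x * Real.exp (K * x)) := by gcongr
    have h4 : ε / K * (K * x * Real.exp (K * x)) = ε * x * Real.exp (K * x) := by field_simp
    linarith

theorem gronwall_forward {y y' : ℝ → ℝ} {a b K ε : ℝ} (hK : 0 ≤ K) (hε : 0 ≤ ε)
    (hy : ∀ t ∈ Icc a b, 0 ≤ y t)
    (hd : ∀ t ∈ Icc a b, HasDerivWithinAt y (y' t) (Icc a b) t)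
    (hb : ∀ t ∈ Icc a b, |y' t| ≤ K * y t + ε) {t : ℝ} (ht : t ∈ Icc a b) :
    y t ≤ (y a + ε * (t - a)) * Real.exp (K * (t - a)) := by
  have ha : a ∈ Icc a b := ⟨le_rfl, ht.1.trans ht.2⟩
  have h := norm_le_gronwallBound_of_norm_deriv_right_le (f := y) (f' := y') (δ := y a) (K := K)
    (ε := ε) (a := a) (b := b) (fun t ht => (hd t ht).continuousWithinAt)
    (fun t ht => (hd t ⟨ht.1, ht.2.le⟩).mono_of_mem_nhdsWithin (Icc_mem_nhdsGE_of_mem ht))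
    (by rw [Real.norm_of_nonneg (hy a ha)])
    (fun t ht => by
      have h := hb t ⟨ht.1, ht.2.le⟩
      rwa [Real.norm_of_nonneg (hy t ⟨ht.1, ht.2.le⟩)]) t ht
  rw [Real.norm_of_nonneg (hy t ht)] at h
  exact h.trans (gronwallBound_le hK hε)

/-- Grönwall's inequality in both time directions. -/
theorem gronwall_two_sided {y y' : ℝ → ℝ} {a b K ε s t : ℝ} (hK : 0 ≤ K) (hε : 0 ≤ ε)
    (hy : ∀ t ∈ Icc a b, 0 ≤ y t)
    (hd : ∀ t ∈ Icc a b, HasDerivWithinAt y (y' t) (Icc a b) t)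
    (hb : ∀ t ∈ Icc a b, |y' t| ≤ K * y t + ε) (hs : s ∈ Icc a b) (ht : t ∈ Icc a b) :
    y t ≤ (y s + ε * |t - s|) * Real.exp (K * |t - s|) := by
  rcases le_total s t with hst | hst
  · rw [abs_of_nonneg (sub_nonneg.2 hst)]
    have hsub : Icc s b ⊆ Icc a b := Icc_subset_Icc_left hs.1
    exact gronwall_forward hK hε (fun t ht => hy t (hsub ht))
      (fun t ht => (hd t (hsub ht)).mono hsub) (fun t ht => hb t (hsub ht)) ⟨hst, ht.2⟩
  · rw [abs_of_nonpos (sub_nonpos.2 hst)]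
    have hsub : ∀ τ ∈ Icc (-s) (-a), -τ ∈ Icc a b := fun τ hτ => by
      constructor <;> linarith [hτ.1, hτ.2, hs.2]
    -- Backward in time: the reflected function satisfies the same hypotheses, because only the
    -- absolute value of the derivative is bounded.
    have h := gronwall_forward (y := fun τ => y (-τ)) (y' := fun τ => -y' (-τ)) (a := -s) (b := -a)
      hK hε (fun τ hτ => hy _ (hsub τ hτ))
      (fun τ hτ => by
        have h1 := (hd _ (hsub τ hτ)).scomp τ (hasDerivWithinAt_neg τ (Icc (-s) (-a)))
          (fun σ hσ => hsub σ hσ)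
        simpa using! h1)
      (fun τ hτ => by rw [abs_neg]; exact hb _ (hsub τ hτ)) (t := -t)
      ⟨by linarith, by linarith [ht.1]⟩
    simp only [neg_neg] at h
    have e : -t - -s = -(t - s) := by ring
    rwa [e] at h

/-- The derivative of the squared norm along a curve. -/
theorem hasDerivWithinAt_norm_sq {E : Type*} [NormedAddCommGroup E] [InnerProductSpace ℂ E]
    [NormedSpace ℝ E] {f : ℝ → E} {f' : E} {s : Set ℝ} {t : ℝ} (h : HasDerivWithinAt f f' s t) :
    HasDerivWithinAt (fun τ => ‖f τ‖ ^ 2) (2 * (inner ℂ (f t) f').re) s t := by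
  have h1 := h.inner ℂ h
  have h2 := (reCLM.hasFDerivAt.comp_hasDerivWithinAt t h1)
  have e : (reCLM ∘ fun τ => inner ℂ (f τ) (f τ)) = fun τ => ‖f τ‖ ^ 2 := by
    funext τ
    simp only [Function.comp, reCLM_apply]
    exact (norm_sq_eq_re_inner (𝕜 := ℂ) (f τ)).symm
  rw [e] at h2
  have e2 : 2 * (inner ℂ (f t) f').re = reCLM (inner ℂ (f t) f' + inner ℂ f' (f t)) := by
    rw [reCLM_apply, add_re, ← inner_conj_symm (𝕜 := ℂ) f', conj_re]
    ring
  rw [e2]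
  exact h2

/-! ### Global flows of locally Lipschitz norm-preserving vector fields -/

/-- Multiplying `G` by a real cut-off in the norm makes it bounded and globally Lipschitz, so that
Picard-Lindelöf applies on the whole interval. A real factor does not destroy conservation of the
norm, hence the orbit stays on the sphere of radius `‖u₀‖`, where the cut-off equals `1`. -/
theorem exists_flow_of_norm_preserving {E : Type*} [NormedAddCommGroup E] [InnerProductSpace ℂ E]
    [NormedSpace ℝ E] [IsScalarTower ℝ ℂ E] [CompleteSpace E] (G : E → E)
    (hlip : ∀ r : ℝ, ∃ K : ℝ, ∀ u v, ‖u‖ ≤ r → ‖v‖ ≤ r → ‖G u - G v‖ ≤ K * ‖u - v‖)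
    (hG : ∀ u, (inner ℂ u (G u)).re = 0) (u₀ : E) {T : ℝ} (hT : 0 ≤ T) :
    ∃ u : ℝ → E, u 0 = u₀ ∧ ∀ t ∈ Icc (-T) T,
      HasDerivWithinAt u (G (u t)) (Icc (-T) T) t ∧ ‖u t‖ = ‖u₀‖ := by
  set r : ℝ := ‖u₀‖ + 2 with hr
  obtain ⟨K₀, hK₀⟩ := hlip r
  set K : ℝ := max K₀ 0 with hKdef
  have hK0 : 0 ≤ K := le_max_right _ _
  have hK : ∀ u v, ‖u‖ ≤ r → ‖v‖ ≤ r → ‖G u - G v‖ ≤ K * ‖u - v‖ := fun u v hu hv =>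
    (hK₀ u v hu hv).trans (by gcongr; exact le_max_left _ _)
  have hr0 : 0 ≤ r := by positivity
  set B : ℝ := ‖G 0‖ + K * r with hB
  have hB0 : 0 ≤ B := by positivity
  have hGB : ∀ u, ‖u‖ ≤ r → ‖G u‖ ≤ B := fun u hu => by
    have h1 := hK u 0 hu (by simpa using hr0)
    have h2 := norm_le_norm_add_norm_sub' (G u) (G 0)
    rw [sub_zero] at h1
    have h3 : K * ‖u‖ ≤ K * r := by gcongr
    linarith
  set χ : E → ℝ := fun u => max 0 (min 1 (r - ‖u‖)) with hχ
  have hχ0 : ∀ u, 0 ≤ χ u := fun u => le_max_left _ _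
  have hχ1 : ∀ u, χ u ≤ 1 := fun u => max_le zero_le_one (min_le_left _ _)
  have hχl : ∀ u v, |χ u - χ v| ≤ ‖u - v‖ := fun u v => by
    have h1 : |χ u - χ v| ≤ |min 1 (r - ‖u‖) - min 1 (r - ‖v‖)| := by
      simpa using abs_max_sub_max_le_max 0 (min 1 (r - ‖u‖)) 0 (min 1 (r - ‖v‖))
    have h2 : |min 1 (r - ‖u‖) - min 1 (r - ‖v‖)| ≤ |(r - ‖u‖) - (r - ‖v‖)| := by
      simpa using abs_min_sub_min_le_max 1 (r - ‖u‖) 1 (r - ‖v‖)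
    have h3 : |(r - ‖u‖) - (r - ‖v‖)| ≤ ‖u - v‖ := by
      rw [show (r - ‖u‖) - (r - ‖v‖) = -(‖u‖ - ‖v‖) by ring, abs_neg]
      exact abs_norm_sub_norm_le u v
    linarith
  have hχz : ∀ u, r < ‖u‖ → χ u = 0 := fun u hu =>
    max_eq_left (min_le_of_right_le (by linarith))
  set F : E → E := fun u => χ u • G u with hF
  have hFB : ∀ u, ‖F u‖ ≤ B := fun u => by
    rcases le_or_gt ‖u‖ r with h | h
    · rw [hF, norm_smul, Real.norm_of_nonneg (hχ0 u)]
      calc χ u * ‖G u‖ ≤ 1 * B := by gcongr; exacts [hχ1 u, hGB u h]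
        _ = B := one_mul B
    · simp [hF, hχz u h, hB0]
  -- One point inside the ball is enough: if both lie outside, `F` vanishes at both.
  have key : ∀ u v, ‖v‖ ≤ r → ‖F u - F v‖ ≤ (K + B) * ‖u - v‖ := fun u v hv => by
    rcases le_or_gt ‖u‖ r with hu | hu
    · have e : F u - F v = χ u • (G u - G v) + (χ u - χ v) • G v := by
        simp only [hF, smul_sub, sub_smul]; abel
      rw [e]
      refine (norm_add_le _ _).trans ?_
      rw [norm_smul, norm_smul, Real.norm_of_nonneg (hχ0 u), Real.norm_eq_abs]
      have h1 : χ u * ‖G u - G v‖ ≤ 1 * (K * ‖u - v‖) := by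
        gcongr; exacts [hχ1 u, hK u v hu hv]
      have h2 : |χ u - χ v| * ‖G v‖ ≤ ‖u - v‖ * B := by gcongr; exacts [hχl u v, hGB v hv]
      linarith
    · have e : F u - F v = (χ u - χ v) • G v := by simp [hF, hχz u hu]
      rw [e, norm_smul, Real.norm_eq_abs]
      have h2 : |χ u - χ v| * ‖G v‖ ≤ ‖u - v‖ * B := by gcongr; exacts [hχl u v, hGB v hv]
      have h3 : 0 ≤ K * ‖u - v‖ := by positivity
      linarith
  have hFl : LipschitzWith (K + B).toNNReal F := by
    refine LipschitzWith.of_dist_le_mul fun u v => ?_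
    rw [dist_eq_norm, dist_eq_norm, Real.coe_toNNReal _ (by positivity)]
    rcases le_or_gt ‖v‖ r with hv | hv
    · exact key u v hv
    · rcases le_or_gt ‖u‖ r with hu | hu
      · rw [norm_sub_rev, norm_sub_rev u v]; exact key v u hu
      · simp only [hF, hχz u hu, hχz v hv, zero_smul, sub_zero, norm_zero]; positivity
  have h0 : (0 : ℝ) ∈ Icc (-T) T := ⟨by linarith, hT⟩
  have hPL : IsPicardLindelof (fun _ => F) (⟨0, h0⟩ : Icc (-T) T) u₀ (B * T).toNNReal 0
      B.toNNReal (K + B).toNNReal := by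
    refine ⟨fun t _ => hFl.lipschitzOnWith, fun x _ => continuousOn_const, fun t _ x _ => ?_, ?_⟩
    · rw [Real.coe_toNNReal _ hB0]; exact hFB x
    · rw [Real.coe_toNNReal _ hB0, Real.coe_toNNReal _ (by positivity)]
      simp
  obtain ⟨u, hu0, hu⟩ := hPL.exists_eq_forall_mem_Icc_hasDerivWithinAt₀
  have hn : ∀ t ∈ Icc (-T) T, ‖u t‖ = ‖u₀‖ := by
    have hd : ∀ t ∈ Icc (-T) T, HasDerivWithinAt (fun τ => ‖u τ‖ ^ 2) 0 (Icc (-T) T) t := by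
      intro t ht
      have h := hasDerivWithinAt_norm_sq (hu t ht)
      have e : (inner ℂ (u t) (F (u t))).re = 0 := by
        have : F (u t) = (χ (u t) : ℂ) • G (u t) := by
          simp only [hF]
          rw [← algebraMap_smul ℂ (χ (u t)) (G (u t))]; rfl
        rw [this, inner_smul_right, re_ofReal_mul, hG, mul_zero]
      rwa [e, mul_zero] at h
    intro t ht
    have h := (convex_Icc (-T) T).norm_image_sub_le_of_norm_hasDerivWithin_le (C := 0)
      hd (by simp) h0 ht
    simp only [zero_mul, norm_le_zero_iff, sub_eq_zero] at h
    have h2 : ‖u t‖ ^ 2 = ‖u₀‖ ^ 2 := by rw [h]; simp only [] at hu0; rw [hu0]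
    exact (sq_eq_sq₀ (norm_nonneg _) (norm_nonneg _)).1 h2
  refine ⟨u, hu0, fun t ht => ⟨?_, hn t ht⟩⟩
  have h := hu t ht
  have e : F (u t) = G (u t) := by
    have : χ (u t) = 1 := by
      simp only [hχ, hn t ht, hr]; norm_num
    simp only [hF, this, one_smul]
  simp only [e] at h
  exact h

end CSS

open MeasureTheory Complex Filter Topology Set
open scoped LineDeriv SchwartzMap ComplexConjugate

namespace CSS

set_option linter.unusedSectionVars false

variable {E : Type*} [NormedAddCommGroup E] [InnerProductSpace ℂ E] [NormedSpace ℝ E]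
  [IsScalarTower ℝ ℂ E] [CompleteSpace E]

/-! ### Quasilinear Schrödinger equations in a Hilbert space -/

/-- A Hilbert space with a smoothing operator `S` and spectral cut-offs `P n` commuting with it,
where `S` is invertible on the range of `P n`, with inverse `Q n`. -/
structure GalerkinFrame (E : Type*) [NormedAddCommGroup E] [InnerProductSpace ℂ E] where
  S : E →L[ℂ] E
  P : ℕ → E →L[ℂ] E
  Q : ℕ → E →L[ℂ] E
  eps : ℕ → ℝ
  P_symm : ∀ n x y, inner ℂ (P n x) y = inner ℂ x (P n y)
  P_P : ∀ {m n}, m ≤ n → ∀ x, P n (P m x) = P m x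
  P_tendsto : ∀ x, Tendsto (fun n => P n x) atTop (𝓝 x)
  S_Q : ∀ n x, S (Q n x) = P n x
  Q_S : ∀ n x, Q n (S x) = P n x
  tail : ∀ n x, ‖S x - P n (S x)‖ ≤ eps n * ‖x‖
  eps_tendsto : Tendsto eps atTop (𝓝 0)

namespace GalerkinFrame

variable (𝔉 : GalerkinFrame E)

theorem P_le (n : ℕ) (x : E) : ‖𝔉.P n x‖ ≤ ‖x‖ := by
  have h : ‖𝔉.P n x‖ ^ 2 ≤ ‖x‖ * ‖𝔉.P n x‖ := by
    have e : inner ℂ (𝔉.P n x) (𝔉.P n x) = inner ℂ x (𝔉.P n x) := by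
      rw [𝔉.P_symm, 𝔉.P_P le_rfl]
    have e2 : (‖𝔉.P n x‖ ^ 2 : ℝ) = ‖inner ℂ x (𝔉.P n x)‖ := by
      rw [← e, inner_self_eq_norm_sq_to_K, norm_pow]
      simp
    rw [e2]
    exact norm_inner_le_norm _ _
  rcases (norm_nonneg (𝔉.P n x)).eq_or_lt with h0 | h0
  · rw [← h0]; exact norm_nonneg _
  · rw [sq] at h; exact le_of_mul_le_mul_right h h0

theorem S_P (n : ℕ) (x : E) : 𝔉.S (𝔉.P n x) = 𝔉.P n (𝔉.S x) := by
  rw [← 𝔉.Q_S, 𝔉.S_Q]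

theorem S_injective : Function.Injective 𝔉.S := by
  refine (injective_iff_map_eq_zero 𝔉.S).2 fun x hx => ?_
  have h : ∀ n, 𝔉.P n x = 0 := fun n => by rw [← 𝔉.Q_S, hx, map_zero]
  exact (tendsto_nhds_unique (𝔉.P_tendsto x) (by simp [h]))

theorem P_Q {m n : ℕ} (h : m ≤ n) (x : E) : 𝔉.P n (𝔉.Q m x) = 𝔉.Q m x := by
  apply 𝔉.S_injective
  rw [𝔉.S_P, 𝔉.S_Q, 𝔉.P_P h]

theorem P_P' {m n : ℕ} (h : m ≤ n) (x : E) : 𝔉.P m (𝔉.P n x) = 𝔉.P m x := by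
  refine ext_inner_right ℂ fun y => ?_
  rw [𝔉.P_symm, 𝔉.P_symm, 𝔉.P_P h, 𝔉.P_symm]

theorem denseRange_S : DenseRange 𝔉.S := fun x =>
  mem_closure_of_tendsto (𝔉.P_tendsto x) (Eventually.of_forall fun n => ⟨𝔉.Q n x, 𝔉.S_Q n x⟩)

end GalerkinFrame

/-- The Hamiltonians `H f` of a quasilinear Schrödinger equation `i ∂ₜ (S f) = H f f`: symmetric,
Lipschitz in `S f`, and elliptic. -/
structure Admissible (𝔉 : GalerkinFrame E) (m b : ℝ) (Bd Lip Rel : ℝ → ℝ)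
    (H : E → E →L[ℂ] E) : Prop where
  Lip_nonneg : ∀ M, 0 ≤ Lip M
  symm : ∀ f x y, inner ℂ (𝔉.S x) (H f y) = inner ℂ (H f x) (𝔉.S y)
  bound : ∀ M f x, ‖f‖ ≤ M → ‖H f x‖ ≤ Bd M * ‖x‖
  lip : ∀ M f f' x, ‖f‖ ≤ M → ‖f'‖ ≤ M → ‖H f x - H f' x‖ ≤ Lip M * ‖x‖ * ‖𝔉.S f - 𝔉.S f'‖
  coer : ∀ n f, ‖𝔉.S f‖ ≤ m → 𝔉.P n f = f → ‖f‖ ≤ ‖𝔉.P n (H f f)‖ + b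
  rel : ∀ M f x, ‖f‖ ≤ M → ‖x‖ ≤ ‖H f x‖ + Rel M * ‖𝔉.S x‖

variable {𝔉 : GalerkinFrame E} {m b : ℝ} {Bd Lip Rel : ℝ → ℝ} {H : E → E →L[ℂ] E}

namespace Admissible

theorem lip_self (hH : Admissible 𝔉 m b Bd Lip Rel H) {M : ℝ} {f g : E} (hf : ‖f‖ ≤ M)
    (hg : ‖g‖ ≤ M) : ‖H f g - H g g‖ ≤ Lip M * M * ‖𝔉.S f - 𝔉.S g‖ := by
  refine (hH.lip M f g g hf hg).trans ?_
  have := hH.Lip_nonneg M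
  gcongr

/-- The energy estimate for the difference of two states. -/
theorem energy (hH : Admissible 𝔉 m b Bd Lip Rel H) {M : ℝ} {f g : E} (hf : ‖f‖ ≤ M)
    (hg : ‖g‖ ≤ M) :
    |(inner ℂ (𝔉.S f - 𝔉.S g) ((-I) • (H f f - H g g))).re|
      ≤ Lip M * M * ‖𝔉.S f - 𝔉.S g‖ ^ 2 := by
  -- The term `H f (f - g)` has a real pairing with `S (f - g)`, so it disappears after
  -- multiplication by `-i`. What remains is `(H f - H g) g`, which is Lipschitz in `S f - S g`.
  have e : H f f - H g g = H f (f - g) + (H f g - H g g) := by rw [map_sub]; abel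
  have hr : (inner ℂ (𝔉.S f - 𝔉.S g) (H f (f - g))).im = 0 := by
    rw [← map_sub, ← conj_eq_iff_im, inner_conj_symm]
    exact (hH.symm f _ _).symm
  have h1 : (inner ℂ (𝔉.S f - 𝔉.S g) ((-I) • (H f f - H g g))).re
      = (inner ℂ (𝔉.S f - 𝔉.S g) (H f g - H g g)).im := by
    rw [inner_smul_right, e, inner_add_right]
    simp only [neg_mul, neg_re, mul_re, I_re, I_im, add_re, add_im, hr]
    ring
  rw [h1]
  refine (abs_im_le_norm _).trans ((norm_inner_le_norm _ _).trans ?_)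
  have := hH.lip_self hf hg
  calc _ ≤ ‖𝔉.S f - 𝔉.S g‖ * (Lip M * M * ‖𝔉.S f - 𝔉.S g‖) := by gcongr
    _ = _ := by ring

end Admissible

/-- `f` solves the Galerkin approximation `i ∂ₜ (S f) = P n (H f f)` on `[a, b]`. -/
structure IsGalerkin (𝔉 : GalerkinFrame E) (H : E → E →L[ℂ] E) (n : ℕ) (a b : ℝ) (f : ℝ → E) :
    Prop where
  proj : ∀ t ∈ Icc a b, 𝔉.P n (f t) = f t
  deriv : ∀ t ∈ Icc a b, HasDerivWithinAt (fun τ => 𝔉.S (f τ)) ((-I) • 𝔉.P n (H (f t) (f t)))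
    (Icc a b) t

namespace IsGalerkin

theorem mono {n : ℕ} {a b a' b' : ℝ} {f : ℝ → E} (hf : IsGalerkin 𝔉 H n a b f)
    (h : Icc a' b' ⊆ Icc a b) : IsGalerkin 𝔉 H n a' b' f :=
  ⟨fun t ht => hf.proj t (h ht), fun t ht => (hf.deriv t (h ht)).mono h⟩

theorem shift {n : ℕ} {a b a' b' h : ℝ} {f : ℝ → E} (hf : IsGalerkin 𝔉 H n a b f)
    (hs : ∀ t ∈ Icc a' b', t + h ∈ Icc a b) : IsGalerkin 𝔉 H n a' b' (fun t => f (t + h)) := by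
  refine ⟨fun t ht => hf.proj _ (hs t ht), fun t ht => ?_⟩
  have h1 := (hf.deriv _ (hs t ht)).scomp t ((hasDerivWithinAt_id t (Icc a' b')).add_const h) hs
  simpa using! h1

/-- Only `S ∘ f` is differentiated in the equation; on the range of `P n` the bounded operator `Q n`
recovers `f` from it. -/
theorem continuousOn {n : ℕ} {a b : ℝ} {f : ℝ → E} (hf : IsGalerkin 𝔉 H n a b f) :
    ContinuousOn f (Icc a b) := by
  have h1 : ContinuousOn (fun t => 𝔉.Q n (𝔉.S (f t))) (Icc a b) := fun t ht =>
    (𝔉.Q n).continuous.continuousAt.comp_continuousWithinAt (hf.deriv t ht).continuousWithinAt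
  exact h1.congr fun t ht => by simp only [𝔉.Q_S, hf.proj t ht]

/-- Two Galerkin approximations of different orders. -/
theorem stability (hH : Admissible 𝔉 m b Bd Lip Rel H) {k n : ℕ} (hkn : k ≤ n) {a c M : ℝ}
    (hM : 0 ≤ M) {f g : ℝ → E} (hf : IsGalerkin 𝔉 H n a c f) (hg : IsGalerkin 𝔉 H k a c g)
    (hfM : ∀ t ∈ Icc a c, ‖f t‖ ≤ M) (hgM : ∀ t ∈ Icc a c, ‖g t‖ ≤ M) {ε : ℝ} (hε0 : 0 ≤ ε)
    (hε : ∀ t ∈ Icc a c, ‖𝔉.S (f t) - 𝔉.P k (𝔉.S (f t))‖ * ‖H (g t) (g t)‖ ≤ ε)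
    {s t : ℝ} (hs : s ∈ Icc a c) (ht : t ∈ Icc a c) :
    ‖𝔉.S (f t) - 𝔉.S (g t)‖ ^ 2 ≤ (‖𝔉.S (f s) - 𝔉.S (g s)‖ ^ 2 + 2 * ε * |t - s|)
      * Real.exp (2 * (Lip M * M) * |t - s|) := by
  have hL := hH.Lip_nonneg M
  refine gronwall_two_sided (y := fun t => ‖𝔉.S (f t) - 𝔉.S (g t)‖ ^ 2)
    (by positivity) (by positivity) (fun _ _ => by positivity)
    (fun τ hτ => hasDerivWithinAt_norm_sq ((hf.deriv τ hτ).sub (hg.deriv τ hτ)))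
    (fun τ hτ => ?_) hs ht
  set F := f τ
  set G := g τ
  have hPF : 𝔉.P n (𝔉.S F) = 𝔉.S F := by rw [← 𝔉.S_P, hf.proj τ hτ]
  have hPG : 𝔉.P k (𝔉.S G) = 𝔉.S G := by rw [← 𝔉.S_P, hg.proj τ hτ]
  have hPG' : 𝔉.P n (𝔉.S G) = 𝔉.S G := by rw [← hPG, 𝔉.P_P hkn]
  -- `P n` fixes both states, but `P k` fixes only `S G`. Moving the projections to the left leaves
  -- the energy term plus one defect, in which the tail `(1 - P k) S F` is paired with `H G G`.
  have e : inner ℂ (𝔉.S F - 𝔉.S G) ((-I) • 𝔉.P n (H F F) - (-I) • 𝔉.P k (H G G))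
      = inner ℂ (𝔉.S F - 𝔉.S G) ((-I) • (H F F - H G G))
        + (-I) * inner ℂ (𝔉.S F - 𝔉.P k (𝔉.S F)) (H G G) := by
    simp only [smul_sub, inner_sub_right, inner_smul_right, inner_sub_left, ← 𝔉.P_symm, map_sub, hPF, hPG,
      hPG']
    ring
  rw [e, add_re, abs_mul, abs_two]
  have h1 := hH.energy (hfM τ hτ) (hgM τ hτ)
  have h2 : |((-I) * inner ℂ (𝔉.S F - 𝔉.P k (𝔉.S F)) (H G G)).re| ≤ ε := by
    refine (abs_re_le_norm _).trans ?_
    rw [norm_mul, norm_neg, norm_I, one_mul]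
    exact (norm_inner_le_norm _ _).trans (hε τ hτ)
  have h3 := abs_add_le (inner ℂ (𝔉.S F - 𝔉.S G) ((-I) • (H F F - H G G))).re
    ((-I) * inner ℂ (𝔉.S F - 𝔉.P k (𝔉.S F)) (H G G)).re
  linarith

theorem stability_same (hH : Admissible 𝔉 m b Bd Lip Rel H) {n : ℕ} {a c M : ℝ}
    (hM : 0 ≤ M) {f g : ℝ → E} (hf : IsGalerkin 𝔉 H n a c f) (hg : IsGalerkin 𝔉 H n a c g)
    (hfM : ∀ t ∈ Icc a c, ‖f t‖ ≤ M) (hgM : ∀ t ∈ Icc a c, ‖g t‖ ≤ M)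
    {s t : ℝ} (hs : s ∈ Icc a c) (ht : t ∈ Icc a c) :
    ‖𝔉.S (f t) - 𝔉.S (g t)‖ ≤ Real.exp (Lip M * M * |t - s|) * ‖𝔉.S (f s) - 𝔉.S (g s)‖ := by
  have h := hf.stability hH le_rfl hM hg hfM hgM le_rfl
    (fun τ hτ => by rw [← 𝔉.S_P, hf.proj τ hτ, sub_self, norm_zero, zero_mul]) hs ht
  refine abs_le_of_sq_le_sq' ?_ (by positivity) |>.2
  rw [mul_pow, ← Real.exp_nat_mul]
  convert! h using 1
  rw [mul_zero, zero_mul, add_zero, mul_comm]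
  congr 2
  push_cast; ring

end IsGalerkin

/-- Serves to turn stability of the flow into a bound on its time derivative: `v` and `w` will be
increments of one orbit at two different times. -/
theorem norm_deriv_le_of_norm_sub_le {F : Type*} [NormedAddCommGroup F] [NormedSpace ℝ F]
    {v w : ℝ → F} {v' w' : F} {c : ℝ}
    (hv : HasDerivWithinAt v v' (Icc 0 1) 0) (hw : HasDerivWithinAt w w' (Icc 0 1) 0)
    (h : ∀ θ ∈ Ioo (0 : ℝ) 1, ‖v θ - v 0‖ ≤ c * ‖w θ - w 0‖) : ‖v'‖ ≤ c * ‖w'‖ := by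
  have hd : ∀ {x : ℝ → F} {x' : F}, HasDerivWithinAt x x' (Icc 0 1) 0 →
      Tendsto (fun θ => ‖slope x 0 θ‖) (𝓝[>] 0) (𝓝 ‖x'‖) := fun {x x'} hx => by
    have h1 : HasDerivWithinAt x x' (Ioi 0) 0 :=
      (hx.mono_of_mem_nhdsWithin (Icc_mem_nhdsGT (by norm_num)))
    rw [hasDerivWithinAt_iff_tendsto_slope' (by simp)] at h1
    exact h1.norm
  refine le_of_tendsto_of_tendsto (hd hv) ((hd hw).const_mul c) ?_
  filter_upwards [Ioo_mem_nhdsGT (show (0 : ℝ) < 1 by norm_num)] with θ hθ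
  rw [slope_def_module, slope_def_module, norm_smul, norm_smul]
  have := h θ hθ
  calc _ ≤ ‖(θ - 0)⁻¹‖ * (c * ‖w θ - w 0‖) := by gcongr
    _ = _ := by ring

/-- Continuation of a strict bound in both time directions. -/
theorem bootstrap {y : ℝ → ℝ} {T M : ℝ} (hy : ContinuousOn y (Icc (-T) T)) (h0 : y 0 < M)
    (h : ∀ t ∈ Icc (-T) T, (∀ s, |s| ≤ |t| → y s ≤ M) → y t < M) :
    ∀ t ∈ Icc (-T) T, y t < M := by
  by_contra! hc
  set A : Set ℝ := Icc (-T) T ∩ y ⁻¹' Ici M with hA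
  have hAc : IsCompact A :=
    isCompact_Icc.of_isClosed_subset (hy.preimage_isClosed_of_isClosed isClosed_Icc isClosed_Ici)
      inter_subset_left
  obtain ⟨t, ht, htM⟩ := hc
  -- A point closest to `0` at which the bound fails.
  obtain ⟨τ, hτ, hmin⟩ := hAc.exists_isMinOn ⟨t, ht, htM⟩ continuous_abs.continuousOn
  have hlt : ∀ s, |s| < |τ| → y s < M := fun s hs => by
    by_contra! hc
    have hsI : s ∈ Icc (-T) T := abs_le.1 (hs.le.trans (abs_le.2 hτ.1))
    exact absurd (hmin (show s ∈ A from ⟨hsI, hc⟩)) (not_le.2 hs)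
  refine absurd (h τ hτ.1 fun s hs => ?_) (not_lt.2 hτ.2)
  rcases hs.lt_or_eq with hs | hs
  · exact (hlt s hs).le
  have hsI : s ∈ Icc (-T) T := abs_le.1 (hs.le.trans (abs_le.2 hτ.1))
  have hτ0 : 0 < |τ| := abs_pos.2 fun h => by
    have := hτ.2; rw [h] at this; exact absurd h0 (not_lt.2 this)
  -- At the end points `s = ±τ` the bound is not yet known; its non-strict form follows by letting
  -- `θ s` tend to `s` from inside.
  have hc : Tendsto (fun θ : ℝ => y (θ * s)) (𝓝[<] 1) (𝓝 (y s)) := by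
    have h1 : Tendsto (fun θ : ℝ => θ * s) (𝓝[<] 1) (𝓝[Icc (-T) T] s) := by
      refine tendsto_nhdsWithin_iff.2 ⟨?_, ?_⟩
      · have : Tendsto (fun θ : ℝ => θ * s) (𝓝 1) (𝓝 (1 * s)) :=
          (continuous_id.mul continuous_const).tendsto 1
        rw [one_mul] at this
        exact this.mono_left nhdsWithin_le_nhds
      · filter_upwards [Ioo_mem_nhdsLT (show (0 : ℝ) < 1 by norm_num)] with θ hθ
        refine abs_le.1 ?_
        rw [abs_mul, abs_of_pos hθ.1]
        have := abs_le.2 hsI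
        nlinarith [hθ.2, abs_nonneg s]
    exact (hy s hsI).tendsto.comp h1
  refine le_of_tendsto hc ?_
  filter_upwards [Ioo_mem_nhdsLT (show (0 : ℝ) < 1 by norm_num)] with θ hθ
  refine (hlt _ ?_).le
  rw [abs_mul, abs_of_pos hθ.1, hs]
  nlinarith [hθ.2]

namespace IsGalerkin

/-- The time derivative grows at most exponentially. -/
theorem deriv_bound (hH : Admissible 𝔉 m b Bd Lip Rel H) {n : ℕ} {T M s : ℝ} (hM : 0 ≤ M)
    {f : ℝ → E} (hf : IsGalerkin 𝔉 H n (-T) T f) (hs : s ∈ Icc (-T) T)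
    (hfM : ∀ τ, |τ| ≤ |s| → ‖f τ‖ ≤ M) :
    ‖𝔉.P n (H (f s) (f s))‖ ≤ Real.exp (Lip M * M * |s|) * ‖𝔉.P n (H (f 0) (f 0))‖ := by
  rcases eq_or_ne s 0 with rfl | hs0
  · simp
  have hI : ∀ τ, |τ| ≤ |s| → τ ∈ Icc (-T) T := fun τ hτ => abs_le.1 (hτ.trans (abs_le.2 hs))
  -- The translation by `-θ s` moves both `0` and `s` inside the interval `|τ| ≤ |s|`, where `f` is
  -- bounded by `M`, for every `0 ≤ θ ≤ 1` only after restricting to these two base points; the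
  -- condition on `τ - s` expresses this.
  have hder : ∀ τ, |τ| ≤ |s| → |τ - s| ≤ |s| → HasDerivWithinAt (fun θ => 𝔉.S (f (τ - θ * s)))
      ((-s) • ((-I) • 𝔉.P n (H (f τ) (f τ)))) (Icc 0 1) 0 := fun τ hτ hτs => by
    have h1 : HasDerivWithinAt (fun θ : ℝ => τ - θ * s) (-s) (Icc 0 1) 0 := by
      simpa using ((hasDerivWithinAt_id (0 : ℝ) (Icc 0 1)).mul_const s).const_sub τ
    have h2 := (hf.deriv τ (hI τ hτ))
    have h3 : HasDerivWithinAt (fun τ => 𝔉.S (f τ)) ((-I) • 𝔉.P n (H (f τ) (f τ)))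
      (Icc (-T) T) ((fun θ : ℝ => τ - θ * s) 0) := by simpa using! h2
    refine h3.scomp 0 h1 fun θ hθ => hI _ ?_
    have e : τ - θ * s = (1 - θ) * τ + θ * (τ - s) := by ring
    simp only [e]
    refine (abs_add_le _ _).trans ?_
    rw [abs_mul, abs_mul, abs_of_nonneg hθ.1, abs_of_nonneg (sub_nonneg.2 hθ.2)]
    nlinarith [hθ.1, hθ.2]
  have h := norm_deriv_le_of_norm_sub_le (c := Real.exp (Lip M * M * |s|))
    (hder s le_rfl (by simp)) (hder 0 (by simp) (by simp)) fun θ hθ => by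
      have hsub : ∀ τ ∈ Icc (min 0 s) (max 0 s), |τ| ≤ |s| := fun τ hτ => by
        rcases le_total 0 s with h | h
        · rw [min_eq_left h, max_eq_right h] at hτ
          rw [abs_of_nonneg h, abs_of_nonneg hτ.1]; exact hτ.2
        · rw [min_eq_right h, max_eq_left h] at hτ
          rw [abs_of_nonpos h, abs_of_nonpos hτ.2]; linarith [hτ.1]
      have hsub' : ∀ τ ∈ Icc (min 0 s) (max 0 s), |τ + (-(θ * s))| ≤ |s| := fun τ hτ => by
        rcases le_total 0 s with h | h
        · rw [min_eq_left h, max_eq_right h] at hτ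
          rw [abs_of_nonneg h]
          exact abs_le.2 ⟨by nlinarith [hτ.1, hτ.2, hθ.1, hθ.2], by nlinarith [hτ.1, hτ.2, hθ.1]⟩
        · rw [min_eq_right h, max_eq_left h] at hτ
          rw [abs_of_nonpos h]
          exact abs_le.2 ⟨by nlinarith [hτ.1, hτ.2, hθ.1, hθ.2], by nlinarith [hτ.1, hτ.2, hθ.2]⟩
      -- The equation is autonomous, so the translate is again a Galerkin solution. Stability
      -- compares it with `f` at the times `0` and `s`.
      have h1 := (hf.shift (h := -(θ * s)) fun τ hτ => hI _ (hsub' τ hτ)).stability_same hH hM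
        (hf.mono fun τ hτ => hI _ (hsub τ hτ)) (fun τ hτ => hfM _ (hsub' τ hτ))
        (fun τ hτ => hfM _ (hsub τ hτ)) (s := 0) (t := s)
        ⟨min_le_left _ _, le_max_left _ _⟩ ⟨min_le_right _ _, le_max_right _ _⟩
      simpa [sub_eq_add_neg] using h1
  have e : ∀ x : E, ‖(-s) • ((-I) • x)‖ = |s| * ‖x‖ := fun x => by
    rw [norm_smul, norm_smul]; simp
  rw [e, e] at h
  have hpos := abs_pos.2 hs0
  refine le_of_mul_le_mul_left ?_ hpos
  linarith

end IsGalerkin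

/-- In the variable `u = S f` the truncated equation is the ordinary differential equation `u' = -i
P n (H (Q n u) (Q n u))`. It is locally Lipschitz since `Q n` is bounded, and symmetry of `H` makes
it norm preserving. -/
theorem Admissible.exists_galerkin (hH : Admissible 𝔉 m b Bd Lip Rel H) (n : ℕ) {f₀ : E}
    (hf₀ : 𝔉.P n f₀ = f₀) {T : ℝ} (hT : 0 ≤ T) :
    ∃ f : ℝ → E, f 0 = f₀ ∧ IsGalerkin 𝔉 H n (-T) T f ∧
      ∀ t ∈ Icc (-T) T, ‖𝔉.S (f t)‖ = ‖𝔉.S f₀‖ := by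
  set G : E → E := fun u => (-I) • 𝔉.P n (H (𝔉.Q n u) (𝔉.Q n u)) with hG
  have hlip : ∀ r : ℝ, ∃ K : ℝ, ∀ u v, ‖u‖ ≤ r → ‖v‖ ≤ r → ‖G u - G v‖ ≤ K * ‖u - v‖ := by
    intro r
    set q := ‖𝔉.Q n‖
    set M := q * r
    refine ⟨Lip M * M + |Bd M| * q, fun u v hu hv => ?_⟩
    have hq : ∀ x, ‖x‖ ≤ r → ‖𝔉.Q n x‖ ≤ M := fun x hx =>
      ((𝔉.Q n).le_opNorm x).trans (mul_le_mul_of_nonneg_left hx (norm_nonneg _))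
    have hr : 0 ≤ r := (norm_nonneg u).trans hu
    have hM : 0 ≤ M := by positivity
    have hL := hH.Lip_nonneg M
    rw [hG]
    simp only
    rw [← smul_sub, norm_smul, norm_neg, norm_I, one_mul, ← map_sub]
    refine (𝔉.P_le n _).trans ?_
    have e : H (𝔉.Q n u) (𝔉.Q n u) - H (𝔉.Q n v) (𝔉.Q n v)
        = H (𝔉.Q n u) (𝔉.Q n (u - v)) + (H (𝔉.Q n u) (𝔉.Q n v) - H (𝔉.Q n v) (𝔉.Q n v)) := by
      simp only [map_sub]; abel
    rw [e]
    refine (norm_add_le _ _).trans ?_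
    have h1 : ‖H (𝔉.Q n u) (𝔉.Q n (u - v))‖ ≤ |Bd M| * (q * ‖u - v‖) := by
      refine (hH.bound M _ _ (hq u hu)).trans ?_
      gcongr
      · exact le_abs_self _
      · exact (𝔉.Q n).le_opNorm _
    have h2 := hH.lip_self (hq u hu) (hq v hv)
    rw [𝔉.S_Q, 𝔉.S_Q, ← map_sub] at h2
    have h3 : Lip M * M * ‖𝔉.P n (u - v)‖ ≤ Lip M * M * ‖u - v‖ := by
      gcongr; exact 𝔉.P_le n _
    linarith
  have hre : ∀ u, (inner ℂ u (G u)).re = 0 := fun u => by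
    have hr : (inner ℂ (𝔉.P n u) (H (𝔉.Q n u) (𝔉.Q n u))).im = 0 := by
      rw [← 𝔉.S_Q, ← conj_eq_iff_im, inner_conj_symm]
      exact (hH.symm _ _ _).symm
    rw [hG]
    simp only
    rw [inner_smul_right, ← 𝔉.P_symm]
    simp [hr]
  obtain ⟨u, hu0, hu⟩ := exists_flow_of_norm_preserving G hlip hre (𝔉.S f₀) hT
  have h0 : (0 : ℝ) ∈ Icc (-T) T := ⟨by linarith, hT⟩
  -- The range of `P n` is invariant: the vector field takes values in it, so `u - P n u` is
  -- constant in time.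
  have hPu : ∀ t ∈ Icc (-T) T, 𝔉.P n (u t) = u t := by
    have hd : ∀ t ∈ Icc (-T) T,
        HasDerivWithinAt (fun τ => u τ - 𝔉.P n (u τ)) 0 (Icc (-T) T) t := fun t ht => by
      have h1 := (hu t ht).1
      have h2 := ((𝔉.P n).restrictScalars ℝ).hasFDerivAt.comp_hasDerivWithinAt t h1
      have h3 := h1.sub h2
      have e : G (u t) - ((𝔉.P n).restrictScalars ℝ) (G (u t)) = 0 := by
        simp [hG, 𝔉.P_P le_rfl]
      rw [e] at h3
      exact h3
    intro t ht
    have h := (convex_Icc (-T) T).norm_image_sub_le_of_norm_hasDerivWithin_le (C := 0)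
      hd (by simp) h0 ht
    simp only [zero_mul, norm_le_zero_iff, sub_eq_zero, hu0, ← 𝔉.S_P, hf₀, sub_self] at h
    exact h.symm
  refine ⟨fun t => 𝔉.Q n (u t), by simp [hu0, 𝔉.Q_S, hf₀], ⟨fun t _ => 𝔉.P_Q le_rfl _,
    fun t ht => ?_⟩, fun t ht => by rw [𝔉.S_Q, hPu t ht, (hu t ht).2]⟩
  exact (hu t ht).1.congr (fun τ hτ => by rw [𝔉.S_Q, hPu τ hτ]) (by rw [𝔉.S_Q, hPu t ht])

/-- Galerkin approximations on a common time interval with a common bound. -/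
theorem exists_galerkin_uniform (m b : ℝ) (Bd Lip : ℝ → ℝ) (hLip : ∀ M, 0 ≤ Lip M) (M₂ : ℝ) :
    ∃ T M : ℝ, 0 < T ∧ 0 ≤ M ∧ ∀ (Rel : ℝ → ℝ) (H : E → E →L[ℂ] E),
      Admissible 𝔉 m b Bd Lip Rel H → ∀ f₀, ‖𝔉.S f₀‖ ≤ m → ‖f₀‖ ≤ M₂ → ∀ n,
      ∃ f : ℝ → E, f 0 = 𝔉.P n f₀ ∧ IsGalerkin 𝔉 H n (-T) T f ∧
        ∀ t ∈ Icc (-T) T, ‖𝔉.S (f t)‖ ≤ m ∧ ‖f t‖ ≤ M ∧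
          ‖𝔉.P n (H (f t) (f t))‖ ≤ Real.exp (Lip M * M * |t|)
            * ‖𝔉.P n (H (f 0) (f 0))‖ := by
  set Y : ℝ := |Bd M₂| * |M₂| with hY
  -- `Y` bounds the initial time derivative. As long as that derivative has at most doubled,
  -- coercivity gives `‖f‖ ≤ 2 Y + b < M`.
  set M : ℝ := max |M₂| (|2 * Y + b|) + 1 with hMdef
  have hM : 0 ≤ M := by positivity
  have hLM := hLip M
  -- On this interval the exponential growth factor of the time derivative is at most `2`.
  set T : ℝ := Real.log 2 / (Lip M * M + 1) with hT
  have hT0 : 0 < T := div_pos (Real.log_pos (by norm_num)) (by positivity)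
  refine ⟨T, M, hT0, hM, fun Rel H hH f₀ hm hf₀ n => ?_⟩
  obtain ⟨f, hf0, hf, hn⟩ := hH.exists_galerkin n (𝔉.P_P le_rfl f₀) hT0.le
  have hSP : ‖𝔉.S (𝔉.P n f₀)‖ ≤ m := by rw [𝔉.S_P]; exact (𝔉.P_le n _).trans hm
  have hPM : ‖𝔉.P n f₀‖ ≤ M₂ := (𝔉.P_le n _).trans hf₀
  have hY0 : ‖𝔉.P n (H (f 0) (f 0))‖ ≤ Y := by
    rw [hf0]
    refine (𝔉.P_le n _).trans ((hH.bound M₂ _ _ hPM).trans ?_)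
    rw [hY]
    gcongr
    · exact le_abs_self _
    · exact hPM.trans (le_abs_self _)
  have hbd : ∀ t ∈ Icc (-T) T, ‖f t‖ < M := by
    refine bootstrap hf.continuousOn.norm ?_ fun t ht hs => ?_
    · rw [hf0]
      have h1 : |M₂| ≤ max |M₂| (|2 * Y + b|) := le_max_left _ _
      have h2 := le_abs_self M₂
      linarith
    · have h1 := hf.deriv_bound hH hM ht hs
      have h2 : Real.exp (Lip M * M * |t|) ≤ 2 := by
        rw [← Real.le_log_iff_exp_le (by norm_num)]
        have h3 : |t| ≤ T := abs_le.2 ht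
        calc Lip M * M * |t| ≤ (Lip M * M + 1) * T := by
              gcongr; linarith
          _ = Real.log 2 := by rw [hT]; field_simp
      have h3 := hH.coer n (f t) (by rw [hn t ht]; exact hSP) (hf.proj t ht)
      have h4 : |2 * Y + b| ≤ max |M₂| (|2 * Y + b|) := le_max_right _ _
      have h5 := le_abs_self (2 * Y + b)
      have h6 : Real.exp (Lip M * M * |t|) * ‖𝔉.P n (H (f 0) (f 0))‖ ≤ 2 * Y := by gcongr
      linarith
  refine ⟨f, hf0, hf, fun t ht => ⟨by rw [hn t ht]; exact hSP, (hbd t ht).le,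
    hf.deriv_bound hH hM ht fun τ hτ => (hbd τ ?_).le⟩⟩
  exact abs_le.1 (hτ.trans (abs_le.2 ht))

end CSS

/-! ### Compactness in the frame and uniqueness of weak solutions. -/

open MeasureTheory Complex Filter Topology Set
open scoped LineDeriv SchwartzMap ComplexConjugate

namespace CSS

set_option linter.unusedSectionVars false

variable {E : Type*} [NormedAddCommGroup E] [InnerProductSpace ℂ E] [NormedSpace ℝ E]
  [IsScalarTower ℝ ℂ E] [CompleteSpace E]

theorem re_inner_comm (x y : E) : RCLike.re (inner ℂ x y) = (inner ℂ y x).re := by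
  rw [← inner_conj_symm]; exact conj_re _

namespace GalerkinFrame

variable (𝔉 : GalerkinFrame E)

/-- The image under `S` of a ball is closed. -/
theorem exists_of_tendsto {ι : Type*} {l : Filter ι} [l.NeBot] {x : ι → E} {M : ℝ}
    (hx : ∀ᶠ i in l, ‖x i‖ ≤ M) {u : E} (hu : Tendsto (fun i => 𝔉.S (x i)) l (𝓝 u)) :
    ∃ f, ‖f‖ ≤ M ∧ 𝔉.S f = u := by
  have hQ : ∀ k, ‖𝔉.Q k u‖ ≤ M := fun k => by
    have h1 : Tendsto (fun i => ‖𝔉.Q k (𝔉.S (x i))‖) l (𝓝 ‖𝔉.Q k u‖) :=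
      (((𝔉.Q k).continuous.tendsto u).comp hu).norm
    refine le_of_tendsto h1 (hx.mono fun i hi => ?_)
    rw [𝔉.Q_S]
    exact (𝔉.P_le k _).trans hi
  have hPQ : ∀ {j k}, j ≤ k → 𝔉.P j (𝔉.Q k u) = 𝔉.Q j u := fun {j k} hjk => by
    apply 𝔉.S_injective
    rw [𝔉.S_P, 𝔉.S_Q, 𝔉.S_Q, 𝔉.P_P' hjk]
  -- Pythagoras: `Q j u` is the orthogonal projection of `Q k u`. Hence the norms increase to a
  -- finite limit, which makes the sequence Cauchy.
  have hsq : ∀ {j k}, j ≤ k → ‖𝔉.Q k u - 𝔉.Q j u‖ ^ 2 = ‖𝔉.Q k u‖ ^ 2 - ‖𝔉.Q j u‖ ^ 2 :=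
    fun {j k} hjk => by
    have e : inner ℂ (𝔉.Q k u) (𝔉.Q j u) = inner ℂ (𝔉.Q j u) (𝔉.Q j u) := by
      conv_lhs => rw [← hPQ hjk, ← 𝔉.P_P le_rfl, ← 𝔉.P_symm, hPQ hjk]
    have h := @norm_sub_sq ℂ E _ _ _ (𝔉.Q k u) (𝔉.Q j u)
    rw [e] at h
    have h2 : RCLike.re (inner ℂ (𝔉.Q j u) (𝔉.Q j u)) = ‖𝔉.Q j u‖ ^ 2 :=
      (norm_sq_eq_re_inner (𝕜 := ℂ) (𝔉.Q j u)).symm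
    rw [h2] at h
    linarith
  have hM : 0 ≤ M := (norm_nonneg _).trans (hQ 0)
  have hmono : Monotone fun k => ‖𝔉.Q k u‖ ^ 2 := fun j k hjk => by
    have := hsq hjk
    have h2 := sq_nonneg ‖𝔉.Q k u - 𝔉.Q j u‖
    linarith
  have hbdd : BddAbove (range fun k => ‖𝔉.Q k u‖ ^ 2) :=
    ⟨M ^ 2, by rintro _ ⟨k, rfl⟩; exact pow_le_pow_left₀ (norm_nonneg _) (hQ k) 2⟩
  have hA := tendsto_atTop_ciSup hmono hbdd
  set A := ⨆ k, ‖𝔉.Q k u‖ ^ 2 with hAdef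
  have hcauchy : CauchySeq fun k => 𝔉.Q k u := by
    refine cauchySeq_of_le_tendsto_0' (fun k => Real.sqrt (A - ‖𝔉.Q k u‖ ^ 2)) (fun j k hjk => ?_)
      ?_
    · rw [dist_comm, dist_eq_norm]
      refine Real.le_sqrt_of_sq_le ?_
      rw [hsq hjk]
      have := le_ciSup hbdd k
      linarith
    · have := (hA.const_sub A).sqrt
      simpa using this
  obtain ⟨f, hf⟩ := cauchySeq_tendsto_of_complete hcauchy
  refine ⟨f, le_of_tendsto' hf.norm hQ, ?_⟩
  have h1 : Tendsto (fun k => 𝔉.S (𝔉.Q k u)) atTop (𝓝 (𝔉.S f)) := (𝔉.S.continuous.tendsto f).comp hf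
  simp only [𝔉.S_Q] at h1
  exact tendsto_nhds_unique h1 (𝔉.P_tendsto u)

/-- Test with `P n g = S (Q n g)` and let `n` tend to infinity. -/
theorem norm_le_of_inner_le {g : E} {c : ℝ} (hc : 0 ≤ c)
    (h : ∀ x, ‖inner ℂ (𝔉.S x) g‖ ≤ ‖𝔉.S x‖ * c) :
    ‖g‖ ≤ c := by
  have h1 : Tendsto (fun n => ‖inner ℂ (𝔉.P n g) g‖) atTop (𝓝 ‖inner ℂ g g‖) :=
    ((𝔉.P_tendsto g).inner tendsto_const_nhds).norm
  have h2 : Tendsto (fun n => ‖𝔉.P n g‖ * c) atTop (𝓝 (‖g‖ * c)) :=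
    (𝔉.P_tendsto g).norm.mul_const c
  have h3 : ‖inner ℂ g g‖ ≤ ‖g‖ * c := le_of_tendsto_of_tendsto' h1 h2 fun n => by
    rw [← 𝔉.S_Q]; exact h _
  have h4 : ‖inner ℂ g g‖ = ‖g‖ * ‖g‖ := by
    rw [inner_self_eq_norm_sq_to_K, norm_pow]; simp [sq]
  rw [h4] at h3
  rcases (norm_nonneg g).eq_or_lt with h0 | h0
  · rwa [← h0]
  · exact le_of_mul_le_mul_left h3 h0

/-- Weak convergence together with convergence of norms is strong convergence. -/
theorem tendsto_of_weak {ι : Type*} {l : Filter ι} {q : ι → E} {g : E} {c : ι → ℝ}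
    (hc : Tendsto c l (𝓝 ‖g‖)) (hq : ∀ᶠ i in l, ‖q i‖ ≤ c i)
    (hw : ∀ x, Tendsto (fun i => inner ℂ (𝔉.S x) (q i)) l (𝓝 (inner ℂ (𝔉.S x) g))) :
    Tendsto q l (𝓝 g) := by
  rw [tendsto_iff_norm_sub_tendsto_zero]
  have key : Tendsto (fun i => ‖q i - g‖ ^ 2) l (𝓝 0) := by
    rw [Metric.tendsto_nhds]
    intro ε hε
    set η : ℝ := ε / (8 * (‖g‖ + 1)) with hη
    -- Weak convergence is known only against the range of `S`. Replacing `g` by a nearby `S x`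
    -- costs an error proportional to `η`, chosen so that `4 η ‖g‖ < ε`.
    have hg1 : 0 < ‖g‖ + 1 := by positivity
    have hη0 : 0 < η := by positivity
    obtain ⟨x, hx⟩ : ∃ x, ‖g - 𝔉.S x‖ < η := by
      obtain ⟨x, hx⟩ := 𝔉.denseRange_S.exists_dist_lt g hη0
      exact ⟨x, by rwa [dist_eq_norm] at hx⟩
    have h1 : Tendsto (fun i => c i ^ 2 - 2 * (inner ℂ (𝔉.S x) (q i)).re + ‖g‖ ^ 2 + 2 * η * c i) l
        (𝓝 (‖g‖ ^ 2 - 2 * (inner ℂ (𝔉.S x) g).re + ‖g‖ ^ 2 + 2 * η * ‖g‖)) :=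
      ((((hc.pow 2).sub (((continuous_re.tendsto _).comp (hw x)).const_mul 2)).add_const _).add
        (hc.const_mul _))
    have h2 : ‖g‖ ^ 2 - 2 * (inner ℂ (𝔉.S x) g).re + ‖g‖ ^ 2 + 2 * η * ‖g‖ < ε := by
      have e : (inner ℂ (𝔉.S x) g).re = ‖g‖ ^ 2 - (inner ℂ (g - 𝔉.S x) g).re := by
        rw [inner_sub_left, sub_re]
        have : (inner ℂ g g).re = ‖g‖ ^ 2 := (norm_sq_eq_re_inner (𝕜 := ℂ) g).symm
        rw [this]; ring
      have h3 : (inner ℂ (g - 𝔉.S x) g).re ≤ η * ‖g‖ :=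
        (re_le_norm _).trans ((norm_inner_le_norm _ _).trans (by gcongr))
      have h4 : 4 * (η * ‖g‖) < ε := by
        have : η * (‖g‖ + 1) = ε / 8 := by rw [hη]; field_simp
        nlinarith
      linarith
    filter_upwards [h1.eventually_lt_const h2, hq] with i hi hqi
    rw [Real.dist_eq, sub_zero, abs_of_nonneg (sq_nonneg _)]
    refine lt_of_le_of_lt ?_ hi
    have e1 : ‖q i - g‖ ^ 2 = ‖q i‖ ^ 2 - 2 * (inner ℂ g (q i)).re + ‖g‖ ^ 2 := by
      have := @norm_sub_sq ℂ E _ _ _ (q i) g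
      rw [this, re_inner_comm]
    have e2 : (inner ℂ g (q i)).re = (inner ℂ (𝔉.S x) (q i)).re + (inner ℂ (g - 𝔉.S x) (q i)).re := by
      rw [inner_sub_left, sub_re]; ring
    have h3 : -(inner ℂ (g - 𝔉.S x) (q i)).re ≤ η * c i := by
      refine (neg_le_abs _).trans ((abs_re_le_norm _).trans ((norm_inner_le_norm _ _).trans ?_))
      gcongr
    have h4 : ‖q i‖ ^ 2 ≤ c i ^ 2 := by gcongr
    rw [e1, e2]
    linarith
  have := key.sqrt
  simpa using this

end GalerkinFrame

variable {𝔉 : GalerkinFrame E} {m b : ℝ} {Bd Lip Rel : ℝ → ℝ} {H : E → E →L[ℂ] E}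

/-- Bounded solutions of `i ∂ₜ (S f) = H f f` on `(-T, T)` in the weak sense. -/
structure IsWeakSolution (𝔉 : GalerkinFrame E) (H : E → E →L[ℂ] E) (m M Y T : ℝ) (f : ℝ → E) :
    Prop where
  bound : ∀ t ∈ Icc (-T) T, ‖f t‖ ≤ M
  mass : ∀ t ∈ Icc (-T) T, ‖𝔉.S (f t)‖ ≤ m
  lipschitz : ∀ s ∈ Icc (-T) T, ∀ t ∈ Icc (-T) T, ‖𝔉.S (f t) - 𝔉.S (f s)‖ ≤ Y * |t - s|
  deriv : ∀ x, ∀ t ∈ Ioo (-T) T, HasDerivAt (fun τ => inner ℂ (𝔉.S x) (𝔉.S (f τ)))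
    (inner ℂ (𝔉.S x) ((-I) • H (f t) (f t))) t

/-- Expand `‖w τ‖² = 2 Re ⟨w t, w τ⟩ - ‖w t‖² + ‖w τ - w t‖²`. The last term is `O(|τ - t|²)` by the
Lipschitz bound, so differentiability against the single vector `w t` suffices. -/
theorem hasDerivAt_norm_sq_of_weak {w : ℝ → E} {t Y : ℝ} {d : ℂ}
    (hY : ∀ᶠ τ in 𝓝 t, ‖w τ - w t‖ ≤ Y * |τ - t|)
    (hd : HasDerivAt (fun τ => inner ℂ (w t) (w τ)) d t) :
    HasDerivAt (fun τ => ‖w τ‖ ^ 2) (2 * d.re) t := by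
  have e : (fun τ => ‖w τ‖ ^ 2)
      = fun τ => (2 * (inner ℂ (w t) (w τ)).re - ‖w t‖ ^ 2) + ‖w τ - w t‖ ^ 2 := by
    funext τ
    have := @norm_sub_sq ℂ E _ _ _ (w τ) (w t)
    rw [this, re_inner_comm]
    simp
  have h1 : HasDerivAt (fun τ => 2 * (inner ℂ (w t) (w τ)).re - ‖w t‖ ^ 2) (2 * d.re) t :=
    ((reCLM.hasFDerivAt.comp_hasDerivAt t hd).const_mul 2).sub_const _
  have h2 : HasDerivAt (fun τ => ‖w τ - w t‖ ^ 2) 0 t := by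
    rw [hasDerivAt_iff_isLittleO]
    simp only [sub_self, norm_zero, smul_zero, sub_zero]
    have h3 : (fun τ => ‖w τ - w t‖ ^ 2 - 0 ^ 2) =O[𝓝 t] fun τ => (τ - t) ^ 2 := by
      refine Asymptotics.IsBigO.of_bound (Y ^ 2) (hY.mono fun τ hτ => ?_)
      rw [Real.norm_eq_abs, Real.norm_eq_abs, abs_pow, ← mul_pow, zero_pow two_ne_zero, sub_zero,
        abs_pow, abs_norm]
      gcongr
    refine h3.trans_isLittleO ?_
    have h4 : (fun τ : ℝ => (τ - t) ^ 2) =o[𝓝 t] fun τ => (τ - t) ^ 1 := by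
      have h5 : Tendsto (fun τ : ℝ => τ - t) (𝓝 t) (𝓝 0) := by
        have : Tendsto (fun τ : ℝ => τ - t) (𝓝 t) (𝓝 (t - t)) :=
          (continuous_id.sub continuous_const).tendsto t
        rwa [sub_self] at this
      exact (Asymptotics.isLittleO_pow_pow (one_lt_two)).comp_tendsto h5
    simpa using h4
  rw [e]
  simpa using! h1.add h2

namespace IsWeakSolution

theorem shift {M Y T s : ℝ} {f : ℝ → E} (hf : IsWeakSolution 𝔉 H m M Y T f) {T' : ℝ}
    (hT : T' ≤ T - |s|) : IsWeakSolution 𝔉 H m M Y T' (fun t => f (t + s)) := by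
  have hI : ∀ t ∈ Icc (-T') T', t + s ∈ Icc (-T) T := fun t ht => by
    have h1 := le_abs_self s
    have h2 := neg_abs_le s
    exact ⟨by linarith [ht.1], by linarith [ht.2]⟩
  have hI' : ∀ t ∈ Ioo (-T') T', t + s ∈ Ioo (-T) T := fun t ht => by
    have h1 := le_abs_self s
    have h2 := neg_abs_le s
    exact ⟨by linarith [ht.1], by linarith [ht.2]⟩
  refine ⟨fun t ht => hf.bound _ (hI t ht), fun t ht => hf.mass _ (hI t ht),
    fun r hr t ht => ?_, fun x t ht => ?_⟩
  · have := hf.lipschitz _ (hI r hr) _ (hI t ht)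
    simpa using this
  · exact (hf.deriv x _ (hI' t ht)).comp_add_const t s

theorem mono {M M' Y T T' : ℝ} {f : ℝ → E} (hf : IsWeakSolution 𝔉 H m M Y T f) (hM : M ≤ M')
    (hT : T' ≤ T) : IsWeakSolution 𝔉 H m M' Y T' f := by
  have := hf.shift (s := 0) (T' := T') (by simpa using hT)
  simp only [add_zero] at this
  exact ⟨fun t ht => (this.bound t ht).trans hM, this.mass, this.lipschitz, this.deriv⟩

/-- The energy estimate needs only the derivative of the squared norm. A weak formulation provides
it, because the required test vector `S (f t - g t)` lies in the range of `S`. -/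
theorem unique (hH : Admissible 𝔉 m b Bd Lip Rel H) {M Y Y' T : ℝ} {f g : ℝ → E}
    (hf : IsWeakSolution 𝔉 H m M Y T f) (hg : IsWeakSolution 𝔉 H m M Y' T g) (h0 : f 0 = g 0) :
    ∀ t ∈ Ioo (-T) T, f t = g t := by
  intro t ht
  have hT : 0 < T := by linarith [ht.1, ht.2]
  have hsub : ∀ τ ∈ Icc (min 0 t) (max 0 t), τ ∈ Ioo (-T) T := fun τ hτ =>
    ⟨lt_of_lt_of_le (lt_min (by linarith) ht.1) hτ.1, lt_of_le_of_lt hτ.2 (max_lt hT ht.2)⟩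
  have hM : 0 ≤ M := (norm_nonneg _).trans (hf.bound t (Ioo_subset_Icc_self ht))
  have hLM := hH.Lip_nonneg M
  have h := gronwall_two_sided (y := fun t => ‖𝔉.S (f t) - 𝔉.S (g t)‖ ^ 2)
    (y' := fun t => 2 * (inner ℂ (𝔉.S (f t) - 𝔉.S (g t))
      ((-I) • (H (f t) (f t) - H (g t) (g t)))).re) (a := min 0 t) (b := max 0 t)
    (K := 2 * (Lip M * M)) (ε := 0)
    (by positivity) le_rfl (fun _ _ => by positivity)
    (fun τ hτ => by
      have hτ' := hsub τ hτ
      refine (hasDerivAt_norm_sq_of_weak (w := fun t => 𝔉.S (f t) - 𝔉.S (g t)) (Y := Y + Y')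
        ?_ ?_).hasDerivWithinAt
      · filter_upwards [Ioo_mem_nhds hτ'.1 hτ'.2] with σ hσ
        have h1 := hf.lipschitz τ (Ioo_subset_Icc_self hτ') σ (Ioo_subset_Icc_self hσ)
        have h2 := hg.lipschitz τ (Ioo_subset_Icc_self hτ') σ (Ioo_subset_Icc_self hσ)
        have e : 𝔉.S (f σ) - 𝔉.S (g σ) - (𝔉.S (f τ) - 𝔉.S (g τ))
            = (𝔉.S (f σ) - 𝔉.S (f τ)) - (𝔉.S (g σ) - 𝔉.S (g τ)) := by abel
        rw [e]
        refine (norm_sub_le _ _).trans ?_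
        linarith
      · have h1 := (hf.deriv (f τ - g τ) τ hτ').sub (hg.deriv (f τ - g τ) τ hτ')
        rw [← inner_sub_right, ← smul_sub, map_sub] at h1
        refine h1.congr_of_eventuallyEq (Eventually.of_forall fun σ => ?_)
        simp only [inner_sub_right, Pi.sub_apply])
    (fun τ hτ => by
      have hτ' := Ioo_subset_Icc_self (hsub τ hτ)
      have := hH.energy (hf.bound τ hτ') (hg.bound τ hτ')
      rw [abs_mul, abs_two]
      linarith)
    (s := 0) (t := t) ⟨min_le_left _ _, le_max_left _ _⟩ ⟨min_le_right _ _, le_max_right _ _⟩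
  simp only [h0, sub_self, norm_zero, zero_mul, add_zero, ne_eq, OfNat.ofNat_ne_zero,
    not_false_eq_true, zero_pow] at h
  have h2 : ‖𝔉.S (f t) - 𝔉.S (g t)‖ = 0 := by
    have := sq_nonneg ‖𝔉.S (f t) - 𝔉.S (g t)‖
    exact pow_eq_zero_iff two_ne_zero |>.1 (le_antisymm h this)
  exact 𝔉.S_injective (sub_eq_zero.1 (norm_eq_zero.1 h2))

end IsWeakSolution

end CSS

/-! ### Limits of Galerkin approximations and strong solutions. -/

open MeasureTheory Complex Filter Topology Set
open scoped LineDeriv SchwartzMap ComplexConjugate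

namespace CSS

set_option linter.unusedSectionVars false

variable {E : Type*} [NormedAddCommGroup E] [InnerProductSpace ℂ E] [NormedSpace ℝ E]
  [IsScalarTower ℝ ℂ E] [CompleteSpace E]

variable {𝔉 : GalerkinFrame E} {m b : ℝ} {Bd Lip Rel : ℝ → ℝ} {H : E → E →L[ℂ] E}

theorem GalerkinFrame.exists_limit_curve (𝔉 : GalerkinFrame E) {m M T : ℝ} {fs : ℕ → ℝ → E} {f₀ : E}
    (h0 : ∀ n, fs n 0 = 𝔉.P n f₀) {δ : ℕ → ℝ} (hδ : Tendsto δ atTop (𝓝 0))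
    (hM : ∀ n, ∀ t ∈ Icc (-T) T, ‖𝔉.S (fs n t)‖ ≤ m ∧ ‖fs n t‖ ≤ M)
    (hT : (0 : ℝ) ∈ Icc (-T) T)
    (hc : ∀ k n, k ≤ n → ∀ t ∈ Icc (-T) T, ‖𝔉.S (fs n t) - 𝔉.S (fs k t)‖ ≤ δ k) :
    ∃ f : ℝ → E, f 0 = f₀ ∧ ∀ t ∈ Icc (-T) T, ‖f t‖ ≤ M ∧ ‖𝔉.S (f t)‖ ≤ m ∧
      (Tendsto (fun n => 𝔉.S (fs n t)) atTop (𝓝 (𝔉.S (f t)))) ∧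
      ∀ n, ‖𝔉.S (fs n t) - 𝔉.S (f t)‖ ≤ δ n := by
  have key : ∀ t ∈ Icc (-T) T, ∃ x, ‖x‖ ≤ M ∧
      Tendsto (fun n => 𝔉.S (fs n t)) atTop (𝓝 (𝔉.S x)) := fun t ht => by
    have hcs : CauchySeq fun n => 𝔉.S (fs n t) :=
      cauchySeq_of_le_tendsto_0' δ (fun k n hkn => by
        rw [dist_comm, dist_eq_norm]; exact hc k n hkn t ht) hδ
    obtain ⟨u, hu⟩ := cauchySeq_tendsto_of_complete hcs
    obtain ⟨x, hx, rfl⟩ := 𝔉.exists_of_tendsto (Eventually.of_forall fun n => (hM n t ht).2) hu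
    exact ⟨x, hx, hu⟩
  choose! f hfM hf using key
  refine ⟨f, ?_, fun t ht => ⟨hfM t ht, le_of_tendsto' (hf t ht).norm fun n => (hM n t ht).1,
    hf t ht, fun n => ?_⟩⟩
  · apply 𝔉.S_injective
    refine tendsto_nhds_unique (hf 0 hT) ?_
    simp only [h0]
    exact (𝔉.S.continuous.tendsto f₀).comp (𝔉.P_tendsto f₀)
  · have h1 := ((hf t ht).sub_const (𝔉.S (fs n t))).norm
    rw [norm_sub_rev]
    refine le_of_tendsto h1 ?_
    filter_upwards [eventually_ge_atTop n] with k hk using hc n k hk t ht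

namespace Admissible

theorem bound_nonneg (hH : Admissible 𝔉 m b Bd Lip Rel H) {M : ℝ} {f : E} (hf : ‖f‖ ≤ M) (x : E) :
    ‖H f x‖ ≤ |Bd M| * ‖x‖ :=
  (hH.bound M f x hf).trans (by gcongr; exact le_abs_self _)

/-- Guarantees that the bounds on the approximations pass to the limit with the exact constant `‖H
f₀ f₀‖`, on which strong continuity at the initial time rests. -/
theorem tendsto_initial (hH : Admissible 𝔉 m b Bd Lip Rel H) (f₀ : E) :
    Tendsto (fun n => H (𝔉.P n f₀) (𝔉.P n f₀)) atTop (𝓝 (H f₀ f₀)) := by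
  rw [tendsto_iff_norm_sub_tendsto_zero]
  have h1 : Tendsto (fun n => Lip ‖f₀‖ * ‖f₀‖ * ‖𝔉.S (𝔉.P n f₀) - 𝔉.S f₀‖
      + |Bd ‖f₀‖| * ‖𝔉.P n f₀ - f₀‖) atTop (𝓝 (Lip ‖f₀‖ * ‖f₀‖ * 0 + |Bd ‖f₀‖| * 0)) := by
    have h2 := tendsto_iff_norm_sub_tendsto_zero.1 (𝔉.P_tendsto f₀)
    have h3 := tendsto_iff_norm_sub_tendsto_zero.1
      ((𝔉.S.continuous.tendsto f₀).comp (𝔉.P_tendsto f₀))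
    exact (h3.const_mul _).add (h2.const_mul _)
  simp only [mul_zero, add_zero] at h1
  refine squeeze_zero (fun _ => norm_nonneg _) (fun n => ?_) h1
  have e : H (𝔉.P n f₀) (𝔉.P n f₀) - H f₀ f₀
      = (H (𝔉.P n f₀) f₀ - H f₀ f₀) + H (𝔉.P n f₀) (𝔉.P n f₀ - f₀) := by
    rw [map_sub]; abel
  rw [e]
  exact (norm_add_le _ _).trans (add_le_add (hH.lip_self (𝔉.P_le n f₀) le_rfl)
    (hH.bound_nonneg (𝔉.P_le n f₀) _))

/-- Solutions on a short time interval, with strong regularity at the initial time. -/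
theorem exists_weak_solution (𝔉 : GalerkinFrame E) (m b : ℝ) (Bd Lip : ℝ → ℝ)
    (hLip : ∀ M, 0 ≤ Lip M) (M₂ : ℝ) :
    ∃ T M Y : ℝ, 0 < T ∧ 0 ≤ M ∧ ∀ (Rel : ℝ → ℝ) (H : E → E →L[ℂ] E),
      Admissible 𝔉 m b Bd Lip Rel H → ∀ f₀, ‖𝔉.S f₀‖ ≤ m → ‖f₀‖ ≤ M₂ →
      ∃ f : ℝ → E, f 0 = f₀ ∧ IsWeakSolution 𝔉 H m M Y T f ∧
        (∀ t ∈ Icc (-T) T,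
          ‖𝔉.S (f t) - 𝔉.S f₀‖ ≤ Real.exp (Lip M * M * |t|) * ‖H f₀ f₀‖ * |t|) ∧
        ∀ t ∈ Icc (-T) T, ‖H (f t) (f t)‖ ≤ Real.exp (Lip M * M * |t|) * ‖H f₀ f₀‖ := by
  obtain ⟨T, M, hT, hM, hG⟩ := exists_galerkin_uniform (𝔉 := 𝔉) m b Bd Lip hLip M₂
  refine ⟨T, M, |Bd M| * M, hT, hM, fun Rel H hH f₀ hm hf₀ => ?_⟩
  choose fs hfs0 hfs hfsb using hG Rel H hH f₀ hm hf₀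
  have h0I : (0 : ℝ) ∈ Icc (-T) T := ⟨by linarith, hT.le⟩
  have hLM := hLip M
  set B := |Bd M| * M with hB
  have hB0 : 0 ≤ B := by positivity
  have hHB : ∀ n, ∀ t ∈ Icc (-T) T, ‖H (fs n t) (fs n t)‖ ≤ B := fun n t ht => by
    have h2 := (hfsb n t ht).2.1
    exact (hH.bound_nonneg h2 _).trans (by rw [hB]; gcongr)
  have hder : ∀ n, ∀ t ∈ Icc (-T) T, ‖(-I) • 𝔉.P n (H (fs n t) (fs n t))‖
      = ‖𝔉.P n (H (fs n t) (fs n t))‖ := fun n t _ => by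
    rw [norm_smul, norm_neg, norm_I, one_mul]
  -- Cauchy property
  set ε : ℕ → ℝ := fun k => |𝔉.eps k| * M * B with hε
  -- The stability estimate between orders `k ≤ n`, started at time `0`: the initial distance is a
  -- tail of `S f₀`, and the defect `ε k` is a tail of `S` on the ball of radius `M` times the bound
  -- `B` for `H`.
  set δ : ℕ → ℝ := fun k => Real.sqrt (((|𝔉.eps k| * ‖f₀‖) ^ 2 + 2 * ε k * T)
    * Real.exp (2 * (Lip M * M) * T)) with hδ
  have hδ0 : Tendsto δ atTop (𝓝 0) := by
    have h1 : Tendsto (fun k => |𝔉.eps k|) atTop (𝓝 0) := by simpa using 𝔉.eps_tendsto.abs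
    have h2 : Tendsto δ atTop (𝓝 (Real.sqrt (((0 * ‖f₀‖) ^ 2 + 2 * (0 * M * B) * T)
        * Real.exp (2 * (Lip M * M) * T)))) :=
      ((((h1.mul_const _).pow 2).add ((((h1.mul_const M).mul_const B).const_mul 2).mul_const
        T)).mul_const _).sqrt
    simpa using h2
  have hcau : ∀ k n, k ≤ n → ∀ t ∈ Icc (-T) T, ‖𝔉.S (fs n t) - 𝔉.S (fs k t)‖ ≤ δ k := by
    intro k n hkn t ht
    have h := (hfs n).stability hH hkn hM (hfs k) (fun t ht => (hfsb n t ht).2.1)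
      (fun t ht => (hfsb k t ht).2.1) (ε := ε k) (by positivity) (fun τ hτ => by
        have h1 := (𝔉.tail k (fs n τ)).trans (mul_le_mul_of_nonneg_right (le_abs_self _)
          (norm_nonneg _))
        have h2 := (hfsb n τ hτ).2.1
        have h3 := hHB k τ hτ
        calc _ ≤ (|𝔉.eps k| * M) * B := by
              refine mul_le_mul (h1.trans ?_) h3 (norm_nonneg _) (by positivity)
              gcongr
          _ = ε k := rfl) h0I ht
    refine Real.le_sqrt_of_sq_le (h.trans ?_)
    have htT : |t - 0| ≤ T := by rw [sub_zero]; exact abs_le.2 ht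
    have h4 : ‖𝔉.S (fs n 0) - 𝔉.S (fs k 0)‖ ≤ |𝔉.eps k| * ‖f₀‖ := by
      rw [hfs0, hfs0, 𝔉.S_P, 𝔉.S_P, ← 𝔉.P_P hkn, ← map_sub]
      exact (𝔉.P_le n _).trans ((𝔉.tail k f₀).trans (by gcongr; exact le_abs_self _))
    have hεk : 0 ≤ ε k := by positivity
    gcongr
  obtain ⟨f, hf0, hf⟩ := 𝔉.exists_limit_curve hfs0 hδ0
    (fun n t ht => ⟨(hfsb n t ht).1, (hfsb n t ht).2.1⟩) h0I hcau
  -- weak convergence of the right-hand sides, uniformly in time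
  have hpair : ∀ n x t, t ∈ Icc (-T) T → inner ℂ (𝔉.S x) ((-I) • 𝔉.P n (H (fs n t) (fs n t)))
      = (-I) * inner ℂ (H (fs n t) (𝔉.P n x)) (𝔉.S (fs n t)) := fun n x t _ => by
    rw [inner_smul_right, ← 𝔉.P_symm, ← 𝔉.S_P, hH.symm]
  have hpair' : ∀ x t, inner ℂ (𝔉.S x) ((-I) • H (f t) (f t))
      = (-I) * inner ℂ (H (f t) x) (𝔉.S (f t)) := fun x t => by
    rw [inner_smul_right, hH.symm]
  have hm0 : 0 ≤ m := (norm_nonneg _).trans hm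
  -- Symmetry has moved the operator onto the fixed vector `x`. Then `f` enters only through `S f`
  -- and through the coefficients, which are Lipschitz in `S f`, so convergence of `S (fs n t)` is
  -- enough.
  have hunif : ∀ x, TendstoUniformlyOn
      (fun n t => inner ℂ (𝔉.S x) ((-I) • 𝔉.P n (H (fs n t) (fs n t))))
      (fun t => inner ℂ (𝔉.S x) ((-I) • H (f t) (f t))) atTop (Icc (-T) T) := fun x => by
    rw [Metric.tendstoUniformlyOn_iff]
    intro η hη
    have h1 : Tendsto (fun n => (|Bd M| * ‖𝔉.P n x - x‖ + Lip M * ‖x‖ * δ n) * m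
        + |Bd M| * ‖x‖ * δ n) atTop (𝓝 ((|Bd M| * 0 + Lip M * ‖x‖ * 0) * m + |Bd M| * ‖x‖ * 0)) :=
      ((((tendsto_iff_norm_sub_tendsto_zero.1 (𝔉.P_tendsto x)).const_mul _).add
        (hδ0.const_mul _)).mul_const _).add (hδ0.const_mul _)
    simp only [mul_zero, add_zero, zero_mul] at h1
    filter_upwards [h1.eventually_lt_const hη] with n hn t ht
    refine lt_of_le_of_lt ?_ hn
    obtain ⟨h2, h3, -, h4⟩ := hf t ht
    have h4 := h4 n
    obtain ⟨h5, h6, -⟩ := hfsb n t ht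
    rw [dist_comm, dist_eq_norm, hpair n x t ht, hpair', ← mul_sub, norm_mul, norm_neg, norm_I,
      one_mul]
    have e : inner ℂ (H (fs n t) (𝔉.P n x)) (𝔉.S (fs n t)) - inner ℂ (H (f t) x) (𝔉.S (f t))
        = inner ℂ (H (fs n t) (𝔉.P n x - x) + (H (fs n t) x - H (f t) x)) (𝔉.S (fs n t))
          + inner ℂ (H (f t) x) (𝔉.S (fs n t) - 𝔉.S (f t)) := by
      simp only [map_sub, inner_add_left, inner_sub_left, inner_sub_right]; ring
    rw [e]
    refine (norm_add_le _ _).trans (add_le_add ((norm_inner_le_norm _ _).trans ?_)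
      ((norm_inner_le_norm _ _).trans ?_))
    · refine mul_le_mul ((norm_add_le _ _).trans (add_le_add (hH.bound_nonneg h6 _) ?_)) h5
        (norm_nonneg _) ?_
      · exact (hH.lip M _ _ x h6 h2).trans (by gcongr)
      · have := (norm_nonneg _).trans h4
        positivity
    · exact mul_le_mul (hH.bound_nonneg h2 _) h4 (norm_nonneg _) (by positivity)
  have hy : Tendsto (fun n => ‖H (𝔉.P n f₀) (𝔉.P n f₀)‖) atTop (𝓝 ‖H f₀ f₀‖) :=
    (hH.tendsto_initial f₀).norm
  have hyn : ∀ n, ∀ t ∈ Icc (-T) T, ‖𝔉.P n (H (fs n t) (fs n t))‖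
      ≤ Real.exp (Lip M * M * |t|) * ‖H (𝔉.P n f₀) (𝔉.P n f₀)‖ := fun n t ht => by
    refine (hfsb n t ht).2.2.trans ?_
    rw [hfs0]
    gcongr
    exact 𝔉.P_le n _
  refine ⟨f, hf0, ⟨fun t ht => (hf t ht).1, fun t ht => (hf t ht).2.1, fun s hs t ht => ?_,
    fun x t ht => ?_⟩, fun t ht => ?_, fun t ht => ?_⟩
  · refine le_of_tendsto' (((hf t ht).2.2.1.sub (hf s hs).2.2.1).norm) fun n => ?_
    have := (convex_Icc (-T) T).norm_image_sub_le_of_norm_hasDerivWithin_le (hfs n).deriv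
      (C := B) (fun τ hτ => by rw [hder n τ hτ]; exact (𝔉.P_le n _).trans (hHB n τ hτ)) hs ht
    rwa [Real.norm_eq_abs] at this
  · refine hasDerivAt_of_tendstoUniformlyOn (f := fun n τ => inner ℂ (𝔉.S x) (𝔉.S (fs n τ)))
      isOpen_Ioo ((hunif x).mono Ioo_subset_Icc_self)
      (Eventually.of_forall fun n τ hτ => ?_) (fun τ hτ => ?_) ht
    · have h1 := ((hfs n).deriv τ (Ioo_subset_Icc_self hτ)).hasDerivAt (Icc_mem_nhds hτ.1 hτ.2)
      simpa using! (hasDerivAt_const τ (𝔉.S x)).inner ℂ h1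
    · exact tendsto_const_nhds.inner (hf τ (Ioo_subset_Icc_self hτ)).2.2.1
  · have hlim := ((hf t ht).2.2.1.sub (hf 0 h0I).2.2.1).norm
    rw [hf0] at hlim
    refine le_of_tendsto_of_tendsto' hlim ((hy.const_mul _).mul_const _) fun n => ?_
    -- The mean value inequality is used on `[-|t|, |t|]` only, so that the growth factor tends to
    -- `1` as `t` tends to `0`.
    have hsub : Icc (-|t|) |t| ⊆ Icc (-T) T := by
      have := abs_le.2 ht
      exact Icc_subset_Icc (by linarith) this
    have := (convex_Icc (-|t|) |t|).norm_image_sub_le_of_norm_hasDerivWithin_le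
      (fun τ hτ => ((hfs n).deriv τ (hsub hτ)).mono hsub)
      (C := Real.exp (Lip M * M * |t|) * ‖H (𝔉.P n f₀) (𝔉.P n f₀)‖) (fun τ hτ => by
        rw [hder n τ (hsub hτ)]
        refine (hyn n τ (hsub hτ)).trans ?_
        have := abs_le.2 hτ
        gcongr) (x := 0) (y := t) ⟨by simp, by simp⟩ ⟨neg_abs_le t, le_abs_self t⟩
    rwa [Real.norm_eq_abs, sub_zero] at this
  · refine 𝔉.norm_le_of_inner_le (by positivity) fun x => ?_
    have h1 := ((hunif x).tendsto_at ht).norm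
    rw [inner_smul_right, norm_mul, norm_neg, norm_I, one_mul] at h1
    refine le_of_tendsto_of_tendsto' h1 ((hy.const_mul _).const_mul _) fun n => ?_
    refine (norm_inner_le_norm _ _).trans ?_
    rw [hder n t ht]
    gcongr
    exact hyn n t ht

/-- Both hypotheses become sharp as `t → 0`: neither `H f f` nor the difference quotient of `S f`
can exceed `‖H f₀ f₀‖` in the limit. Weak convergence without gain of norm is strong convergence.
The ellipticity bound `rel` then turns convergence of `H f f` into convergence of `f`. -/
theorem strong_at_initial (hH : Admissible 𝔉 m b Bd Lip Rel H) {M Y T : ℝ} (hT : 0 < T)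
    {f : ℝ → E} (hf : IsWeakSolution 𝔉 H m M Y T f)
    (h1 : ∀ t ∈ Icc (-T) T,
      ‖𝔉.S (f t) - 𝔉.S (f 0)‖ ≤ Real.exp (Lip M * M * |t|) * ‖H (f 0) (f 0)‖ * |t|)
    (h2 : ∀ t ∈ Icc (-T) T, ‖H (f t) (f t)‖ ≤ Real.exp (Lip M * M * |t|) * ‖H (f 0) (f 0)‖) :
    ContinuousAt f 0 ∧ HasDerivAt (fun t => 𝔉.S (f t)) ((-I) • H (f 0) (f 0)) 0 := by
  have h0I : (0 : ℝ) ∈ Icc (-T) T := ⟨by linarith, hT.le⟩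
  have hLM := hH.Lip_nonneg M
  have hnhds : Icc (-T) T ∈ 𝓝 (0 : ℝ) := Icc_mem_nhds (by linarith) hT
  have hexp : Tendsto (fun t : ℝ => Real.exp (Lip M * M * |t|) * ‖H (f 0) (f 0)‖) (𝓝 0)
      (𝓝 ‖H (f 0) (f 0)‖) := by
    have : Continuous fun t : ℝ => Real.exp (Lip M * M * |t|) * ‖H (f 0) (f 0)‖ := by fun_prop
    simpa using this.tendsto 0
  have hSc : Tendsto (fun t => ‖𝔉.S (f t) - 𝔉.S (f 0)‖) (𝓝 0) (𝓝 0) := by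
    have h3 : Tendsto (fun t : ℝ => Y * |t - 0|) (𝓝 0) (𝓝 0) := by
      have : Continuous fun t : ℝ => Y * |t - 0| := by fun_prop
      simpa using this.tendsto 0
    refine squeeze_zero' (Eventually.of_forall fun _ => norm_nonneg _) ?_ h3
    filter_upwards [hnhds] with t ht using hf.lipschitz 0 h0I t ht
  constructor
  · have hg : Tendsto (fun t => H (f t) (f t)) (𝓝 0) (𝓝 (H (f 0) (f 0))) := by
      refine 𝔉.tendsto_of_weak hexp (by filter_upwards [hnhds] with t ht using h2 t ht)
        fun x => ?_
      have e : ∀ t, inner ℂ (𝔉.S x) (H (f t) (f t)) = inner ℂ (H (f t) x) (𝔉.S (f t)) :=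
        fun t => hH.symm _ _ _
      simp only [e]
      refine Tendsto.inner ?_ (tendsto_iff_norm_sub_tendsto_zero.2 hSc)
      rw [tendsto_iff_norm_sub_tendsto_zero]
      have h3 := hSc.const_mul (Lip M * ‖x‖)
      rw [mul_zero] at h3
      refine squeeze_zero' (Eventually.of_forall fun _ => norm_nonneg _) ?_ h3
      filter_upwards [hnhds] with t ht using hH.lip M _ _ x (hf.bound t ht) (hf.bound 0 h0I)
    rw [ContinuousAt, tendsto_iff_norm_sub_tendsto_zero]
    have h3 : Tendsto (fun t => (‖H (f t) (f t) - H (f 0) (f 0)‖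
        + Lip M * M * ‖𝔉.S (f t) - 𝔉.S (f 0)‖) + Rel M * ‖𝔉.S (f t) - 𝔉.S (f 0)‖) (𝓝 0)
        (𝓝 ((0 + Lip M * M * 0) + Rel M * 0)) :=
      ((tendsto_iff_norm_sub_tendsto_zero.1 hg).add (hSc.const_mul _)).add (hSc.const_mul _)
    simp only [mul_zero, add_zero] at h3
    refine squeeze_zero' (Eventually.of_forall fun _ => norm_nonneg _) ?_ h3
    filter_upwards [hnhds] with t ht
    refine (hH.rel M (f 0) (f t - f 0) (hf.bound 0 h0I)).trans ?_
    rw [map_sub 𝔉.S]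
    gcongr
    have e : H (f 0) (f t - f 0) = (H (f t) (f t) - H (f 0) (f 0))
        - (H (f t) (f t) - H (f 0) (f t)) := by rw [map_sub]; abel
    rw [e]
    refine (norm_sub_le _ _).trans (add_le_add le_rfl ?_)
    have := hH.lip_self (hf.bound 0 h0I) (hf.bound t ht)
    rwa [norm_sub_rev, norm_sub_rev (𝔉.S (f 0))] at this
  · rw [hasDerivAt_iff_tendsto_slope]
    have e : ‖(-I) • H (f 0) (f 0)‖ = ‖H (f 0) (f 0)‖ := by
      rw [norm_smul, norm_neg, norm_I, one_mul]
    rw [← e] at hexp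
    refine 𝔉.tendsto_of_weak (hexp.mono_left nhdsWithin_le_nhds) ?_ fun x => ?_
    · filter_upwards [nhdsWithin_le_nhds hnhds, self_mem_nhdsWithin] with t ht ht0
      rw [slope_def_module, sub_zero, norm_smul, e, norm_inv, Real.norm_eq_abs,
        inv_mul_le_iff₀ (abs_pos.2 ht0), mul_comm |t|]
      exact h1 t ht
    · have := (hf.deriv x 0 ⟨by linarith, hT⟩)
      rw [hasDerivAt_iff_tendsto_slope] at this
      refine this.congr fun t => ?_
      rw [slope_def_module, slope_def_module, ← inner_sub_right,
        ← algebraMap_smul ℂ (t - 0)⁻¹ (𝔉.S (f t) - 𝔉.S (f 0)), inner_smul_right]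
      rfl

/-- Strong solutions on a time interval that depends only on the size of the data. -/
theorem exists_strong_solution (𝔉 : GalerkinFrame E) (m b : ℝ) (Bd Lip : ℝ → ℝ)
    (hLip : ∀ M, 0 ≤ Lip M) (M₂ : ℝ) :
    ∃ T M : ℝ, 0 < T ∧ 0 ≤ M ∧ ∀ (Rel : ℝ → ℝ) (H : E → E →L[ℂ] E),
      Admissible 𝔉 m b Bd Lip Rel H → ∀ f₀, ‖𝔉.S f₀‖ ≤ m → ‖f₀‖ ≤ M₂ →
      ∃ f : ℝ → E, f 0 = f₀ ∧ ∀ t ∈ Icc 0 T, ‖f t‖ ≤ M ∧ ContinuousAt f t ∧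
        HasDerivAt (fun t => 𝔉.S (f t)) ((-I) • H (f t) (f t)) t := by
  obtain ⟨T, M, Y, hT, hM, hex⟩ := exists_weak_solution 𝔉 m b Bd Lip hLip M₂
  obtain ⟨T', M', Y', hT', -, hex'⟩ := exists_weak_solution 𝔉 m b Bd Lip hLip M
  -- Halving the interval leaves room on both sides of each time in `[0, T/2]`.
  refine ⟨T / 2, M, by positivity, hM, fun Rel H hH f₀ hm hf₀ => ?_⟩
  obtain ⟨f, hf0, hf, -, -⟩ := hex Rel H hH f₀ hm hf₀
  refine ⟨f, hf0, fun s hs => ?_⟩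
  have hsI : s ∈ Icc (-T) T := ⟨by linarith [hs.1], by linarith [hs.2]⟩
  refine ⟨hf.bound s hsI, ?_⟩
  -- Restart at time `s`: the new solution is strong at its own initial time, and by uniqueness it
  -- is a translate of `f` near that time.
  obtain ⟨g, hg0, hg, hg1, hg2⟩ := hex' Rel H hH (f s) (hf.mass s hsI) (hf.bound s hsI)
  rw [← hg0] at hg1 hg2
  obtain ⟨hc, hd⟩ := hH.strong_at_initial hT' hg hg1 hg2
  set δ := min (T - |s|) T' with hδ
  have hδ0 : 0 < δ := by
    refine lt_min ?_ hT'
    rw [abs_of_nonneg hs.1]; linarith [hs.2]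
  have heq := IsWeakSolution.unique hH
    ((hf.shift (s := s) (T' := δ) (min_le_left _ _)).mono (le_max_left M M') le_rfl)
    (hg.mono (T' := δ) (le_max_right M M') (min_le_right _ _)) (by simp [hg0])
  have hev : (fun t => f (t + s)) =ᶠ[𝓝 0] g := by
    filter_upwards [Ioo_mem_nhds (by linarith : -δ < 0) hδ0] with t ht using heq t ht
  have hev' : (fun t => 𝔉.S (f (t + s))) =ᶠ[𝓝 0] fun t => 𝔉.S (g t) := by
    filter_upwards [hev] with t ht
    rw [ht]
  constructor
  · have h1 : ContinuousAt (fun t => f (t + s)) 0 := hc.congr hev.symm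
    have h2 : ContinuousAt (fun t : ℝ => t - s) s := by fun_prop
    have h3 := ContinuousAt.comp (g := fun t => f (t + s)) (f := fun t : ℝ => t - s) (x := s)
      (by simpa using h1) h2
    simpa [Function.comp_def] using h3
  · have h1 := hd.congr_of_eventuallyEq hev'
    have h2 := HasDerivAt.comp_sub_const (f := fun t => 𝔉.S (f (t + s))) s s
      (by simpa using h1)
    rw [hg0] at h2
    simpa using h2

end Admissible

end CSS

open MeasureTheory Complex Filter Topology Set FourierTransform
open scoped LineDeriv SchwartzMap ComplexConjugate ENNReal

namespace CSS

noncomputable section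

/-! ### Multiplication operators and Fourier multipliers on `L²(ℝ²)` -/

open Classical in
/-- Multiplication by an essentially bounded function (and `0` for other functions). -/
def mulOp (a : Plane → ℂ) : L2 →L[ℂ] L2 :=
  if h : MemLp a ∞ (volume : Measure Plane) then
    (ContinuousLinearMap.mul ℂ ℂ).holderL volume ∞ 2 2 (h.toLp a) else 0

theorem mulOp_ae {a : Plane → ℂ} (ha : MemLp a ∞ (volume : Measure Plane)) (f : L2) :
    mulOp a f =ᵐ[volume] fun x => a x * f x := by
  rw [mulOp, dif_pos ha, ContinuousLinearMap.holderL_apply_apply]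
  filter_upwards [(ContinuousLinearMap.mul ℂ ℂ).coeFn_holder (r := 2) (ha.toLp a) f,
    ha.coeFn_toLp] with x h1 h2
  rw [h1, h2]; rfl

theorem norm_mulOp_le {a : Plane → ℂ} (ha : MemLp a ∞ (volume : Measure Plane)) {C : ℝ}
    (hC : ∀ x, ‖a x‖ ≤ C) (f : L2) : ‖mulOp a f‖ ≤ C * ‖f‖ := by
  refine Lp.norm_le_mul_norm_of_ae_le_mul ?_
  filter_upwards [mulOp_ae ha f] with x hx
  rw [hx, norm_mul]
  gcongr
  exact hC x

theorem mulOp_mulOp {a b : Plane → ℂ} (ha : MemLp a ∞ (volume : Measure Plane))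
    (hb : MemLp b ∞ (volume : Measure Plane)) (f : L2) :
    mulOp a (mulOp b f) = mulOp (fun x => a x * b x) f := by
  have hab : MemLp (fun x => a x * b x) ∞ (volume : Measure Plane) := hb.mul' ha
  ext1
  filter_upwards [mulOp_ae ha (mulOp b f), mulOp_ae hb f, mulOp_ae hab f] with x h1 h2 h3
  rw [h1, h2, h3, mul_assoc]

theorem mulOp_add {a b : Plane → ℂ} (ha : MemLp a ∞ (volume : Measure Plane))
    (hb : MemLp b ∞ (volume : Measure Plane)) (f : L2) :
    mulOp (fun x => a x + b x) f = mulOp a f + mulOp b f := by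
  have hab : MemLp (fun x => a x + b x) ∞ (volume : Measure Plane) := ha.add hb
  ext1
  filter_upwards [mulOp_ae ha f, mulOp_ae hb f, mulOp_ae hab f,
    Lp.coeFn_add (mulOp a f) (mulOp b f)] with x h1 h2 h3 h4
  rw [h4, Pi.add_apply, h1, h2, h3, add_mul]

theorem mulOp_const_mul {a : Plane → ℂ} (ha : MemLp a ∞ (volume : Measure Plane)) (c : ℂ) (f : L2) :
    mulOp (fun x => c * a x) f = c • mulOp a f := by
  have hab : MemLp (fun x => c * a x) ∞ (volume : Measure Plane) := ha.const_mul c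
  ext1
  filter_upwards [mulOp_ae ha f, mulOp_ae hab f, Lp.coeFn_smul c (mulOp a f)] with x h1 h3 h4
  rw [h4, Pi.smul_apply, h1, h3, smul_eq_mul, mul_assoc]

theorem mulOp_one (f : L2) : mulOp (fun _ => 1) f = f := by
  ext1
  filter_upwards [mulOp_ae (a := fun _ => (1 : ℂ)) (memLp_top_const 1) f] with x h1
  rw [h1, one_mul]

theorem inner_mulOp {a : Plane → ℂ} (ha : MemLp a ∞ (volume : Measure Plane)) (f g : L2) :
    inner ℂ (mulOp a f) g = inner ℂ f (mulOp (fun x => conj (a x)) g) := by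
  have ha' : MemLp (fun x => conj (a x)) ∞ (volume : Measure Plane) := ha.star
  rw [L2.inner_def, L2.inner_def]
  refine integral_congr_ae ?_
  filter_upwards [mulOp_ae ha f, mulOp_ae ha' g] with x h1 h2
  rw [h1, h2]
  simp only [RCLike.inner_apply, map_mul]
  ring

/-- The Fourier multiplier with a bounded symbol. -/
def fmul (a : Plane → ℂ) : L2 →L[ℂ] L2 :=
  (fourierInvCLM ℂ L2) ∘L (mulOp a) ∘L (fourierCLM ℂ L2)

theorem fmul_apply (a : Plane → ℂ) (f : L2) : fmul a f = 𝓕⁻ (mulOp a (𝓕 f)) := rfl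

theorem norm_fourierInv_L2 (f : L2) : ‖(𝓕⁻ f : L2)‖ = ‖f‖ :=
  (Lp.fourierTransformₗᵢ Plane ℂ).symm.norm_map f

theorem norm_fmul_le {a : Plane → ℂ} (ha : MemLp a ∞ (volume : Measure Plane)) {C : ℝ}
    (hC : ∀ x, ‖a x‖ ≤ C) (f : L2) : ‖fmul a f‖ ≤ C * ‖f‖ := by
  rw [fmul_apply, norm_fourierInv_L2]
  refine (norm_mulOp_le ha hC _).trans_eq ?_
  rw [Lp.norm_fourier_eq]

theorem fmul_fmul {a b : Plane → ℂ} (ha : MemLp a ∞ (volume : Measure Plane))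
    (hb : MemLp b ∞ (volume : Measure Plane)) (f : L2) :
    fmul a (fmul b f) = fmul (fun x => a x * b x) f := by
  rw [fmul_apply, fmul_apply, fmul_apply, fourier_fourierInv_eq, mulOp_mulOp ha hb]

theorem fmul_add {a b : Plane → ℂ} (ha : MemLp a ∞ (volume : Measure Plane))
    (hb : MemLp b ∞ (volume : Measure Plane)) (f : L2) :
    fmul (fun x => a x + b x) f = fmul a f + fmul b f := by
  rw [fmul_apply, fmul_apply, fmul_apply, mulOp_add ha hb, fourierInv_add]

theorem fmul_const_mul {a : Plane → ℂ} (ha : MemLp a ∞ (volume : Measure Plane)) (c : ℂ) (f : L2) :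
    fmul (fun x => c * a x) f = c • fmul a f := by
  rw [fmul_apply, fmul_apply, mulOp_const_mul ha, fourierInv_smul]

theorem fmul_one (f : L2) : fmul (fun _ => 1) f = f := by
  rw [fmul_apply, mulOp_one, fourierInv_fourier_eq]

theorem inner_fmul {a : Plane → ℂ} (ha : MemLp a ∞ (volume : Measure Plane)) (f g : L2) :
    inner ℂ (fmul a f) g = inner ℂ f (fmul (fun x => conj (a x)) g) := by
  rw [← Lp.inner_fourier_eq, ← Lp.inner_fourier_eq f, fmul_apply, fmul_apply,
    fourier_fourierInv_eq, fourier_fourierInv_eq, inner_mulOp ha]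

theorem toTemperedDistribution_injective :
    Function.Injective (fun f : L2 => (f : 𝓢'(Plane, ℂ))) := by
  have h := Lp.ker_toTemperedDistributionCLM_eq_bot (F := ℂ) (μ := (volume : Measure Plane)) (p := 2)
  exact LinearMap.ker_eq_bot.1 h

theorem fmul_toTemperedDistribution {a : Plane → ℂ} (ha : MemLp a ∞ (volume : Measure Plane))
    (ht : a.HasTemperateGrowth) (f : L2) :
    (fmul a f : 𝓢'(Plane, ℂ)) = TemperedDistribution.fourierMultiplierCLM ℂ a (f : 𝓢'(Plane, ℂ)) := by
  rw [fmul_apply, ← Lp.fourierInv_toTemperedDistribution_eq,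
    TemperedDistribution.fourierMultiplierCLM_apply, Lp.fourier_toTemperedDistribution_eq,
    ← Lp.toTemperedDistribution_smul_eq (r := 2) ht ha]
  congr 2
  ext1
  filter_upwards [mulOp_ae ha (𝓕 f), Lp.coeFn_lpSMul (r := 2) (ha.toLp a) (𝓕 f : L2),
    ha.coeFn_toLp] with x h1 h2 h3
  rw [h1, h2, Pi.smul_apply', h3, smul_eq_mul]

theorem fmul_toLp {a : Plane → ℂ} (ha : MemLp a ∞ (volume : Measure Plane))
    (ht : a.HasTemperateGrowth) (φ : 𝓢(Plane, ℂ)) :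
    fmul a (φ.toLp 2) = (SchwartzMap.fourierMultiplierCLM ℂ a φ).toLp 2 := by
  apply toTemperedDistribution_injective
  simp only
  rw [fmul_toTemperedDistribution ha ht, Lp.toTemperedDistribution_toLp_eq,
    Lp.toTemperedDistribution_toLp_eq,
    TemperedDistribution.fourierMultiplierCLM_toTemperedDistributionCLM_eq ht]

theorem memLp_top_of_continuous {a : Plane → ℂ} (ha : Continuous a) {C : ℝ} (hC : ∀ x, ‖a x‖ ≤ C) :
    MemLp a ∞ (volume : Measure Plane) :=
  memLp_top_of_bound ha.aestronglyMeasurable C (Eventually.of_forall hC)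

/-! ### Bessel potentials and their derivatives -/

/-- The symbol `(1 + |ξ|²)⁻¹`. -/
def bessel (ξ : Plane) : ℂ := ((1 + ‖ξ‖ ^ 2)⁻¹ : ℝ)

/-- The symbol of `∂ⱼ`. -/
def dsymb (j : Fin 2) (ξ : Plane) : ℂ := 2 * Real.pi * I * (ξ j : ℂ)

/-- The operator `(1 - Δ / (4 π²))⁻¹`. -/
def S : L2 →L[ℂ] L2 := fmul bessel

/-- The operator `∂ⱼ S`. -/
def D (j : Fin 2) : L2 →L[ℂ] L2 := fmul fun ξ => dsymb j ξ * bessel ξ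

/-- The operator `∂ⱼ ∂ₖ S`. -/
def DD (j k : Fin 2) : L2 →L[ℂ] L2 := fmul fun ξ => dsymb j ξ * (dsymb k ξ * bessel ξ)

theorem abs_coord_le (j : Fin 2) (ξ : Plane) : |ξ j| ≤ ‖ξ‖ := by
  have := PiLp.norm_apply_le ξ j
  rwa [Real.norm_eq_abs] at this

theorem norm_sq_plane (x : Plane) : ‖x‖ ^ 2 = x 0 ^ 2 + x 1 ^ 2 := by
  rw [EuclideanSpace.norm_sq_eq, Fin.sum_univ_two]; simp

theorem hasTemperateGrowth_bessel : bessel.HasTemperateGrowth := by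
  have h : (fun x : Plane => ((1 + ‖x‖ ^ 2) ^ (-1 : ℝ) : ℝ)).HasTemperateGrowth := by fun_prop
  have h2 : (fun x : Plane => (((1 + ‖x‖ ^ 2) ^ (-1 : ℝ) : ℝ) : ℂ)).HasTemperateGrowth := by
    fun_prop
  have e : bessel = fun x : Plane => (((1 + ‖x‖ ^ 2) ^ (-1 : ℝ) : ℝ) : ℂ) := by
    funext x; rw [bessel, Real.rpow_neg_one]
  rw [e]; exact h2

theorem dsymb_eq (j : Fin 2) : dsymb j = (2 * Real.pi * I : ℂ) •
    fun ξ : Plane => ((inner ℝ ξ (EuclideanSpace.single j (1 : ℝ)) : ℝ) : ℂ) := by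
  funext ξ
  simp [dsymb, EuclideanSpace.inner_single_right]

theorem hasTemperateGrowth_dsymb (j : Fin 2) : (dsymb j).HasTemperateGrowth := by
  have e : dsymb j = fun ξ => (2 * Real.pi * I : ℂ) *
    ((inner ℝ ξ (EuclideanSpace.single j (1 : ℝ)) : ℝ) : ℂ) := by
    rw [dsymb_eq]; rfl
  rw [e]
  fun_prop

theorem norm_bessel (ξ : Plane) : ‖bessel ξ‖ = (1 + ‖ξ‖ ^ 2)⁻¹ := by
  rw [bessel, norm_real, Real.norm_of_nonneg (by positivity)]

theorem norm_dsymb (j : Fin 2) (ξ : Plane) : ‖dsymb j ξ‖ = 2 * Real.pi * |ξ j| := by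
  simp [dsymb, abs_of_pos Real.pi_pos]

theorem norm_bessel_le (ξ : Plane) : ‖bessel ξ‖ ≤ 1 := by
  rw [norm_bessel]
  exact inv_le_one_of_one_le₀ (by nlinarith [sq_nonneg ‖ξ‖])

theorem norm_dsymb_bessel_le (j : Fin 2) (ξ : Plane) :
    ‖dsymb j ξ * bessel ξ‖ ≤ 2 * Real.pi := by
  rw [norm_mul, norm_bessel, norm_dsymb, mul_inv_le_iff₀ (by positivity)]
  have h := abs_coord_le j ξ
  have := Real.pi_pos
  have h2 : |ξ j| ≤ 1 + ‖ξ‖ ^ 2 := by nlinarith [sq_nonneg (‖ξ‖ - 1)]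
  gcongr

theorem norm_dsymb_dsymb_bessel_le (j k : Fin 2) (ξ : Plane) :
    ‖dsymb j ξ * (dsymb k ξ * bessel ξ)‖ ≤ 4 * Real.pi ^ 2 := by
  rw [norm_mul, norm_mul, norm_bessel, norm_dsymb, norm_dsymb, ← mul_assoc,
    mul_inv_le_iff₀ (by positivity)]
  have h := abs_coord_le j ξ
  have h' := abs_coord_le k ξ
  have := Real.pi_pos
  have h2 : |ξ j| * |ξ k| ≤ 1 + ‖ξ‖ ^ 2 := by
    nlinarith [abs_nonneg (ξ j), abs_nonneg (ξ k), norm_nonneg ξ]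
  calc _ = 4 * Real.pi ^ 2 * (|ξ j| * |ξ k|) := by ring
    _ ≤ _ := by gcongr

theorem memLp_bessel : MemLp bessel ∞ (volume : Measure Plane) :=
  memLp_top_of_continuous hasTemperateGrowth_bessel.1.continuous norm_bessel_le

theorem hasTemperateGrowth_D (j : Fin 2) :
    (fun ξ => dsymb j ξ * bessel ξ).HasTemperateGrowth :=
  (hasTemperateGrowth_dsymb j).mul hasTemperateGrowth_bessel

theorem hasTemperateGrowth_DD (j k : Fin 2) :
    (fun ξ => dsymb j ξ * (dsymb k ξ * bessel ξ)).HasTemperateGrowth :=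
  (hasTemperateGrowth_dsymb j).mul (hasTemperateGrowth_D k)

theorem memLp_D (j : Fin 2) : MemLp (fun ξ => dsymb j ξ * bessel ξ) ∞ (volume : Measure Plane) :=
  memLp_top_of_continuous (hasTemperateGrowth_D j).1.continuous (norm_dsymb_bessel_le j)

theorem memLp_DD (j k : Fin 2) :
    MemLp (fun ξ => dsymb j ξ * (dsymb k ξ * bessel ξ)) ∞ (volume : Measure Plane) :=
  memLp_top_of_continuous (hasTemperateGrowth_DD j k).1.continuous (norm_dsymb_dsymb_bessel_le j k)

theorem norm_S_le (g : L2) : ‖S g‖ ≤ ‖g‖ :=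
  (norm_fmul_le memLp_bessel norm_bessel_le g).trans_eq (one_mul _)

theorem norm_D_le (j : Fin 2) (g : L2) : ‖D j g‖ ≤ 2 * Real.pi * ‖g‖ :=
  norm_fmul_le (memLp_D j) (norm_dsymb_bessel_le j) g

theorem norm_DD_le (j k : Fin 2) (g : L2) : ‖DD j k g‖ ≤ 4 * Real.pi ^ 2 * ‖g‖ :=
  norm_fmul_le (memLp_DD j k) (norm_dsymb_dsymb_bessel_le j k) g

theorem conj_bessel (ξ : Plane) : conj (bessel ξ) = bessel ξ := by rw [bessel, conj_ofReal]

theorem conj_dsymb (j : Fin 2) (ξ : Plane) : conj (dsymb j ξ) = -dsymb j ξ := by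
  simp only [dsymb, map_mul, conj_ofReal, conj_I, map_ofNat]
  ring

theorem S_symm (f g : L2) : inner ℂ (S f) g = inner ℂ f (S g) := by
  rw [S, inner_fmul memLp_bessel]
  simp only [conj_bessel]

theorem distDeriv_fmul {a : Plane → ℂ} (ha : MemLp a ∞ (volume : Measure Plane))
    (hat : a.HasTemperateGrowth) (j : Fin 2)
    (hd : MemLp (fun ξ => dsymb j ξ * a ξ) ∞ (volume : Measure Plane)) (g : L2) :
    distDeriv j (fmul a g) = (fmul (fun ξ => dsymb j ξ * a ξ) g : 𝓢'(Plane, ℂ)) := by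
  have ht : (fun ξ => dsymb j ξ * a ξ).HasTemperateGrowth := (hasTemperateGrowth_dsymb j).mul hat
  have hi : (fun ξ : Plane => ((inner ℝ ξ (EuclideanSpace.single j (1 : ℝ)) : ℝ) : ℂ)).HasTemperateGrowth := by
    fun_prop
  rw [distDeriv, TemperedDistribution.lineDeriv_eq_fourierMultiplierCLM,
    fmul_toTemperedDistribution ha hat, fmul_toTemperedDistribution hd ht,
    TemperedDistribution.fourierMultiplierCLM_fourierMultiplierCLM_apply hat hi,
    ← _root_.smul_apply, ← TemperedDistribution.fourierMultiplierCLM_smul (hat.mul hi)]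
  congr 2
  funext ξ
  simp [dsymb_eq]
  ring

theorem distDeriv_S (j : Fin 2) (g : L2) : distDeriv j (S g) = (D j g : 𝓢'(Plane, ℂ)) :=
  distDeriv_fmul memLp_bessel hasTemperateGrowth_bessel j (memLp_D j) g

theorem distDeriv_D (j k : Fin 2) (g : L2) : distDeriv j (D k g) = (DD j k g : 𝓢'(Plane, ℂ)) :=
  distDeriv_fmul (memLp_D k) (hasTemperateGrowth_D k) j (memLp_DD j k) g

theorem weakDeriv_eq {j : Fin 2} {f g : L2} (h : distDeriv j f = (g : 𝓢'(Plane, ℂ))) :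
    weakDeriv j f = g := by
  have hex : ∃ g : L2, (g : 𝓢'(Plane, ℂ)) = distDeriv j f := ⟨g, h.symm⟩
  rw [weakDeriv, dif_pos hex]
  exact toTemperedDistribution_injective (hex.choose_spec.trans h)

theorem weakDeriv_S (j : Fin 2) (g : L2) : weakDeriv j (S g) = D j g := weakDeriv_eq (distDeriv_S j g)

theorem weakDeriv_D (j k : Fin 2) (g : L2) : weakDeriv j (D k g) = DD j k g :=
  weakDeriv_eq (distDeriv_D j k g)

/-- `S` preserves Schwartz functions, whose weak derivatives are classical. Together with density of
these functions, this supplies the approximations used for integration by parts. -/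
theorem exists_schwartz (φ : 𝓢(Plane, ℂ)) : ∃ ψ : 𝓢(Plane, ℂ), S (φ.toLp 2) = ψ.toLp 2 ∧
    (∀ j, D j (φ.toLp 2) = (∂_{(EuclideanSpace.single j (1 : ℝ) : Plane)} ψ).toLp 2) ∧
    ∀ j k, DD j k (φ.toLp 2) = (∂_{(EuclideanSpace.single j (1 : ℝ) : Plane)}
      (∂_{(EuclideanSpace.single k (1 : ℝ) : Plane)} ψ)).toLp 2 := by
  have key : ∀ (j : Fin 2) (ψ : 𝓢(Plane, ℂ)), distDeriv j (ψ.toLp 2)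
      = ((∂_{(EuclideanSpace.single j (1 : ℝ) : Plane)} ψ).toLp 2 : L2) := fun j ψ => by
    rw [distDeriv, Lp.toTemperedDistribution_toLp_eq, Lp.toTemperedDistribution_toLp_eq,
      TemperedDistribution.lineDerivOp_toTemperedDistributionCLM_eq]
  set ψ := SchwartzMap.fourierMultiplierCLM ℂ bessel φ with hψ
  have h0 : S (φ.toLp 2) = ψ.toLp 2 := fmul_toLp memLp_bessel hasTemperateGrowth_bessel φ
  have h1 : ∀ j, D j (φ.toLp 2) = (∂_{(EuclideanSpace.single j (1 : ℝ) : Plane)} ψ).toLp 2 :=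
    fun j => by rw [← weakDeriv_S, h0, weakDeriv_eq (key j ψ)]
  exact ⟨ψ, h0, h1, fun j k => by rw [← weakDeriv_D, h1, weakDeriv_eq (key j _)]⟩

theorem denseRange_toLp : DenseRange fun φ : 𝓢(Plane, ℂ) => (φ.toLp 2 : L2) :=
  SchwartzMap.denseRange_toLpCLM (F := ℂ) (p := 2) (μ := (volume : Measure Plane)) ENNReal.ofNat_ne_top

theorem exists_schwartz_seq (g : L2) : ∃ φ : ℕ → 𝓢(Plane, ℂ),
    Tendsto (fun n => ((φ n).toLp 2 : L2)) atTop (𝓝 g) := by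
  obtain ⟨x, hx, hlim⟩ := mem_closure_iff_seq_limit.1 (denseRange_toLp g)
  choose φ hφ using hx
  exact ⟨φ, by simpa only [hφ] using hlim⟩

theorem denseRange_S : DenseRange S := by
  refine Dense.mono ?_ denseRange_toLp
  rintro _ ⟨φ, rfl⟩
  have ht : (fun ξ : Plane => ((1 + ‖ξ‖ ^ 2 : ℝ) : ℂ)).HasTemperateGrowth := by
    have : (fun ξ : Plane => (1 + ‖ξ‖ ^ 2 : ℝ)).HasTemperateGrowth := by fun_prop
    fun_prop
  refine ⟨(SchwartzMap.fourierMultiplierCLM ℂ (fun ξ : Plane => ((1 + ‖ξ‖ ^ 2 : ℝ) : ℂ)) φ).toLp 2, ?_⟩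
  rw [S, fmul_toLp memLp_bessel hasTemperateGrowth_bessel,
    SchwartzMap.fourierMultiplierCLM_fourierMultiplierCLM_apply hasTemperateGrowth_bessel ht]
  have e : (bessel * fun ξ : Plane => ((1 + ‖ξ‖ ^ 2 : ℝ) : ℂ)) = fun _ => (1 : ℂ) := by
    funext ξ
    rw [Pi.mul_apply, bessel, ← ofReal_mul, inv_mul_cancel₀ (by positivity), ofReal_one]
  rw [e]
  simp

/-- The operator `-Δ S`. -/
theorem sum_DD (g : L2) : ∑ j, DD j j g = -((4 * Real.pi ^ 2 : ℝ) : ℂ) • (g - S g) := by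
  have e : DD 0 0 g + DD 1 1 g = fmul (fun ξ => (((4 * Real.pi ^ 2 : ℝ) : ℂ)) * bessel ξ
      + (-((4 * Real.pi ^ 2 : ℝ) : ℂ)) * 1) g := by
    rw [DD, DD, ← fmul_add (memLp_DD 0 0) (memLp_DD 1 1)]
    congr 1
    congr 1
    funext ξ
    have h1 : ((ξ 0 : ℂ) ^ 2 + (ξ 1 : ℂ) ^ 2) = ((‖ξ‖ ^ 2 : ℝ) : ℂ) := by
      rw [norm_sq_plane]; push_cast; ring
    have h2 : (1 + ((‖ξ‖ ^ 2 : ℝ) : ℂ)) * bessel ξ = 1 := by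
      rw [bessel, ← ofReal_one, ← ofReal_add, ← ofReal_mul, mul_inv_cancel₀ (by positivity)]
    have h3 : dsymb 0 ξ * (dsymb 0 ξ * bessel ξ) + dsymb 1 ξ * (dsymb 1 ξ * bessel ξ)
        = -(4 * Real.pi ^ 2) * (((ξ 0 : ℂ) ^ 2 + (ξ 1 : ℂ) ^ 2) * bessel ξ) := by
      simp only [dsymb]
      linear_combination (4 * (Real.pi : ℂ) ^ 2 * ((ξ 0 : ℂ) ^ 2 + (ξ 1 : ℂ) ^ 2) * bessel ξ) * I_sq
    rw [h3, h1]
    push_cast at h2 ⊢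
    linear_combination (-(4 * (Real.pi : ℂ) ^ 2)) * h2
  rw [Fin.sum_univ_two, e, fmul_add (memLp_bessel.const_mul _) ((memLp_top_const _)),
    fmul_const_mul memLp_bessel, fmul_const_mul (memLp_top_const _), fmul_one, S, smul_sub]
  simp only [neg_smul]
  abel

theorem inner_D_D (j : Fin 2) (f g : L2) :
    inner ℂ (D j f) (D j g) = -inner ℂ (S f) (DD j j g) := by
  rw [D, S, DD, inner_fmul (memLp_D j), inner_fmul memLp_bessel, ← inner_neg_right]
  congr 1
  have h1 : MemLp (fun ξ => conj (dsymb j ξ * bessel ξ)) ∞ (volume : Measure Plane) := (memLp_D j).star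
  have h2 : MemLp (fun ξ => conj (bessel ξ)) ∞ (volume : Measure Plane) := memLp_bessel.star
  have h3 : MemLp (fun ξ => conj (bessel ξ) * (dsymb j ξ * (dsymb j ξ * bessel ξ))) ∞
    (volume : Measure Plane) := (memLp_DD j j).mul' h2
  rw [fmul_fmul h1 (memLp_D j), fmul_fmul h2 (memLp_DD j j), ← neg_one_smul ℂ (fmul _ g),
    ← fmul_const_mul h3]
  congr 1
  congr 1
  funext ξ
  rw [map_mul, conj_dsymb]
  ring

/-- The symbols of the derivatives commute and are imaginary. Consequently the Hessian and the
Laplacian have the same `L²` norm. -/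
theorem inner_DD_DD (j k : Fin 2) (f g : L2) :
    inner ℂ (DD j k f) (DD j k g) = inner ℂ (DD j j f) (DD k k g) := by
  rw [DD, DD, DD, inner_fmul (memLp_DD j k), inner_fmul (memLp_DD j j)]
  have h1 : ∀ i l, MemLp (fun ξ => conj (dsymb i ξ * (dsymb l ξ * bessel ξ))) ∞
    (volume : Measure Plane) := fun i l => (memLp_DD i l).star
  rw [fmul_fmul (h1 j k) (memLp_DD j k), fmul_fmul (h1 j j) (memLp_DD k k)]
  congr 1
  congr 1
  congr 1
  funext ξ
  simp only [map_mul, conj_dsymb]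
  ring

/-- The `L²` norm of the Laplacian of `S g`. -/
def lapNorm (g : L2) : ℝ := 4 * Real.pi ^ 2 * ‖g - S g‖

theorem lapNorm_nonneg (g : L2) : 0 ≤ lapNorm g := by unfold lapNorm; positivity

theorem norm_sum_DD (g : L2) : ‖∑ j, DD j j g‖ = lapNorm g := by
  rw [sum_DD, norm_smul, norm_neg, norm_real, Real.norm_of_nonneg (by positivity), lapNorm]

theorem sum_norm_DD_sq (g : L2) : ∑ j, ∑ k, ‖DD j k g‖ ^ 2 = lapNorm g ^ 2 := by
  have h : ∀ x : L2, ((‖x‖ ^ 2 : ℝ) : ℂ) = inner ℂ x x := fun x => by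
    rw [inner_self_eq_norm_sq_to_K]; simp
  have : ((∑ j, ∑ k, ‖DD j k g‖ ^ 2 : ℝ) : ℂ) = ((lapNorm g ^ 2 : ℝ) : ℂ) := by
    rw [← norm_sum_DD, h, inner_sum]
    simp only [sum_inner, ofReal_sum]
    rw [Finset.sum_comm]
    refine Finset.sum_congr rfl fun j _ => Finset.sum_congr rfl fun k _ => ?_
    rw [h, inner_DD_DD]
  exact_mod_cast this

/-- Interpolation from `‖∇u‖² = -⟨u, Δu⟩` for `u = S g`. -/
theorem sum_norm_D_sq_le (g : L2) : ∑ j, ‖D j g‖ ^ 2 ≤ ‖S g‖ * lapNorm g := by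
  have h : ∀ x : L2, ((‖x‖ ^ 2 : ℝ) : ℂ) = inner ℂ x x := fun x => by
    rw [inner_self_eq_norm_sq_to_K]; simp
  have e : ((∑ j, ‖D j g‖ ^ 2 : ℝ) : ℂ) = -inner ℂ (S g) (∑ j, DD j j g) := by
    rw [inner_sum]
    simp only [ofReal_sum, h, inner_D_D, Finset.sum_neg_distrib]
  have h0 : 0 ≤ ∑ j, ‖D j g‖ ^ 2 := Finset.sum_nonneg fun _ _ => sq_nonneg _
  calc ∑ j, ‖D j g‖ ^ 2 = ‖((∑ j, ‖D j g‖ ^ 2 : ℝ) : ℂ)‖ := by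
        rw [norm_real, Real.norm_of_nonneg h0]
    _ ≤ ‖S g‖ * ‖∑ j, DD j j g‖ := by rw [e, norm_neg]; exact norm_inner_le_norm _ _
    _ = _ := by rw [norm_sum_DD]

/-- `S` is the Bessel potential of order `-2`, in the normalisation in which `∂ⱼ` has symbol `2πi
ξⱼ`. This permits writing every state as `S f`. -/
theorem memH2_iff (f : L2) : MemH2 f ↔ ∃ g, S g = f := by
  have e : ∀ g : L2, (S g : 𝓢'(Plane, ℂ))
      = TemperedDistribution.besselPotential Plane ℂ (-2) (g : 𝓢'(Plane, ℂ)) := fun g => by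
    rw [S, fmul_toTemperedDistribution memLp_bessel hasTemperateGrowth_bessel,
      TemperedDistribution.besselPotential]
    congr 2
    funext ξ
    rw [bessel]
    norm_num [Real.rpow_neg_one]
  constructor
  · rintro ⟨g, hg⟩
    refine ⟨g, toTemperedDistribution_injective ?_⟩
    simp only
    rw [e, TemperedDistribution.besselPotential_neg_apply_eq_iff]
    exact hg
  · rintro ⟨g, rfl⟩
    refine ⟨g, ?_⟩
    rw [← TemperedDistribution.besselPotential_neg_apply_eq_iff, e]

/-! ### The Galerkin frame of spectral cut-offs -/

/-- The indicator of the ball of radius `n`. -/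
def cutoff (n : ℕ) (ξ : Plane) : ℂ := (Metric.closedBall (0 : Plane) n).indicator 1 ξ

theorem cutoff_of_le {n : ℕ} {ξ : Plane} (h : ‖ξ‖ ≤ n) : cutoff n ξ = 1 := by
  rw [cutoff, indicator_of_mem (by simpa using h)]; rfl

theorem cutoff_of_lt {n : ℕ} {ξ : Plane} (h : (n : ℝ) < ‖ξ‖) : cutoff n ξ = 0 := by
  rw [cutoff, indicator_of_notMem (by simpa using h)]

theorem measurable_cutoff (n : ℕ) : Measurable (cutoff n) :=
  (measurable_one).indicator measurableSet_closedBall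

theorem norm_cutoff_le (n : ℕ) (ξ : Plane) : ‖cutoff n ξ‖ ≤ 1 := by
  rcases le_or_gt ‖ξ‖ n with h | h
  · simp [cutoff_of_le h]
  · simp [cutoff_of_lt h]

theorem memLp_cutoff (n : ℕ) : MemLp (cutoff n) ∞ (volume : Measure Plane) :=
  memLp_top_of_bound (measurable_cutoff n).aestronglyMeasurable 1
    (Eventually.of_forall (norm_cutoff_le n))

theorem memLp_cutoffInv (n : ℕ) :
    MemLp (fun ξ => cutoff n ξ * ((1 + ‖ξ‖ ^ 2 : ℝ) : ℂ)) ∞ (volume : Measure Plane) := by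
  refine memLp_top_of_bound (((measurable_cutoff n).mul (by fun_prop)).aestronglyMeasurable)
    (1 + (n : ℝ) ^ 2) (Eventually.of_forall fun ξ => ?_)
  rcases le_or_gt ‖ξ‖ n with h | h
  · rw [cutoff_of_le h, one_mul, norm_real, Real.norm_of_nonneg (by positivity)]
    gcongr
  · rw [cutoff_of_lt h, zero_mul, norm_zero]; positivity

theorem bessel_mul_inv (ξ : Plane) : bessel ξ * ((1 + ‖ξ‖ ^ 2 : ℝ) : ℂ) = 1 := by
  rw [bessel, ← ofReal_mul, inv_mul_cancel₀ (by positivity), ofReal_one]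

theorem cutoff_tail (n : ℕ) (g : L2) :
    ‖S g - fmul (cutoff n) (S g)‖ ≤ 1 / ((n : ℝ) + 1) * ‖g‖ := by
  have h1 : MemLp (fun ξ => cutoff n ξ * bessel ξ) ∞ (volume : Measure Plane) :=
    memLp_bessel.mul' (memLp_cutoff n)
  have e : S g - fmul (cutoff n) (S g)
      = fmul (fun ξ => bessel ξ + (-1) * (cutoff n ξ * bessel ξ)) g := by
    rw [fmul_add memLp_bessel (h1.const_mul _), fmul_const_mul h1, S,
      fmul_fmul (memLp_cutoff n) memLp_bessel, neg_one_smul, sub_eq_add_neg]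
  rw [e]
  refine norm_fmul_le (memLp_bessel.add (h1.const_mul _)) (fun ξ => ?_) g
  change ‖bessel ξ + (-1) * (cutoff n ξ * bessel ξ)‖ ≤ _
  rcases le_or_gt ‖ξ‖ n with h | h
  · rw [cutoff_of_le h]; simp; positivity
  · rw [cutoff_of_lt h]
    simp only [zero_mul, mul_zero, add_zero, norm_bessel, one_div]
    -- Beyond the cut-off the symbol is at most `1/(1 + n²)`, and `n ≤ n²` for natural `n`.
    have h2 : (n : ℝ) ≤ (n : ℝ) ^ 2 := by exact_mod_cast Nat.le_self_pow two_ne_zero n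
    have h3 : (n : ℝ) ^ 2 ≤ ‖ξ‖ ^ 2 := by gcongr
    exact inv_anti₀ (by positivity) (by linarith)

/-- The spectral cut-offs of the Laplacian. -/
def planeFrame : GalerkinFrame L2 where
  S := S
  P n := fmul (cutoff n)
  Q n := fmul fun ξ => cutoff n ξ * ((1 + ‖ξ‖ ^ 2 : ℝ) : ℂ)
  eps n := 1 / ((n : ℝ) + 1)
  P_symm n x y := by
    rw [inner_fmul (memLp_cutoff n)]
    congr 3
    funext ξ
    rcases le_or_gt ‖ξ‖ n with h | h
    · simp [cutoff_of_le h]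
    · simp [cutoff_of_lt h]
  P_P {m n} h x := by
    rw [fmul_fmul (memLp_cutoff n) (memLp_cutoff m)]
    congr 2
    funext ξ
    rcases le_or_gt ‖ξ‖ m with h1 | h1
    · rw [cutoff_of_le (h1.trans (by exact_mod_cast h)), one_mul]
    · simp [cutoff_of_lt h1]
  P_tendsto x := by
    rw [Metric.tendsto_atTop]
    intro ε hε
    obtain ⟨g, hg⟩ := denseRange_S.exists_dist_lt x (show (0 : ℝ) < ε / 3 by positivity)
    have h1 : Tendsto (fun n : ℕ => 1 / ((n : ℝ) + 1) * ‖g‖) atTop (𝓝 (0 * ‖g‖)) :=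
      tendsto_one_div_add_atTop_nhds_zero_nat.mul_const _
    rw [zero_mul] at h1
    obtain ⟨N, hN⟩ := eventually_atTop.1 (h1.eventually_lt_const (show (0 : ℝ) < ε / 3 by positivity))
    refine ⟨N, fun n hn => ?_⟩
    rw [dist_eq_norm] at hg ⊢
    have e : fmul (cutoff n) x - x = fmul (cutoff n) (x - S g) - (S g - fmul (cutoff n) (S g))
        - (x - S g) := by rw [map_sub]; abel
    have h2 := norm_fmul_le (memLp_cutoff n) (norm_cutoff_le n) (x - S g)
    have h3 := cutoff_tail n g
    have h4 := hN n hn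
    rw [e]
    have h5 := norm_sub_le (fmul (cutoff n) (x - S g) - (S g - fmul (cutoff n) (S g))) (x - S g)
    have h6 := norm_sub_le (fmul (cutoff n) (x - S g)) (S g - fmul (cutoff n) (S g))
    linarith
  S_Q n x := by
    rw [S, fmul_fmul memLp_bessel (memLp_cutoffInv n)]
    congr 2
    funext ξ
    rw [mul_left_comm, bessel_mul_inv, mul_one]
  Q_S n x := by
    rw [S, fmul_fmul (memLp_cutoffInv n) memLp_bessel]
    congr 2
    funext ξ
    rw [mul_assoc, mul_comm _ (bessel ξ), bessel_mul_inv, mul_one]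
  tail := cutoff_tail
  eps_tendsto := tendsto_one_div_add_atTop_nhds_zero_nat

end

end CSS

open MeasureTheory Complex Filter Topology Set FourierTransform
open scoped LineDeriv SchwartzMap ComplexConjugate ENNReal

namespace CSS

noncomputable section

/-! ### Integration by parts and Hardy's inequality -/

/-- The coordinate vectors. -/
def basisVec (j : Fin 2) : Plane := EuclideanSpace.single j (1 : ℝ)

/-- `u ∈ H¹(ℝ²)` with partial derivatives `du`. -/
def IsH1 (u : L2) (du : Fin 2 → L2) : Prop :=
  ∃ ψ : ℕ → 𝓢(Plane, ℂ), Tendsto (fun n => ((ψ n).toLp 2 : L2)) atTop (𝓝 u) ∧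
    ∀ j, Tendsto (fun n => ((∂_{basisVec j} (ψ n)).toLp 2 : L2)) atTop (𝓝 (du j))

theorem isH1_S (g : L2) : IsH1 (S g) (fun j => D j g) := by
  obtain ⟨φ, hφ⟩ := exists_schwartz_seq g
  choose ψ h0 h1 _ using fun n => exists_schwartz (φ n)
  refine ⟨ψ, ?_, fun j => ?_⟩
  · simpa only [Function.comp_def, h0] using (S.continuous.tendsto g).comp hφ
  · simpa only [basisVec, Function.comp_def, h1] using ((D j).continuous.tendsto g).comp hφ

theorem isH1_D (k : Fin 2) (g : L2) : IsH1 (D k g) (fun j => DD j k g) := by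
  obtain ⟨φ, hφ⟩ := exists_schwartz_seq g
  choose ψ _ h1 h2 using fun n => exists_schwartz (φ n)
  refine ⟨fun n => ∂_{basisVec k} (ψ n), ?_, fun j => ?_⟩
  · simpa only [basisVec, Function.comp_def, h1] using ((D k).continuous.tendsto g).comp hφ
  · simpa only [basisVec, Function.comp_def, h2] using ((DD j k).continuous.tendsto g).comp hφ

theorem inner_mulOp_eq_integral {a : Plane → ℂ} (ha : MemLp a ∞ (volume : Measure Plane))
    (f g : L2) : inner ℂ f (mulOp a g) = ∫ x, a x * (conj (f x) * g x) := by
  rw [L2.inner_def]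
  refine integral_congr_ae ?_
  filter_upwards [mulOp_ae ha g] with x hx
  rw [hx, RCLike.inner_apply]
  ring

theorem integral_ibp_schwartz {a a' : Plane → ℝ} {j : Fin 2} {C : ℝ} (ha : Continuous a)
    (ha' : Continuous a') (hC : ∀ x, |a x| ≤ C) (hC' : ∀ x, |a' x| ≤ C)
    (hd : ∀ x, HasLineDerivAt ℝ a (a' x) x (basisVec j)) (ψ χ : 𝓢(Plane, ℂ)) :
    ∫ x, (a x : ℂ) * (conj ((∂_{basisVec j} ψ) x) * χ x) +
      (a x : ℂ) * (conj (ψ x) * (∂_{basisVec j} χ) x)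
      = -∫ x, (a' x : ℂ) * (conj (ψ x) * χ x) := by
  have hP : ∀ ψ χ : 𝓢(Plane, ℂ), Integrable (fun x => conj (ψ x) * χ x) := fun ψ χ =>
    (ψ.memLp 2).star.integrable_mul (χ.memLp 2)
  have hs : ∀ (b : Plane → ℝ), Continuous b → (∀ x, |b x| ≤ C) → ∀ ψ χ : 𝓢(Plane, ℂ),
      Integrable fun x => (b x : ℂ) * (conj (ψ x) * χ x) := fun b hb hbC ψ χ =>
    (hP ψ χ).bdd_mul (c := C) (continuous_ofReal.comp hb).aestronglyMeasurable
      (Eventually.of_forall fun x => by rw [norm_real, Real.norm_eq_abs]; exact hbC x)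
  have hline : ∀ (ψ : 𝓢(Plane, ℂ)) (x : Plane),
      HasLineDerivAt ℝ (⇑ψ) ((∂_{basisVec j} ψ) x) x (basisVec j) := fun ψ x => by
    rw [SchwartzMap.lineDerivOp_apply_eq_fderiv]
    exact ψ.differentiableAt.hasFDerivAt.hasLineDerivAt _
  have h := integral_bilinear_hasLineDerivAt_right_eq_neg_left_of_integrable
    (μ := (volume : Measure Plane)) (B := ContinuousLinearMap.lsmul ℝ ℝ) (f := a) (f' := a')
    (g := fun x => conj (ψ x) * χ x)
    (g' := fun x => conj ((∂_{basisVec j} ψ) x) * χ x + conj (ψ x) * (∂_{basisVec j} χ) x)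
    (v := basisVec j)
    (by simpa [real_smul] using hs a' ha' hC' ψ χ)
    (by
      have h1 := (hs a ha hC (∂_{basisVec j} ψ) χ).add (hs a ha hC ψ (∂_{basisVec j} χ))
      refine h1.congr (Eventually.of_forall fun x => ?_)
      simp [real_smul])
    (by simpa [real_smul] using hs a ha hC ψ χ) (fun x _ => hd x)
    (fun x _ => by
      have h1 := hline ψ x
      have h2 := hline χ x
      rw [HasLineDerivAt] at h1 h2 ⊢
      have h3 := conjCLE.hasFDerivAt.comp_hasDerivAt (0 : ℝ) h1
      have h4 := h3.mul h2
      simpa using! h4)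
  simp only [ContinuousLinearMap.lsmul_apply, real_smul, mul_add] at h
  exact h

/-- Both sides are continuous in the functions and their derivatives for the `L²` norm, since `a`
and `a'` are bounded. The identity for Schwartz functions therefore passes to the limit. -/
theorem inner_ibp {a a' : Plane → ℝ} {j : Fin 2} {C : ℝ} (ha : Continuous a)
    (ha' : Continuous a') (hC : ∀ x, |a x| ≤ C) (hC' : ∀ x, |a' x| ≤ C)
    (hd : ∀ x, HasLineDerivAt ℝ a (a' x) x (basisVec j)) {u v : L2} {du dv : Fin 2 → L2}
    (hu : IsH1 u du) (hv : IsH1 v dv) :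
    inner ℂ (du j) (mulOp (fun x => a x) v) + inner ℂ u (mulOp (fun x => a x) (dv j))
      = -inner ℂ u (mulOp (fun x => a' x) v) := by
  have hm : ∀ b : Plane → ℝ, Continuous b → (∀ x, |b x| ≤ C) →
      MemLp (fun x => (b x : ℂ)) ∞ (volume : Measure Plane) := fun b hb hbC =>
    memLp_top_of_continuous (continuous_ofReal.comp hb) (C := C)
      fun x => by rw [norm_real, Real.norm_eq_abs]; exact hbC x
  obtain ⟨ψ, hψ, hψd⟩ := hu
  obtain ⟨χ, hχ, hχd⟩ := hv
  have hlim : ∀ (b : Plane → ℂ) {x y : ℕ → L2} {x' y' : L2}, Tendsto x atTop (𝓝 x') →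
      Tendsto y atTop (𝓝 y') →
      Tendsto (fun n => inner ℂ (x n) (mulOp b (y n))) atTop (𝓝 (inner ℂ x' (mulOp b y'))) :=
    fun b x y x' y' hx hy => hx.inner (((mulOp b).continuous.tendsto _).comp hy)
  refine tendsto_nhds_unique ((hlim (fun x => a x) (hψd j) hχ).add (hlim (fun x => a x) hψ (hχd j)))
    ((hlim (fun x => a' x) hψ hχ).neg.congr fun n => ?_)
  have hint : ∀ (b : Plane → ℝ), Continuous b → (∀ x, |b x| ≤ C) → ∀ ψ χ : 𝓢(Plane, ℂ),
      inner ℂ (ψ.toLp 2 : L2) (mulOp (fun x => b x) (χ.toLp 2))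
        = ∫ x, (b x : ℂ) * (conj (ψ x) * χ x) := fun b hb hbC ψ χ => by
    rw [inner_mulOp_eq_integral (hm b hb hbC)]
    refine integral_congr_ae ?_
    filter_upwards [ψ.coeFn_toLp 2, χ.coeFn_toLp 2] with x h1 h2
    rw [h1, h2]
  have hs : ∀ ψ χ : 𝓢(Plane, ℂ), Integrable fun x => (a x : ℂ) * (conj (ψ x) * χ x) := fun ψ χ =>
    ((ψ.memLp 2).star.integrable_mul (χ.memLp 2)).bdd_mul (c := C)
      (continuous_ofReal.comp ha).aestronglyMeasurable
      (Eventually.of_forall fun x => by rw [norm_real, Real.norm_eq_abs]; exact hC x)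
  rw [hint a' ha' hC', hint a ha hC, hint a ha hC, ← integral_add (hs _ _) (hs _ _),
    integral_ibp_schwartz ha ha' hC hC' hd]

theorem hasDerivAt_coord (x y : Plane) (i j : Fin 2) :
    HasDerivAt (fun t : ℝ => (x + t • basisVec j - y) i) (if i = j then 1 else 0) 0 := by
  have h1 : (fun t : ℝ => (x + t • basisVec j - y) i)
      = fun t => t * (if i = j then 1 else 0) + (x i - y i) := by
    funext t
    simp [basisVec]
    split_ifs <;> ring
  rw [h1]
  simpa using ((hasDerivAt_id (0 : ℝ)).mul_const (if i = j then (1 : ℝ) else 0)).add_const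
    (x i - y i)

theorem hasDerivAt_norm_sq_line (x y : Plane) (j : Fin 2) :
    HasDerivAt (fun t : ℝ => ‖x + t • basisVec j - y‖ ^ 2) (2 * (x - y) j) 0 := by
  have h0 := (hasDerivAt_coord x y 0 j).pow 2
  have h1 := (hasDerivAt_coord x y 1 j).pow 2
  have h := h0.add h1
  have e : (fun t : ℝ => ‖x + t • basisVec j - y‖ ^ 2)
      = (fun t : ℝ => (x + t • basisVec j - y) 0) ^ 2 + (fun t : ℝ => (x + t • basisVec j - y) 1) ^ 2 := by
    funext t; rw [norm_sq_plane]; rfl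
  rw [e]
  refine h.congr_deriv ?_
  fin_cases j <;> simp

/-- The regularised distance `(|x - y|² + ε²)^{1/2}`. -/
def rdist (ε : ℝ) (y x : Plane) : ℝ := Real.sqrt (‖x - y‖ ^ 2 + ε ^ 2)

theorem rdist_pos {ε : ℝ} (hε : 0 < ε) (y x : Plane) : 0 < rdist ε y x :=
  Real.sqrt_pos.2 (by positivity)

theorem rdist_sq (ε : ℝ) (y x : Plane) : rdist ε y x ^ 2 = ‖x - y‖ ^ 2 + ε ^ 2 :=
  Real.sq_sqrt (by positivity)

theorem le_rdist (ε : ℝ) (y x : Plane) : ε ≤ rdist ε y x :=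
  Real.le_sqrt_of_sq_le (by nlinarith [sq_nonneg ‖x - y‖])

theorem norm_le_rdist (ε : ℝ) (y x : Plane) : ‖x - y‖ ≤ rdist ε y x :=
  Real.le_sqrt_of_sq_le (by nlinarith [sq_nonneg ε])

theorem continuous_rdist (ε : ℝ) (y : Plane) : Continuous (rdist ε y) := by
  unfold rdist; fun_prop

/-- With `s = (|x - y|² + ε²)^{1/2}`, the field `(x - y)/s` has components bounded by `1` and
divergence `2/s - |x - y|²/s³ ≥ 1/s` in two dimensions. Integrating the divergence against `|u|²` by
parts leaves `2 ‖u‖ ‖∂ⱼu‖` for each `j`. The parameter `ε` keeps the coefficients bounded. -/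
theorem hardy_aux {u : L2} {du : Fin 2 → L2} (hu : IsH1 u du) {ε : ℝ} (hε : 0 < ε) (y : Plane) :
    ∫ x, (rdist ε y x)⁻¹ * ‖u x‖ ^ 2 ≤ 2 * ‖u‖ * ∑ j, ‖du j‖ := by
  set s := rdist ε y with hs
  have hs0 : ∀ x, 0 < s x := rdist_pos hε y
  have hsε : ∀ x, ε ≤ s x := le_rdist ε y
  have hsn : ∀ x, ‖x - y‖ ≤ s x := norm_le_rdist ε y
  have hsc : Continuous s := continuous_rdist ε y
  have hsne : ∀ x, s x ≠ 0 := fun x => (hs0 x).ne'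
  have hco : ∀ (j : Fin 2) x, |(x - y) j| ≤ s x := fun j x => (abs_coord_le j _).trans (hsn x)
  set a : Fin 2 → Plane → ℝ := fun j x => (x - y) j * (s x)⁻¹ with ha
  set a' : Fin 2 → Plane → ℝ := fun j x => (s x)⁻¹ - ((x - y) j) ^ 2 * ((s x)⁻¹) ^ 3 with ha'
  have hinv : ∀ x, (s x)⁻¹ ≤ ε⁻¹ := fun x => inv_anti₀ hε (hsε x)
  have hac : ∀ j, Continuous (a j) := fun j => by
    have := hsc.inv₀ hsne
    simp only [ha]
    fun_prop
  have ha'c : ∀ j, Continuous (a' j) := fun j => by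
    have := hsc.inv₀ hsne
    simp only [ha']
    fun_prop
  have hab : ∀ j x, |a j x| ≤ 1 := fun j x => by
    simp only [ha]
    rw [abs_mul, abs_of_pos (inv_pos.2 (hs0 x)), ← div_eq_mul_inv, div_le_one (hs0 x)]
    exact hco j x
  have hsq : ∀ (j : Fin 2) x, ((x - y) j) ^ 2 ≤ s x ^ 2 := fun j x => by
    rw [← sq_abs]; gcongr; exact hco j x
  have ha'0 : ∀ j x, 0 ≤ a' j x := fun j x => by
    have e : a' j x = (s x ^ 2 - ((x - y) j) ^ 2) * ((s x)⁻¹) ^ 3 := by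
      simp only [ha']; have := hsne x; field_simp
    rw [e]
    have := hsq j x
    have := inv_pos.2 (hs0 x)
    exact mul_nonneg (by linarith) (by positivity)
  have ha'b : ∀ j x, |a' j x| ≤ ε⁻¹ := fun j x => by
    rw [abs_of_nonneg (ha'0 j x)]
    have := inv_pos.2 (hs0 x)
    have h1 : 0 ≤ ((x - y) j) ^ 2 * ((s x)⁻¹) ^ 3 := by positivity
    have h2 := hinv x
    simp only [ha']
    linarith
  have hsum : ∀ x, (s x)⁻¹ ≤ a' 0 x + a' 1 x := fun x => by
    have e : a' 0 x + a' 1 x - (s x)⁻¹ = (s x ^ 2 - ‖x - y‖ ^ 2) * ((s x)⁻¹) ^ 3 := by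
      rw [norm_sq_plane]; simp only [ha']; have := hsne x; field_simp; ring
    have h1 : s x ^ 2 - ‖x - y‖ ^ 2 = ε ^ 2 := by rw [hs, rdist_sq]; ring
    have := inv_pos.2 (hs0 x)
    have h2 : 0 ≤ (s x ^ 2 - ‖x - y‖ ^ 2) * ((s x)⁻¹) ^ 3 := by rw [h1]; positivity
    linarith
  have hd : ∀ j x, HasLineDerivAt ℝ (a j) (a' j x) x (basisVec j) := fun j x => by
    rw [HasLineDerivAt]
    have h1 := hasDerivAt_coord x y j j
    have h2 := ((hasDerivAt_norm_sq_line x y j).add_const (ε ^ 2)).sqrt (by simp; positivity)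
    have h3 := h1.mul (h2.inv (by
      have := hsne x
      simpa [hs, rdist] using this))
    refine h3.congr_deriv ?_
    simp only [ha', if_true]
    have e : Real.sqrt (‖x + (0 : ℝ) • basisVec j - y‖ ^ 2 + ε ^ 2) = s x := by simp [hs, rdist]
    simp only [Pi.inv_apply, e]
    simp only [zero_smul, add_zero]
    have := hsne x
    field_simp
    ring
  set C : ℝ := max 1 ε⁻¹
  have hibp := fun j => inner_ibp (hac j) (ha'c j) (C := C) (fun x => (hab j x).trans (le_max_left _ _))
    (fun x => (ha'b j x).trans (le_max_right _ _)) (hd j) hu hu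
  have hm : ∀ j, MemLp (fun x => (a' j x : ℂ)) ∞ (volume : Measure Plane) := fun j =>
    memLp_top_of_continuous (continuous_ofReal.comp (ha'c j)) (C := ε⁻¹)
      fun x => by rw [norm_real, Real.norm_eq_abs]; exact ha'b j x
  have hma : ∀ j, MemLp (fun x => (a j x : ℂ)) ∞ (volume : Measure Plane) := fun j =>
    memLp_top_of_continuous (continuous_ofReal.comp (hac j)) (C := 1)
      fun x => by rw [norm_real, Real.norm_eq_abs]; exact hab j x
  have hmn : ∀ j (v : L2), ‖mulOp (fun x => (a j x : ℂ)) v‖ ≤ ‖v‖ := fun j v => by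
    have := norm_mulOp_le (hma j) (C := 1)
      (fun x => by rw [norm_real, Real.norm_eq_abs]; exact hab j x) v
    rwa [one_mul] at this
  have hu2 : Integrable fun x => ‖u x‖ ^ 2 := (Lp.memLp u).integrable_norm_pow (by norm_num)
  have hint : ∀ (b : Plane → ℝ), Continuous b → (∀ x, |b x| ≤ ε⁻¹) →
      Integrable fun x => b x * ‖u x‖ ^ 2 := fun b hb hbC =>
    hu2.bdd_mul (c := ε⁻¹) hb.aestronglyMeasurable (Eventually.of_forall hbC)
  have hj : ∀ j, ∫ x, a' j x * ‖u x‖ ^ 2 ≤ 2 * ‖u‖ * ‖du j‖ := fun j => by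
    have e : ((∫ x, a' j x * ‖u x‖ ^ 2 : ℝ) : ℂ) = inner ℂ u (mulOp (fun x => a' j x) u) := by
      rw [inner_mulOp_eq_integral (hm j), ← integral_complex_ofReal]
      refine integral_congr_ae (Eventually.of_forall fun x => ?_)
      simp only
      rw [← normSq_eq_conj_mul_self, normSq_eq_norm_sq]
      push_cast; ring
    have h1 : ‖((∫ x, a' j x * ‖u x‖ ^ 2 : ℝ) : ℂ)‖ ≤ 2 * ‖u‖ * ‖du j‖ := by
      rw [e, ← norm_neg, ← hibp j]
      refine (norm_add_le _ _).trans ?_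
      have h2 := (norm_inner_le_norm (𝕜 := ℂ) (du j) (mulOp (fun x => (a j x : ℂ)) u)).trans
        (mul_le_mul_of_nonneg_left (hmn j u) (norm_nonneg _))
      have h3 := (norm_inner_le_norm (𝕜 := ℂ) u (mulOp (fun x => (a j x : ℂ)) (du j))).trans
        (mul_le_mul_of_nonneg_left (hmn j (du j)) (norm_nonneg _))
      linarith
    rw [norm_real] at h1
    exact (le_abs_self _).trans h1
  calc ∫ x, (s x)⁻¹ * ‖u x‖ ^ 2 ≤ ∫ x, (a' 0 x * ‖u x‖ ^ 2 + a' 1 x * ‖u x‖ ^ 2) := by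
        refine integral_mono ?_ ?_ fun x => ?_
        · exact hint (fun x => (s x)⁻¹) (hsc.inv₀ hsne) fun x => by
            rw [abs_of_pos (inv_pos.2 (hs0 x))]; exact hinv x
        · exact (hint _ (ha'c 0) (ha'b 0)).add (hint _ (ha'c 1) (ha'b 1))
        · simp only
          rw [← add_mul]
          exact mul_le_mul_of_nonneg_right (hsum x) (sq_nonneg _)
    _ = _ := integral_add (hint _ (ha'c 0) (ha'b 0)) (hint _ (ha'c 1) (ha'b 1))
    _ ≤ 2 * ‖u‖ * ∑ j, ‖du j‖ := by
        rw [Fin.sum_univ_two]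
        have h0 := hj 0
        have h1 := hj 1
        linarith

/-- The singular weight `1 / |x - y|`. -/
def sing (x y : Plane) : ℝ≥0∞ := ENNReal.ofReal ‖x - y‖⁻¹

theorem sing_comm (x y : Plane) : sing x y = sing y x := by rw [sing, sing, norm_sub_rev]

theorem measurable_sing : Measurable (fun p : Plane × Plane => sing p.1 p.2) := by
  unfold sing; fun_prop

theorem measurable_sing_left (y : Plane) : Measurable fun x => sing x y := by
  unfold sing; fun_prop

/-- `f` satisfies `∫ |f|² / |x - y| dx ≤ c²` for all `y`. -/
structure HasHardy (f : Plane → ℂ) (c : ℝ) : Prop where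
  nonneg : 0 ≤ c
  meas : AEStronglyMeasurable f (volume : Measure Plane)
  bound : ∀ y, ∫⁻ x, ‖f x‖ₑ ^ 2 * sing x y ≤ ENNReal.ofReal (c ^ 2)

/-- **Hardy's inequality** in the plane. -/
theorem hardy {u : L2} {du : Fin 2 → L2} (hu : IsH1 u du) :
    HasHardy u (Real.sqrt (2 * ‖u‖ * ∑ j, ‖du j‖)) := by
  have h0 : 0 ≤ 2 * ‖u‖ * ∑ j, ‖du j‖ := by positivity
  refine ⟨Real.sqrt_nonneg _, (Lp.memLp u).1, fun y => ?_⟩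
  rw [Real.sq_sqrt h0]
  set ε : ℕ → ℝ := fun n => 1 / ((n : ℝ) + 1) with hε
  have hε0 : ∀ n, 0 < ε n := fun n => by positivity
  have hεt : Tendsto ε atTop (𝓝 0) := tendsto_one_div_add_atTop_nhds_zero_nat
  have hmeas : ∀ n, AEMeasurable (fun x => ‖u x‖ₑ ^ 2 * ENNReal.ofReal (rdist (ε n) y x)⁻¹)
      (volume : Measure Plane) := fun n =>
    ((Lp.memLp u).1.enorm.pow_const 2).mul
      ((continuous_rdist (ε n) y).measurable.inv.ennreal_ofReal.aemeasurable)
  have hle : ∀ n, ∫⁻ x, ‖u x‖ₑ ^ 2 * ENNReal.ofReal (rdist (ε n) y x)⁻¹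
      ≤ ENNReal.ofReal (2 * ‖u‖ * ∑ j, ‖du j‖) := fun n => by
    refine le_trans (le_of_eq ?_) (ENNReal.ofReal_le_ofReal (hardy_aux hu (hε0 n) y))
    rw [ofReal_integral_eq_lintegral_ofReal]
    · refine lintegral_congr fun x => ?_
      rw [ENNReal.ofReal_mul (inv_pos.2 (rdist_pos (hε0 n) y x)).le, mul_comm,
        ENNReal.ofReal_pow (norm_nonneg _), ofReal_norm]
    · refine ((Lp.memLp u).integrable_norm_pow (by norm_num)).bdd_mul (c := (ε n)⁻¹)
        ((continuous_rdist (ε n) y).inv₀ fun x => (rdist_pos (hε0 n) y x).ne').aestronglyMeasurable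
        (Eventually.of_forall fun x => ?_)
      rw [Real.norm_of_nonneg (inv_pos.2 (rdist_pos (hε0 n) y x)).le]
      exact inv_anti₀ (hε0 n) (le_rdist (ε n) y x)
    · exact Eventually.of_forall fun x => by
        have := inv_pos.2 (rdist_pos (hε0 n) y x)
        positivity
  have hlim : ∀ x, ‖u x‖ₑ ^ 2 * sing x y
      ≤ liminf (fun n => ‖u x‖ₑ ^ 2 * ENNReal.ofReal (rdist (ε n) y x)⁻¹) atTop := fun x => by
    -- At `x = y` the weight is `0`, since the inverse of `0` is `0`; elsewhere the regularised
    -- weights converge and Fatou's lemma applies.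
    rcases eq_or_ne x y with rfl | hxy
    · simp [sing]
    · have hne : ‖x - y‖ ≠ 0 := norm_ne_zero_iff.2 (sub_ne_zero.2 hxy)
      have h1 : Tendsto (fun n => rdist (ε n) y x) atTop (𝓝 ‖x - y‖) := by
        have h2 : Tendsto (fun n => rdist (ε n) y x) atTop (𝓝 (Real.sqrt (‖x - y‖ ^ 2 + 0 ^ 2))) :=
          ((hεt.pow 2).const_add _).sqrt
        simpa using h2
      have h3 := ENNReal.tendsto_ofReal (h1.inv₀ hne)
      have h4 := ENNReal.Tendsto.const_mul (a := ‖u x‖ₑ ^ 2) h3 (Or.inr (by simp))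
      exact h4.liminf_eq.ge
  calc ∫⁻ x, ‖u x‖ₑ ^ 2 * sing x y
      ≤ ∫⁻ x, liminf (fun n => ‖u x‖ₑ ^ 2 * ENNReal.ofReal (rdist (ε n) y x)⁻¹) atTop :=
        lintegral_mono hlim
    _ ≤ liminf (fun n => ∫⁻ x, ‖u x‖ₑ ^ 2 * ENNReal.ofReal (rdist (ε n) y x)⁻¹) atTop :=
        lintegral_liminf_le' hmeas
    _ ≤ _ := by
        refine (liminf_le_liminf (Eventually.of_forall hle)).trans ?_
        simp

theorem HasHardy.mono {f : Plane → ℂ} {c c' : ℝ} (h : HasHardy f c) (hc : c ≤ c') : HasHardy f c' :=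
  ⟨h.nonneg.trans hc, h.meas, fun y => (h.bound y).trans
    (ENNReal.ofReal_le_ofReal (pow_le_pow_left₀ h.nonneg hc 2))⟩

theorem hardy_S (g : L2) : HasHardy (S g) (Real.sqrt (2 * ‖S g‖ * ∑ j, ‖D j g‖)) := hardy (isH1_S g)

theorem hardy_D (k : Fin 2) (g : L2) :
    HasHardy (D k g) (Real.sqrt (2 * ‖D k g‖ * ∑ j, ‖DD j k g‖)) := hardy (isH1_D k g)

end

end CSS

open MeasureTheory Complex Filter Topology Set FourierTransform
open scoped LineDeriv SchwartzMap ComplexConjugate ENNReal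

namespace CSS

noncomputable section

/-! ### Convolution with kernels dominated by `1 / |x|` -/

/-- `∫ |ρ| / |x - y| dx ≤ B` for all `y`. -/
structure HasPot (ρ : Plane → ℂ) (B : ℝ) : Prop where
  nonneg : 0 ≤ B
  meas : AEStronglyMeasurable ρ (volume : Measure Plane)
  bound : ∀ y, ∫⁻ x, ‖ρ x‖ₑ * sing x y ≤ ENNReal.ofReal B

theorem sq_lintegral_mul_weight_le {f g : Plane → ℂ} (hf : AEStronglyMeasurable f (volume : Measure Plane))
    (hg : AEStronglyMeasurable g (volume : Measure Plane)) {w : Plane → ℝ} (hw : Measurable w)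
    (hw0 : ∀ x, 0 ≤ w x) :
    (∫⁻ x, ‖f x‖ₑ * ‖g x‖ₑ * ENNReal.ofReal (w x)) ^ 2
      ≤ (∫⁻ x, ‖f x‖ₑ ^ 2 * ENNReal.ofReal (w x)) * ∫⁻ x, ‖g x‖ₑ ^ 2 * ENNReal.ofReal (w x) := by
  set t : Plane → ℝ≥0∞ := fun x => ENNReal.ofReal (Real.sqrt (w x)) with ht
  have htm : Measurable t := by simp only [ht]; fun_prop
  have htt : ∀ x, t x * t x = ENNReal.ofReal (w x) := fun x => by
    simp only [ht]
    rw [← ENNReal.ofReal_mul (Real.sqrt_nonneg _), Real.mul_self_sqrt (hw0 x)]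
  have h := ENNReal.lintegral_mul_le_Lp_mul_Lq (volume : Measure Plane) Real.HolderConjugate.two_two
    (f := fun x => ‖f x‖ₑ * t x) (g := fun x => ‖g x‖ₑ * t x)
    (hf.enorm.mul htm.aemeasurable) (hg.enorm.mul htm.aemeasurable)
  have e : ∀ φ : Plane → ℂ, ∫⁻ x, (‖φ x‖ₑ * t x) ^ (2 : ℝ) = ∫⁻ x, ‖φ x‖ₑ ^ 2 * ENNReal.ofReal (w x) :=
    fun φ => lintegral_congr fun x => by
      rw [← htt, ENNReal.rpow_two]; ring
  have e2 : ∫⁻ x, ((fun x => ‖f x‖ₑ * t x) * fun x => ‖g x‖ₑ * t x) x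
      = ∫⁻ x, ‖f x‖ₑ * ‖g x‖ₑ * ENNReal.ofReal (w x) := lintegral_congr fun x => by
    rw [← htt, Pi.mul_apply]; ring
  rw [e2, e, e] at h
  refine (pow_le_pow_left' h 2).trans (le_of_eq ?_)
  rw [mul_pow, ← ENNReal.rpow_natCast, ← ENNReal.rpow_natCast, ← ENNReal.rpow_mul,
    ← ENNReal.rpow_mul]
  norm_num

theorem sq_lintegral_mul_sing_le {f g : Plane → ℂ} (hf : AEStronglyMeasurable f (volume : Measure Plane))
    (hg : AEStronglyMeasurable g (volume : Measure Plane)) (y : Plane) :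
    (∫⁻ x, ‖f x‖ₑ * ‖g x‖ₑ * sing x y) ^ 2
      ≤ (∫⁻ x, ‖f x‖ₑ ^ 2 * sing x y) * ∫⁻ x, ‖g x‖ₑ ^ 2 * sing x y :=
  sq_lintegral_mul_weight_le hf hg (by fun_prop) fun x => by positivity

theorem HasHardy.lintegral_le {f g : Plane → ℂ} {a b : ℝ} (hf : HasHardy f a) (hg : HasHardy g b)
    (y : Plane) : ∫⁻ x, ‖f x‖ₑ * ‖g x‖ₑ * sing x y ≤ ENNReal.ofReal (a * b) := by
  have h := (sq_lintegral_mul_sing_le hf.meas hg.meas y).trans (mul_le_mul' (hf.bound y) (hg.bound y))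
  rw [← ENNReal.ofReal_mul (sq_nonneg a), ← mul_pow,
    ENNReal.ofReal_pow (mul_nonneg hf.nonneg hg.nonneg)] at h
  exact (ENNReal.pow_le_pow_left_iff two_ne_zero).1 h

theorem HasHardy.hasPot {f g ρ : Plane → ℂ} {a b : ℝ} (hf : HasHardy f a) (hg : HasHardy g b)
    (hρ : AEStronglyMeasurable ρ (volume : Measure Plane)) (h : ∀ᵐ x, ‖ρ x‖ ≤ ‖f x‖ * ‖g x‖) :
    HasPot ρ (a * b) := by
  refine ⟨mul_nonneg hf.nonneg hg.nonneg, hρ, fun y => le_trans ?_ (hf.lintegral_le hg y)⟩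
  refine lintegral_mono_ae ?_
  filter_upwards [h] with x hx
  gcongr
  rw [← enorm_mul]
  exact enorm_le_iff_norm_le.2 (by rwa [norm_mul])

theorem HasHardy.of_le {f g : Plane → ℂ} {a c : ℝ} (hf : HasHardy f a) (hc : 0 ≤ c)
    (hg : AEStronglyMeasurable g (volume : Measure Plane)) (h : ∀ᵐ x, ‖g x‖ ≤ c * ‖f x‖) :
    HasHardy g (c * a) := by
  refine ⟨mul_nonneg hc hf.nonneg, hg, fun y => ?_⟩
  calc ∫⁻ x, ‖g x‖ₑ ^ 2 * sing x y ≤ ∫⁻ x, ENNReal.ofReal (c ^ 2) * (‖f x‖ₑ ^ 2 * sing x y) := by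
        refine lintegral_mono_ae ?_
        filter_upwards [h] with x hx
        rw [← mul_assoc]
        gcongr
        rw [ENNReal.ofReal_pow hc, ← mul_pow]
        gcongr
        rw [← ofReal_norm, ← ofReal_norm, ← ENNReal.ofReal_mul hc]
        exact ENNReal.ofReal_le_ofReal hx
    _ = ENNReal.ofReal (c ^ 2) * ∫⁻ x, ‖f x‖ₑ ^ 2 * sing x y :=
        lintegral_const_mul' _ _ ENNReal.ofReal_ne_top
    _ ≤ ENNReal.ofReal (c ^ 2) * ENNReal.ofReal (a ^ 2) := by gcongr; exact hf.bound y
    _ = _ := by rw [← ENNReal.ofReal_mul (sq_nonneg c), mul_pow]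

theorem HasPot.of_le {ρ σ : Plane → ℂ} {B c : ℝ} (hρ : HasPot ρ B) (hc : 0 ≤ c)
    (hσ : AEStronglyMeasurable σ (volume : Measure Plane)) (h : ∀ᵐ x, ‖σ x‖ ≤ c * ‖ρ x‖) :
    HasPot σ (c * B) := by
  refine ⟨mul_nonneg hc hρ.nonneg, hσ, fun y => ?_⟩
  calc ∫⁻ x, ‖σ x‖ₑ * sing x y ≤ ∫⁻ x, ENNReal.ofReal c * (‖ρ x‖ₑ * sing x y) := by
        refine lintegral_mono_ae ?_
        filter_upwards [h] with x hx
        rw [← mul_assoc]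
        gcongr
        rw [← ofReal_norm, ← ofReal_norm, ← ENNReal.ofReal_mul hc]
        exact ENNReal.ofReal_le_ofReal hx
    _ = ENNReal.ofReal c * ∫⁻ x, ‖ρ x‖ₑ * sing x y :=
        lintegral_const_mul' _ _ ENNReal.ofReal_ne_top
    _ ≤ ENNReal.ofReal c * ENNReal.ofReal B := by gcongr; exact hρ.bound y
    _ = _ := by rw [← ENNReal.ofReal_mul hc]

theorem HasPot.add {ρ σ : Plane → ℂ} {B C : ℝ} (hρ : HasPot ρ B) (hσ : HasPot σ C) :
    HasPot (fun x => ρ x + σ x) (B + C) := by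
  refine ⟨add_nonneg hρ.nonneg hσ.nonneg, hρ.meas.add hσ.meas, fun y => ?_⟩
  calc ∫⁻ x, ‖ρ x + σ x‖ₑ * sing x y ≤ ∫⁻ x, (‖ρ x‖ₑ * sing x y + ‖σ x‖ₑ * sing x y) :=
        lintegral_mono fun x => by
          rw [← add_mul]; gcongr; exact enorm_add_le _ _
    _ = (∫⁻ x, ‖ρ x‖ₑ * sing x y) + ∫⁻ x, ‖σ x‖ₑ * sing x y :=
        lintegral_add_left' (hρ.meas.enorm.mul (measurable_sing_left y).aemeasurable) _
    _ ≤ _ := by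
        rw [ENNReal.ofReal_add hρ.nonneg hσ.nonneg]
        exact add_le_add (hρ.bound y) (hσ.bound y)

/-- A measurable kernel dominated by `1 / |x|`. -/
structure SubCoulomb (k : Plane → ℝ) : Prop where
  meas : Measurable k
  bound : ∀ x, |k x| ≤ ‖x‖⁻¹

theorem SubCoulomb.enorm_le {k : Plane → ℝ} (hk : SubCoulomb k) (x y : Plane) :
    ‖((k (y - x) : ℝ) : ℂ)‖ₑ ≤ sing x y := by
  rw [sing, ← ofReal_norm]
  refine ENNReal.ofReal_le_ofReal ?_
  rw [norm_real, Real.norm_eq_abs, norm_sub_rev]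
  exact hk.bound _

/-- The convolution `k ∗ ρ`. -/
def cv (k : Plane → ℝ) (ρ : Plane → ℂ) (y : Plane) : ℂ := ∫ x, (k (y - x) : ℂ) * ρ x

section

variable {k : Plane → ℝ} (hk : SubCoulomb k)
include hk

theorem SubCoulomb.meas_left (y : Plane) : Measurable fun x => (k (y - x) : ℂ) := by
  have := hk.meas
  fun_prop

theorem SubCoulomb.integrable {ρ : Plane → ℂ} {B : ℝ} (h : HasPot ρ B) (y : Plane) :
    Integrable fun x => (k (y - x) : ℂ) * ρ x := by
  refine ⟨(hk.meas_left y).aestronglyMeasurable.mul h.meas, ?_⟩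
  refine lt_of_le_of_lt (lintegral_mono fun x => ?_) ((h.bound y).trans_lt ENNReal.ofReal_lt_top)
  rw [enorm_mul, mul_comm]
  gcongr
  exact hk.enorm_le x y

theorem SubCoulomb.enorm_cv_le (ρ : Plane → ℂ) (y : Plane) :
    ‖cv k ρ y‖ₑ ≤ ∫⁻ x, ‖ρ x‖ₑ * sing x y := by
  refine (enorm_integral_le_lintegral_enorm _).trans (lintegral_mono fun x => ?_)
  rw [enorm_mul, mul_comm]
  gcongr
  exact hk.enorm_le x y

theorem SubCoulomb.norm_cv_le {ρ : Plane → ℂ} {B : ℝ} (h : HasPot ρ B) (y : Plane) :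
    ‖cv k ρ y‖ ≤ B := by
  have := (hk.enorm_cv_le ρ y).trans (h.bound y)
  rw [← ofReal_norm] at this
  exact (ENNReal.ofReal_le_ofReal_iff h.nonneg).1 this

theorem SubCoulomb.aestronglyMeasurable_cv {ρ : Plane → ℂ}
    (hρ : AEStronglyMeasurable ρ (volume : Measure Plane)) :
    AEStronglyMeasurable (cv k ρ) (volume : Measure Plane) := by
  have h1 : AEStronglyMeasurable (fun p : Plane × Plane => (k (p.1 - p.2) : ℂ) * ρ p.2)
      ((volume : Measure Plane).prod volume) := by
    refine AEStronglyMeasurable.mul ?_ hρ.comp_snd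
    have := hk.meas
    exact Measurable.aestronglyMeasurable (by fun_prop)
  exact h1.integral_prod_right'

theorem SubCoulomb.cv_add {ρ σ : Plane → ℂ} {B C : ℝ} (hρ : HasPot ρ B) (hσ : HasPot σ C) (y : Plane) :
    cv k (fun x => ρ x + σ x) y = cv k ρ y + cv k σ y := by
  simp only [cv, mul_add]
  exact integral_add (hk.integrable hρ y) (hk.integrable hσ y)

theorem SubCoulomb.cv_sub {ρ σ : Plane → ℂ} {B C : ℝ} (hρ : HasPot ρ B) (hσ : HasPot σ C) (y : Plane) :
    cv k (fun x => ρ x - σ x) y = cv k ρ y - cv k σ y := by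
  simp only [cv, mul_sub]
  exact integral_sub (hk.integrable hρ y) (hk.integrable hσ y)

/-- Cauchy-Schwarz with weight `1/|x - y|` gives `|k ∗ ρ|²(y) ≤ a² ∫ |f|²/|x - y| dx`. Multiplying
by `|h(y)|²` and integrating in `y` first, the Hardy bound of `h` absorbs the weight. Only the `L²`
norm of `f` survives, so a difference of two states can be placed there without losing a derivative.
-/
theorem SubCoulomb.eLpNorm_cv_mul_le {ρ f g h : Plane → ℂ} {a b : ℝ}
    (hf : AEStronglyMeasurable f (volume : Measure Plane)) (hg : HasHardy g a) (hh : HasHardy h b)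
    (hρ : ∀ᵐ x, ‖ρ x‖ ≤ ‖f x‖ * ‖g x‖) :
    eLpNorm (fun y => cv k ρ y * h y) 2 volume ≤ ENNReal.ofReal (a * b) * eLpNorm f 2 volume := by
  have hsq : ∀ F : Plane → ℂ, eLpNorm F 2 volume ^ 2 = ∫⁻ x, ‖F x‖ₑ ^ 2 := fun F => by
    rw [eLpNorm_eq_lintegral_rpow_enorm_toReal two_ne_zero ENNReal.ofNat_ne_top, ← ENNReal.rpow_natCast,
      ← ENNReal.rpow_mul]
    simp
  refine (ENNReal.pow_le_pow_left_iff two_ne_zero).1 ?_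
  rw [mul_pow, hsq, hsq]
  have hmeas : AEMeasurable (fun p : Plane × Plane => ‖f p.2‖ₑ ^ 2 * sing p.2 p.1 * ‖h p.1‖ₑ ^ 2)
      ((volume : Measure Plane).prod volume) := by
    refine ((hf.comp_snd.enorm.pow_const 2).mul ?_).mul (hh.meas.comp_fst.enorm.pow_const 2)
    exact (measurable_sing.comp measurable_swap).aemeasurable
  calc ∫⁻ y, ‖cv k ρ y * h y‖ₑ ^ 2
      ≤ ∫⁻ y, ENNReal.ofReal (a ^ 2) * ∫⁻ x, ‖f x‖ₑ ^ 2 * sing x y * ‖h y‖ₑ ^ 2 := by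
        refine lintegral_mono fun y => ?_
        rw [enorm_mul, mul_pow, lintegral_mul_const' _ _ (by finiteness), ← mul_assoc]
        gcongr
        refine (pow_le_pow_left' ((hk.enorm_cv_le ρ y).trans
          (lintegral_mono_ae (g := fun x => ‖f x‖ₑ * ‖g x‖ₑ * sing x y) ?_)) 2).trans
          ((sq_lintegral_mul_sing_le hf hg.meas y).trans ?_)
        · filter_upwards [hρ] with x hx
          gcongr
          rw [← enorm_mul]
          exact enorm_le_iff_norm_le.2 (by rwa [norm_mul])
        · rw [mul_comm]
          gcongr
          exact hg.bound y
    _ = ENNReal.ofReal (a ^ 2) * ∫⁻ x, ∫⁻ y, ‖f x‖ₑ ^ 2 * sing x y * ‖h y‖ₑ ^ 2 := by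
        rw [lintegral_const_mul' _ _ ENNReal.ofReal_ne_top, lintegral_lintegral_swap hmeas]
    _ ≤ ENNReal.ofReal (a ^ 2) * ∫⁻ x, ‖f x‖ₑ ^ 2 * ENNReal.ofReal (b ^ 2) := by
        gcongr with x
        simp only [mul_assoc]
        rw [lintegral_const_mul' _ _ (by finiteness)]
        gcongr
        refine le_trans (le_of_eq (lintegral_congr fun y => ?_)) (hh.bound x)
        rw [sing_comm, mul_comm]
    _ = _ := by
        rw [lintegral_mul_const' _ _ ENNReal.ofReal_ne_top, ENNReal.ofReal_mul hg.nonneg, mul_pow,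
          ENNReal.ofReal_pow hg.nonneg, ENNReal.ofReal_pow hh.nonneg]
        ring

/-- Fubini's theorem for convolutions. -/
theorem SubCoulomb.integral_cv_mul {ρ θ : Plane → ℂ} {B : ℝ} (hρ : Integrable ρ) (hθ : HasPot θ B) :
    Integrable (fun x => ρ x * ∫ y, (k (y - x) : ℂ) * θ y) ∧
    ∫ y, cv k ρ y * θ y = ∫ x, ρ x * ∫ y, (k (y - x) : ℂ) * θ y := by
  have hm : AEStronglyMeasurable (fun p : Plane × Plane => (k (p.1 - p.2) : ℂ) * ρ p.2 * θ p.1)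
      ((volume : Measure Plane).prod volume) := by
    refine AEStronglyMeasurable.mul (AEStronglyMeasurable.mul ?_ hρ.1.comp_snd) hθ.meas.comp_fst
    have := hk.meas
    exact Measurable.aestronglyMeasurable (by fun_prop)
  have hint : Integrable (fun p : Plane × Plane => (k (p.1 - p.2) : ℂ) * ρ p.2 * θ p.1)
      ((volume : Measure Plane).prod volume) := by
    refine ⟨hm, ?_⟩
    rw [HasFiniteIntegral, lintegral_prod_symm _ hm.enorm]
    calc ∫⁻ x, ∫⁻ y, ‖(k (y - x) : ℂ) * ρ x * θ y‖ₑ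
        ≤ ∫⁻ x, ‖ρ x‖ₑ * ENNReal.ofReal B := by
          refine lintegral_mono fun x => ?_
          calc ∫⁻ y, ‖(k (y - x) : ℂ) * ρ x * θ y‖ₑ ≤ ∫⁻ y, ‖ρ x‖ₑ * (‖θ y‖ₑ * sing y x) := by
                refine lintegral_mono fun y => ?_
                rw [enorm_mul, enorm_mul, mul_comm ‖(k (y - x) : ℂ)‖ₑ, mul_assoc,
                  mul_comm ‖(k (y - x) : ℂ)‖ₑ, sing_comm]
                gcongr
                exact hk.enorm_le x y
            _ = ‖ρ x‖ₑ * ∫⁻ y, ‖θ y‖ₑ * sing y x := lintegral_const_mul' _ _ (by finiteness)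
            _ ≤ _ := by gcongr; exact hθ.bound x
      _ = (∫⁻ x, ‖ρ x‖ₑ) * ENNReal.ofReal B := lintegral_mul_const' _ _ ENNReal.ofReal_ne_top
      _ < ∞ := ENNReal.mul_lt_top hρ.2 ENNReal.ofReal_lt_top
  have e : ∀ y, cv k ρ y * θ y = ∫ x, (k (y - x) : ℂ) * ρ x * θ y := fun y => by
    rw [cv, ← integral_mul_const]
  have e2 : ∀ x, ∫ y, (k (y - x) : ℂ) * ρ x * θ y = ρ x * ∫ y, (k (y - x) : ℂ) * θ y := fun x => by
    rw [← integral_const_mul]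
    refine integral_congr_ae (Eventually.of_forall fun y => ?_)
    simp only
    ring
  constructor
  · simpa only [e2] using hint.integral_prod_right
  · simp only [e]
    rw [integral_integral_swap hint]
    simp only [e2]

end

end

end CSS

open MeasureTheory Complex Filter Topology Set FourierTransform
open scoped LineDeriv SchwartzMap ComplexConjugate ENNReal

namespace CSS

noncomputable section

/-! ### The regularised vortex kernels -/

theorem perp_zero (x : Plane) : perp x 0 = -(x 1) := rfl

theorem perp_one (x : Plane) : perp x 1 = x 0 := rfl

theorem abs_perp_le (j : Fin 2) (x : Plane) : |perp x j| ≤ ‖x‖ := by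
  fin_cases j
  · simpa [perp] using abs_coord_le 1 x
  · simpa [perp] using abs_coord_le 0 x

/-- The components of `x^⊥ / max(|x|², R²)`. -/
def kern (R : ℝ) (j : Fin 2) (x : Plane) : ℝ := perp x j * (max (‖x‖ ^ 2) (R ^ 2))⁻¹

theorem measurable_perp (j : Fin 2) : Measurable fun x : Plane => perp x j := by
  fin_cases j
  · simp only [Fin.zero_eta, perp_zero]; fun_prop
  · simp only [Fin.mk_one, perp_one]; fun_prop

theorem subCoulomb_kern (R : ℝ) (j : Fin 2) : SubCoulomb (kern R j) := by
  refine ⟨?_, fun x => ?_⟩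
  · have := measurable_perp j
    unfold kern
    fun_prop
  · rcases eq_or_ne x 0 with rfl | hx
    · have : perp (0 : Plane) j = 0 := by fin_cases j <;> simp [perp]
      simp [kern, this]
    · have hx0 : 0 < ‖x‖ := norm_pos_iff.2 hx
      have h1 : ‖x‖ ^ 2 ≤ max (‖x‖ ^ 2) (R ^ 2) := le_max_left _ _
      rw [kern, abs_mul, abs_of_nonneg (a := (max (‖x‖ ^ 2) (R ^ 2))⁻¹) (by positivity)]
      calc |perp x j| * (max (‖x‖ ^ 2) (R ^ 2))⁻¹ ≤ ‖x‖ * (‖x‖ ^ 2)⁻¹ := by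
            gcongr
            exact abs_perp_le j x
        _ = ‖x‖⁻¹ := by field_simp

theorem kern_neg (R : ℝ) (j : Fin 2) (x : Plane) : kern R j (-x) = -kern R j x := by
  have : perp (-x) j = -perp x j := by fin_cases j <;> simp [perp]
  rw [kern, kern, this, norm_neg, neg_mul]

/-- The field `x^⊥ F(|x|²)` is divergence free because `x^⊥` is orthogonal to `x`; it is paired here
with the gradient of `ū v`. The two bounds with `C` make its components and their derivatives
bounded. -/
theorem sum_integral_smooth {F F' : ℝ → ℝ} {C : ℝ} (hF : ∀ s, HasDerivAt F (F' s) s)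
    (hF' : Continuous F') (hC : ∀ r, 0 ≤ r → r * |F (r ^ 2)| ≤ C)
    (hC' : ∀ r, 0 ≤ r → 2 * r ^ 2 * |F' (r ^ 2)| ≤ C) {u v : L2} {du dv : Fin 2 → L2}
    (hu : IsH1 u du) (hv : IsH1 v dv) (y : Plane) :
    ∑ j, ∫ x, ((perp (x - y) j * F (‖x - y‖ ^ 2) : ℝ) : ℂ) *
      (conj (du j x) * v x + conj (u x) * dv j x) = 0 := by
  have hFc : Continuous F := continuous_iff_continuousAt.2 fun s => (hF s).continuousAt
  set a : Fin 2 → Plane → ℝ := fun j x => perp (x - y) j * F (‖x - y‖ ^ 2) with ha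
  set a' : Fin 2 → Plane → ℝ := fun j x => perp (x - y) j * (F' (‖x - y‖ ^ 2) * (2 * (x - y) j)) with ha'
  have hpc : ∀ j, Continuous fun x : Plane => perp (x - y) j := fun j => by
    fin_cases j
    · simp only [Fin.zero_eta, perp_zero]; fun_prop
    · simp only [Fin.mk_one, perp_one]; fun_prop
  have hac : ∀ j, Continuous (a j) := fun j => by
    have := hpc j
    simp only [ha]; fun_prop
  have ha'c : ∀ j, Continuous (a' j) := fun j => by
    have := hpc j
    simp only [ha']; fun_prop
  have hab : ∀ j x, |a j x| ≤ C := fun j x => by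
    refine le_trans ?_ (hC ‖x - y‖ (norm_nonneg _))
    simp only [ha]
    rw [abs_mul]
    gcongr
    exact abs_perp_le j _
  have ha'b : ∀ j x, |a' j x| ≤ C := fun j x => by
    refine le_trans ?_ (hC' ‖x - y‖ (norm_nonneg _))
    simp only [ha']
    rw [abs_mul, abs_mul, abs_mul, abs_two]
    calc |perp (x - y) j| * (|F' (‖x - y‖ ^ 2)| * (2 * |(x - y) j|))
        ≤ ‖x - y‖ * (|F' (‖x - y‖ ^ 2)| * (2 * ‖x - y‖)) := by
          gcongr
          · exact abs_perp_le j _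
          · exact abs_coord_le j _
      _ = _ := by ring
  have hperp : ∀ x j, HasDerivAt (fun t : ℝ => perp (x + t • basisVec j - y) j) 0 0 := fun x j => by
    fin_cases j
    · have h := (hasDerivAt_coord x y 1 0).neg
      simp only [one_ne_zero, if_false, neg_zero] at h
      exact h
    · simpa [perp] using hasDerivAt_coord x y 0 1
  have hd : ∀ j x, HasLineDerivAt ℝ (a j) (a' j x) x (basisVec j) := fun j x => by
    rw [HasLineDerivAt]
    have h1 := hasDerivAt_norm_sq_line x y j
    have h2 := HasDerivAt.comp (0 : ℝ) (hF _) h1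
    refine ((hperp x j).mul h2).congr_deriv ?_
    simp [ha']
  have hm : ∀ b : Plane → ℝ, Continuous b → (∀ x, |b x| ≤ C) →
      MemLp (fun x => (b x : ℂ)) ∞ (volume : Measure Plane) := fun b hb hbC =>
    memLp_top_of_continuous (continuous_ofReal.comp hb) (C := C)
      fun x => by rw [norm_real, Real.norm_eq_abs]; exact hbC x
  have hP : ∀ (b : Plane → ℝ), Continuous b → (∀ x, |b x| ≤ C) → ∀ f g : L2,
      Integrable fun x => (b x : ℂ) * (conj (f x) * g x) := fun b hb hbC f g =>
    ((Lp.memLp f).star.integrable_mul (Lp.memLp g)).bdd_mul (c := C)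
      (continuous_ofReal.comp hb).aestronglyMeasurable
      (Eventually.of_forall fun x => by rw [norm_real, Real.norm_eq_abs]; exact hbC x)
  have hj : ∀ j, ∫ x, (a j x : ℂ) * (conj (du j x) * v x + conj (u x) * dv j x)
      = -∫ x, (a' j x : ℂ) * (conj (u x) * v x) := fun j => by
    have h := inner_ibp (hac j) (ha'c j) (hab j) (ha'b j) (hd j) hu hv
    rw [inner_mulOp_eq_integral (hm _ (hac j) (hab j)), inner_mulOp_eq_integral (hm _ (hac j) (hab j)),
      inner_mulOp_eq_integral (hm _ (ha'c j) (ha'b j)),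
      ← integral_add (hP _ (hac j) (hab j) _ _) (hP _ (hac j) (hab j) _ _)] at h
    rw [← h]
    simp only [mul_add]
  change ∑ j, ∫ x, (a j x : ℂ) * (conj (du j x) * v x + conj (u x) * dv j x) = 0
  simp only [hj]
  rw [Fin.sum_univ_two, ← neg_add, ← integral_add (hP _ (ha'c 0) (ha'b 0) _ _)
    (hP _ (ha'c 1) (ha'b 1) _ _), integral_eq_zero_of_ae, neg_zero]
  refine Eventually.of_forall fun x => ?_
  simp only [ha', perp_zero, perp_one, Pi.zero_apply]
  push_cast
  ring

/-- A smooth approximation of `max (s, R²)`. -/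
def smax (R ε s : ℝ) : ℝ := (s + R ^ 2 + Real.sqrt ((s - R ^ 2) ^ 2 + ε ^ 2)) / 2

theorem max_le_smax (R ε s : ℝ) : max s (R ^ 2) ≤ smax R ε s := by
  have h : |s - R ^ 2| ≤ Real.sqrt ((s - R ^ 2) ^ 2 + ε ^ 2) :=
    Real.abs_le_sqrt (by nlinarith [sq_nonneg ε])
  rw [smax]
  have h1 := le_abs_self (s - R ^ 2)
  have h2 := neg_le_abs (s - R ^ 2)
  exact max_le (by linarith) (by linarith)

theorem half_le_smax {R ε s : ℝ} (hs : 0 ≤ s) : ε / 2 ≤ smax R ε s := by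
  have h : ε ≤ Real.sqrt ((s - R ^ 2) ^ 2 + ε ^ 2) :=
    Real.le_sqrt_of_sq_le (by nlinarith [sq_nonneg (s - R ^ 2)])
  rw [smax]
  nlinarith [sq_nonneg R]

theorem smax_pos {R ε : ℝ} (hε : 0 < ε) (s : ℝ) : 0 < smax R ε s := by
  have h : |s - R ^ 2| < Real.sqrt ((s - R ^ 2) ^ 2 + ε ^ 2) :=
    Real.lt_sqrt_of_sq_lt (by rw [sq_abs]; nlinarith)
  have h2 := neg_le_abs (s - R ^ 2)
  rw [smax]
  nlinarith [sq_nonneg R]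

theorem hasDerivAt_smax {R ε : ℝ} (hε : 0 < ε) (s : ℝ) : HasDerivAt (smax R ε)
    ((1 + (s - R ^ 2) / Real.sqrt ((s - R ^ 2) ^ 2 + ε ^ 2)) / 2) s := by
  have h1 : HasDerivAt (fun s : ℝ => (s - R ^ 2) ^ 2 + ε ^ 2) (2 * (s - R ^ 2)) s := by
    simpa using (((hasDerivAt_id s).sub_const (R ^ 2)).pow 2).add_const (ε ^ 2)
  have h2 := h1.sqrt (by positivity)
  have h3 := (((hasDerivAt_id s).add_const (R ^ 2)).add h2).div_const 2
  refine h3.congr_deriv ?_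
  have : Real.sqrt ((s - R ^ 2) ^ 2 + ε ^ 2) ≠ 0 := (Real.sqrt_pos.2 (by positivity)).ne'
  field_simp

theorem sum_integral_smax {u v : L2} {du dv : Fin 2 → L2} (hu : IsH1 u du) (hv : IsH1 v dv)
    (R : ℝ) {ε : ℝ} (hε : 0 < ε) (y : Plane) :
    ∑ j, ∫ x, ((perp (x - y) j * (smax R ε (‖x - y‖ ^ 2))⁻¹ : ℝ) : ℂ) *
      (conj (du j x) * v x + conj (u x) * dv j x) = 0 := by
  set G : ℝ → ℝ := fun s => (1 + (s - R ^ 2) / Real.sqrt ((s - R ^ 2) ^ 2 + ε ^ 2)) / 2 with hG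
  have hq : ∀ s, Real.sqrt ((s - R ^ 2) ^ 2 + ε ^ 2) ≠ 0 := fun s =>
    (Real.sqrt_pos.2 (by positivity)).ne'
  have hGb : ∀ s, |G s| ≤ 1 := fun s => by
    have h : |s - R ^ 2| ≤ Real.sqrt ((s - R ^ 2) ^ 2 + ε ^ 2) :=
      Real.abs_le_sqrt (by nlinarith [sq_nonneg ε])
    have h1 : |(s - R ^ 2) / Real.sqrt ((s - R ^ 2) ^ 2 + ε ^ 2)| ≤ 1 := by
      rw [abs_div, abs_of_nonneg (Real.sqrt_nonneg _)]
      exact div_le_one_of_le₀ h (Real.sqrt_nonneg _)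
    rw [abs_le] at h1 ⊢
    simp only [hG]
    constructor <;> linarith [h1.1, h1.2]
  have hGc : Continuous G := by
    simp only [hG]
    have : Continuous fun s : ℝ => (s - R ^ 2) / Real.sqrt ((s - R ^ 2) ^ 2 + ε ^ 2) :=
      Continuous.div (by fun_prop) (by fun_prop) hq
    fun_prop
  have hmc : Continuous (smax R ε) := by unfold smax; fun_prop
  have hp : ∀ s, 0 < smax R ε s := smax_pos hε
  refine sum_integral_smooth (F := fun s => (smax R ε s)⁻¹) (F' := fun s => -G s / smax R ε s ^ 2)
    -- Since `smax` is at least `r²` and at least `ε/2`, one has `r ≤ 1 + r² ≤ (1 + 2/ε) smax` and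
    -- `2 r² / smax² ≤ 2 / smax ≤ 4/ε`.
    (C := max (1 + 2 / ε) (4 / ε))
    (fun s => (hasDerivAt_smax hε s).inv (hp s).ne')
    (Continuous.div (by fun_prop) (by fun_prop) fun s => (pow_pos (hp s) 2).ne')
    (fun r hr => le_trans ?_ (le_max_left _ _)) (fun r hr => le_trans ?_ (le_max_right _ _)) hu hv y
  · have h1 : r ^ 2 ≤ smax R ε (r ^ 2) := (le_max_left _ _).trans (max_le_smax R ε _)
    have h2 : ε / 2 ≤ smax R ε (r ^ 2) := half_le_smax (sq_nonneg r)
    rw [abs_of_pos (inv_pos.2 (hp _)), ← div_eq_mul_inv, div_le_iff₀ (hp _)]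
    have h3 : 2 / ε * (ε / 2) = 1 := by field_simp
    have h4 : 2 / ε * (ε / 2) ≤ 2 / ε * smax R ε (r ^ 2) := by gcongr
    nlinarith [sq_nonneg (r - 1)]
  · have h1 : r ^ 2 ≤ smax R ε (r ^ 2) := (le_max_left _ _).trans (max_le_smax R ε _)
    have h2 : ε / 2 ≤ smax R ε (r ^ 2) := half_le_smax (sq_nonneg r)
    have hp2 := hp (r ^ 2)
    rw [abs_div, abs_neg, abs_of_pos (pow_pos hp2 2)]
    calc 2 * r ^ 2 * (|G (r ^ 2)| / smax R ε (r ^ 2) ^ 2)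
        ≤ 2 * smax R ε (r ^ 2) * (1 / smax R ε (r ^ 2) ^ 2) := by
          gcongr
          exact hGb _
      _ = 2 / smax R ε (r ^ 2) := by field_simp
      _ ≤ 2 / (ε / 2) := by gcongr
      _ = 4 / ε := by field_simp; norm_num

/-- The kernels `x^⊥ / max(|x|², R²)` are divergence free. -/
theorem sum_integral_kern {u v : L2} {du dv : Fin 2 → L2} (hu : IsH1 u du) (hv : IsH1 v dv)
    {B : ℝ} (h : ∀ j, HasPot (fun x => conj (du j x) * v x + conj (u x) * dv j x) B)
    (R : ℝ) (y : Plane) :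
    ∑ j, ∫ x, (kern R j (x - y) : ℂ) * (conj (du j x) * v x + conj (u x) * dv j x) = 0 := by
  set ε : ℕ → ℝ := fun n => 1 / ((n : ℝ) + 1) with hε
  have hε0 : ∀ n, 0 < ε n := fun n => by positivity
  have hεt : Tendsto ε atTop (𝓝 0) := tendsto_one_div_add_atTop_nhds_zero_nat
  set θ : Fin 2 → Plane → ℂ := fun j x => conj (du j x) * v x + conj (u x) * dv j x with hθ
  have hlim : ∀ j, Tendsto (fun n => ∫ x,
      ((perp (x - y) j * (smax R (ε n) (‖x - y‖ ^ 2))⁻¹ : ℝ) : ℂ) * θ j x) atTop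
      (𝓝 (∫ x, (kern R j (x - y) : ℂ) * θ j x)) := fun j => by
    refine tendsto_integral_of_dominated_convergence (fun x => ‖x - y‖⁻¹ * ‖θ j x‖) (fun n => ?_) ?_
      (fun n => ?_) ?_
    · refine AEStronglyMeasurable.mul ?_ (h j).meas
      have h1 := measurable_perp j
      have h2 : Continuous (smax R (ε n)) := by unfold smax; fun_prop
      have h3 := h2.measurable
      exact Measurable.aestronglyMeasurable (by fun_prop)
    · refine ⟨AEStronglyMeasurable.mul (Measurable.aestronglyMeasurable (by fun_prop))
        (h j).meas.norm, lt_of_le_of_lt (lintegral_mono fun x => ?_)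
        (((h j).bound y).trans_lt ENNReal.ofReal_lt_top)⟩
      rw [enorm_mul, enorm_norm, mul_comm, sing, ← ofReal_norm (‖x - y‖⁻¹),
        Real.norm_of_nonneg (by positivity)]
    · refine Eventually.of_forall fun x => ?_
      rw [norm_mul, norm_real, Real.norm_eq_abs]
      gcongr
      have hs : ‖x - y‖ ^ 2 ≤ smax R (ε n) (‖x - y‖ ^ 2) := (le_max_left _ _).trans (max_le_smax R _ _)
      rw [abs_mul, abs_of_pos (inv_pos.2 (smax_pos (hε0 n) _))]
      rcases eq_or_ne (x - y) 0 with h0 | h0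
      · rw [h0]
        have : perp (0 : Plane) j = 0 := by fin_cases j <;> simp [perp]
        simp [this]
      · have hx0 : 0 < ‖x - y‖ := norm_pos_iff.2 h0
        calc |perp (x - y) j| * (smax R (ε n) (‖x - y‖ ^ 2))⁻¹ ≤ ‖x - y‖ * (‖x - y‖ ^ 2)⁻¹ := by
              gcongr
              · exact (inv_pos.2 (smax_pos (hε0 n) _)).le
              · exact abs_perp_le j _
          _ = _ := by field_simp
    · refine Eventually.of_forall fun x => Tendsto.mul_const _ ?_
      refine (continuous_ofReal.tendsto _).comp ?_
      rcases eq_or_ne (x - y) 0 with h0 | h0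
      · have : perp (0 : Plane) j = 0 := by fin_cases j <;> simp [perp]
        simp [h0, kern, this]
      · have hx0 : 0 < ‖x - y‖ := norm_pos_iff.2 h0
        have e : smax R 0 (‖x - y‖ ^ 2) = max (‖x - y‖ ^ 2) (R ^ 2) := by
          rw [smax]
          have : Real.sqrt ((‖x - y‖ ^ 2 - R ^ 2) ^ 2 + 0 ^ 2) = |‖x - y‖ ^ 2 - R ^ 2| := by
            rw [← Real.sqrt_sq_eq_abs]; congr 1; ring
          rw [this]
          rcases le_total (‖x - y‖ ^ 2) (R ^ 2) with h1 | h1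
          · rw [max_eq_right h1, abs_of_nonpos (by linarith)]; ring
          · rw [max_eq_left h1, abs_of_nonneg (by linarith)]; ring
        have hc : Continuous fun e : ℝ => smax R e (‖x - y‖ ^ 2) := by unfold smax; fun_prop
        have h1 : Tendsto (fun n => smax R (ε n) (‖x - y‖ ^ 2)) atTop
            (𝓝 (max (‖x - y‖ ^ 2) (R ^ 2))) := by
          rw [← e]
          exact (hc.tendsto 0).comp hεt
        rw [kern]
        exact (h1.inv₀ (by positivity)).const_mul _
  refine tendsto_nhds_unique (tendsto_finsetSum _ fun j _ => hlim j)
    (tendsto_const_nhds.congr fun n => ?_)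
  exact (sum_integral_smax hu hv R (hε0 n) y).symm

theorem sum_cv_kern {u v : L2} {du dv : Fin 2 → L2} (hu : IsH1 u du) (hv : IsH1 v dv)
    {B : ℝ} (h : ∀ j, HasPot (fun x => conj (du j x) * v x + conj (u x) * dv j x) B)
    (R : ℝ) (y : Plane) :
    ∑ j, cv (kern R j) (fun x => conj (du j x) * v x + conj (u x) * dv j x) y = 0 := by
  have h1 := sum_integral_kern hu hv h R y
  rw [← neg_eq_zero, ← Finset.sum_neg_distrib] at h1
  rw [← h1]
  refine Finset.sum_congr rfl fun j _ => ?_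
  rw [cv, ← integral_neg]
  refine integral_congr_ae (Eventually.of_forall fun x => ?_)
  simp only
  rw [← neg_sub, kern_neg]
  push_cast
  ring

end

end CSS

open MeasureTheory Complex Filter Topology Set FourierTransform
open scoped LineDeriv SchwartzMap ComplexConjugate ENNReal

namespace CSS

noncomputable section

/-! ### The potentials -/

/-- `‖F‖₂ ≤ B`. -/
structure L2Le (F : Plane → ℂ) (B : ℝ) : Prop where
  nonneg : 0 ≤ B
  meas : AEStronglyMeasurable F (volume : Measure Plane)
  bound : eLpNorm F 2 volume ≤ ENNReal.ofReal B

theorem L2Le.coe (w : L2) : L2Le w ‖w‖ := by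
  refine ⟨norm_nonneg _, (Lp.memLp w).1, ?_⟩
  rw [Lp.norm_def, ENNReal.ofReal_toReal (Lp.eLpNorm_ne_top w)]

theorem L2Le.norm_le {F : Plane → ℂ} {B : ℝ} (h : L2Le F B) {w : L2} (hw : w =ᵐ[volume] F) :
    ‖w‖ ≤ B := by
  rw [Lp.norm_def, eLpNorm_congr_ae hw]
  exact ENNReal.toReal_le_of_le_ofReal h.nonneg h.bound

theorem L2Le.add {F G : Plane → ℂ} {B C : ℝ} (hF : L2Le F B) (hG : L2Le G C) :
    L2Le (fun x => F x + G x) (B + C) := by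
  refine ⟨add_nonneg hF.nonneg hG.nonneg, hF.meas.add hG.meas, ?_⟩
  rw [ENNReal.ofReal_add hF.nonneg hG.nonneg]
  exact (eLpNorm_add_le hF.meas hG.meas (by norm_num)).trans (add_le_add hF.bound hG.bound)

theorem L2Le.of_le {F G : Plane → ℂ} {B c : ℝ} (hF : L2Le F B) (hc : 0 ≤ c)
    (hG : AEStronglyMeasurable G (volume : Measure Plane)) (h : ∀ᵐ x, ‖G x‖ ≤ c * ‖F x‖) :
    L2Le G (c * B) := by
  refine ⟨mul_nonneg hc hF.nonneg, hG, ?_⟩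
  refine (eLpNorm_le_mul_eLpNorm_of_ae_le_mul h 2).trans ?_
  rw [ENNReal.ofReal_mul hc]
  gcongr
  exact hF.bound

theorem L2Le.sum {F : Fin 2 → Plane → ℂ} {B : ℝ} (h : ∀ j, L2Le (F j) B) :
    L2Le (fun x => ∑ j, F j x) (2 * B) := by
  simp only [Fin.sum_univ_two, two_mul]
  exact (h 0).add (h 1)

theorem L2Le.mono {F : Plane → ℂ} {B C : ℝ} (h : L2Le F B) (hBC : B ≤ C) : L2Le F C :=
  ⟨h.nonneg.trans hBC, h.meas, h.bound.trans (ENNReal.ofReal_le_ofReal hBC)⟩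

theorem L2Le.cv {k : Plane → ℝ} (hk : SubCoulomb k) {ρ f g h : Plane → ℂ} {N a b : ℝ} (hf : L2Le f N)
    (hg : HasHardy g a) (hh : HasHardy h b) (hρm : AEStronglyMeasurable ρ (volume : Measure Plane))
    (hρ : ∀ᵐ x, ‖ρ x‖ ≤ ‖f x‖ * ‖g x‖) :
    L2Le (fun y => cv k ρ y * h y) (N * a * b) := by
  refine ⟨mul_nonneg (mul_nonneg hf.nonneg hg.nonneg) hh.nonneg,
    (hk.aestronglyMeasurable_cv hρm).mul hh.meas, (hk.eLpNorm_cv_mul_le hf.meas hg hh hρ).trans ?_⟩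
  rw [mul_assoc, mul_comm N, ENNReal.ofReal_mul (mul_nonneg hg.nonneg hh.nonneg)]
  gcongr
  exact hf.bound

theorem HasHardy.add_norm {f g : Plane → ℂ} {a b : ℝ} (hf : HasHardy f a) (hg : HasHardy g b) :
    HasHardy (fun x => ((‖f x‖ + ‖g x‖ : ℝ) : ℂ)) (2 * (a + b)) := by
  have ha := hf.nonneg
  have hb := hg.nonneg
  refine ⟨by positivity,
    continuous_ofReal.comp_aestronglyMeasurable (hf.meas.norm.add hg.meas.norm), fun y => ?_⟩
  have hsq : ∀ x, ‖((‖f x‖ + ‖g x‖ : ℝ) : ℂ)‖ₑ ^ 2 * sing x y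
      ≤ 2 * (‖f x‖ₑ ^ 2 * sing x y) + 2 * (‖g x‖ₑ ^ 2 * sing x y) := fun x => by
    have e : ‖((‖f x‖ + ‖g x‖ : ℝ) : ℂ)‖ₑ ^ 2 ≤ 2 * ‖f x‖ₑ ^ 2 + 2 * ‖g x‖ₑ ^ 2 := by
      simp only [← ofReal_norm]
      rw [norm_real, Real.norm_of_nonneg (by positivity), ← ENNReal.ofReal_pow (by positivity),
        ← ENNReal.ofReal_pow (by positivity), ← ENNReal.ofReal_pow (by positivity),
        ← ENNReal.ofReal_ofNat 2, ← ENNReal.ofReal_mul (by positivity),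
        ← ENNReal.ofReal_mul (by positivity), ← ENNReal.ofReal_add (by positivity) (by positivity)]
      exact ENNReal.ofReal_le_ofReal (by nlinarith [sq_nonneg (‖f x‖ - ‖g x‖)])
    calc _ ≤ (2 * ‖f x‖ₑ ^ 2 + 2 * ‖g x‖ₑ ^ 2) * sing x y := by gcongr
      _ = _ := by ring
  calc ∫⁻ x, ‖((‖f x‖ + ‖g x‖ : ℝ) : ℂ)‖ₑ ^ 2 * sing x y
      ≤ ∫⁻ x, (2 * (‖f x‖ₑ ^ 2 * sing x y) + 2 * (‖g x‖ₑ ^ 2 * sing x y)) := lintegral_mono hsq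
    _ = 2 * (∫⁻ x, ‖f x‖ₑ ^ 2 * sing x y) + 2 * ∫⁻ x, ‖g x‖ₑ ^ 2 * sing x y := by
        have hm : AEMeasurable (fun x => 2 * (‖f x‖ₑ ^ 2 * sing x y)) (volume : Measure Plane) :=
          ((hf.meas.enorm.pow_const 2).mul (measurable_sing_left y).aemeasurable).const_mul 2
        rw [lintegral_add_left' hm, lintegral_const_mul' _ _ (by simp),
          lintegral_const_mul' _ _ (by simp)]
    _ ≤ 2 * ENNReal.ofReal (a ^ 2) + 2 * ENNReal.ofReal (b ^ 2) := by
        gcongr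
        · exact hf.bound y
        · exact hg.bound y
    _ ≤ _ := by
        rw [← ENNReal.ofReal_ofNat 2, ← ENNReal.ofReal_mul (by positivity),
          ← ENNReal.ofReal_mul (by positivity), ← ENNReal.ofReal_add (by positivity) (by positivity)]
        exact ENNReal.ofReal_le_ofReal (by nlinarith [mul_nonneg ha hb, sq_nonneg a, sq_nonneg b])

theorem HasHardy.two_mul_norm {f : Plane → ℂ} {a : ℝ} (hf : HasHardy f a) :
    HasHardy (fun x => ((2 * ‖f x‖ : ℝ) : ℂ)) (2 * a) :=
  hf.of_le zero_le_two (continuous_ofReal.comp_aestronglyMeasurable (hf.meas.norm.const_mul 2))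
    (Eventually.of_forall fun x => by
      rw [norm_real, Real.norm_of_nonneg (by positivity)])

theorem norm_conj_mul_le (a b : ℂ) : ‖conj a * b‖ ≤ ‖a‖ * ‖b‖ := by
  rw [norm_mul, RCLike.norm_conj]

/-- A single constant serves for `S` and `D`: both `8π` and `32π³` are below `1600 = 40²`. -/
theorem hardy_S_le (g : L2) : HasHardy (S g) (40 * ‖g‖) := by
  refine (hardy_S g).mono ?_
  refine Real.sqrt_le_iff.2 ⟨by positivity, ?_⟩
  rw [Fin.sum_univ_two]
  have h0 := norm_D_le 0 g
  have h1 := norm_D_le 1 g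
  have h2 := norm_S_le g
  have hπ := Real.pi_lt_d2
  calc 2 * ‖S g‖ * (‖D 0 g‖ + ‖D 1 g‖)
      ≤ 2 * ‖g‖ * (2 * Real.pi * ‖g‖ + 2 * Real.pi * ‖g‖) := by gcongr
    _ = 8 * Real.pi * ‖g‖ ^ 2 := by ring
    _ ≤ 1600 * ‖g‖ ^ 2 := by gcongr; linarith
    _ = _ := by ring

theorem hardy_D_le (k : Fin 2) (g : L2) : HasHardy (D k g) (40 * ‖g‖) := by
  refine (hardy_D k g).mono ?_
  refine Real.sqrt_le_iff.2 ⟨by positivity, ?_⟩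
  rw [Fin.sum_univ_two]
  have h0 := norm_DD_le 0 k g
  have h1 := norm_DD_le 1 k g
  have h2 := norm_D_le k g
  have hπ := Real.pi_lt_d2
  have hπ0 := Real.pi_pos
  calc 2 * ‖D k g‖ * (‖DD 0 k g‖ + ‖DD 1 k g‖)
      ≤ 2 * (2 * Real.pi * ‖g‖) * (4 * Real.pi ^ 2 * ‖g‖ + 4 * Real.pi ^ 2 * ‖g‖) := by gcongr
    _ = 32 * Real.pi ^ 3 * ‖g‖ ^ 2 := by ring
    _ ≤ 32 * 3.15 ^ 3 * ‖g‖ ^ 2 := by gcongr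
    _ ≤ 1600 * ‖g‖ ^ 2 := by gcongr; norm_num
    _ = _ := by ring

/-- The components of the vector potential of `S f`. -/
def Apot (R : ℝ) (f : L2) (j : Fin 2) (y : Plane) : ℝ := ∫ x, ‖S f x‖ ^ 2 * kern R j (y - x)

/-- The components of the current of `S f`. -/
def curr (f : L2) (j : Fin 2) (x : Plane) : ℂ :=
  I * (S f x * conj (D j f x) - conj (S f x) * D j f x)

/-- The source of the scalar potential of `S f`. -/
def src (β R : ℝ) (f : L2) (j : Fin 2) (x : Plane) : ℂ :=
  2 * β * (Apot R f j x : ℂ) * (‖S f x‖ : ℂ) ^ 2 + curr f j x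

/-- The scalar potential of `S f`. -/
def Vpot (β R : ℝ) (f : L2) (y : Plane) : ℂ := ∑ j, cv (kern R j) (src β R f j) y

/-- The zeroth order coefficient of the Hamiltonian. -/
def Wpot (β R : ℝ) (f : L2) (y : Plane) : ℂ :=
  (β : ℂ) ^ 2 * ∑ j, (Apot R f j y : ℂ) ^ 2 - β * Vpot β R f y

theorem ofReal_Apot (R : ℝ) (f : L2) (j : Fin 2) (y : Plane) :
    (Apot R f j y : ℂ) = cv (kern R j) (fun x => (‖S f x‖ : ℂ) ^ 2) y := by
  rw [Apot, cv, ← integral_complex_ofReal]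
  refine integral_congr_ae (Eventually.of_forall fun x => ?_)
  simp only
  push_cast
  ring

theorem meas_coe (w : L2) : AEStronglyMeasurable w (volume : Measure Plane) := (Lp.memLp w).1

theorem meas_conj {F : Plane → ℂ} (h : AEStronglyMeasurable F (volume : Measure Plane)) :
    AEStronglyMeasurable (fun x => conj (F x)) (volume : Measure Plane) :=
  continuous_conj.comp_aestronglyMeasurable h

theorem meas_dens (f : L2) :
    AEStronglyMeasurable (fun x => (‖S f x‖ : ℂ) ^ 2) (volume : Measure Plane) :=
  (continuous_ofReal.comp_aestronglyMeasurable (meas_coe (S f)).norm).pow 2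

theorem meas_Apot (R : ℝ) (f : L2) (j : Fin 2) :
    AEStronglyMeasurable (fun x => (Apot R f j x : ℂ)) (volume : Measure Plane) := by
  simp only [ofReal_Apot]
  exact (subCoulomb_kern R j).aestronglyMeasurable_cv (meas_dens f)

theorem meas_curr (f : L2) (j : Fin 2) :
    AEStronglyMeasurable (curr f j) (volume : Measure Plane) :=
  aestronglyMeasurable_const.mul (((meas_coe _).mul (meas_conj (meas_coe _))).sub
    ((meas_conj (meas_coe _)).mul (meas_coe _)))

theorem meas_src (β R : ℝ) (f : L2) (j : Fin 2) :
    AEStronglyMeasurable (src β R f j) (volume : Measure Plane) :=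
  ((aestronglyMeasurable_const.mul (meas_Apot R f j)).mul (meas_dens f)).add (meas_curr f j)

theorem meas_Vpot (β R : ℝ) (f : L2) :
    AEStronglyMeasurable (Vpot β R f) (volume : Measure Plane) := by
  unfold Vpot
  simp only [Fin.sum_univ_two]
  exact ((subCoulomb_kern R 0).aestronglyMeasurable_cv (meas_src β R f 0)).add
    ((subCoulomb_kern R 1).aestronglyMeasurable_cv (meas_src β R f 1))

theorem meas_Wpot (β R : ℝ) (f : L2) :
    AEStronglyMeasurable (Wpot β R f) (volume : Measure Plane) := by
  unfold Wpot
  simp only [Fin.sum_univ_two]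
  exact (aestronglyMeasurable_const.mul (((meas_Apot R f 0).pow 2).add ((meas_Apot R f 1).pow 2))).sub
    (aestronglyMeasurable_const.mul (meas_Vpot β R f))

theorem hasPot_dens {f : L2} {a : ℝ} (ha : HasHardy (S f) a) :
    HasPot (fun x => (‖S f x‖ : ℂ) ^ 2) (a * a) :=
  ha.hasPot ha (meas_dens f) (Eventually.of_forall fun x => by
    rw [norm_pow, norm_real, norm_norm, sq])

theorem abs_Apot_le (R : ℝ) {f : L2} {a : ℝ} (ha : HasHardy (S f) a) (j : Fin 2) (y : Plane) :
    |Apot R f j y| ≤ a * a := by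
  rw [← Real.norm_eq_abs, ← norm_real, ofReal_Apot]
  exact (subCoulomb_kern R j).norm_cv_le (hasPot_dens ha) y

theorem norm_curr_le (f : L2) (j : Fin 2) (x : Plane) :
    ‖curr f j x‖ ≤ 2 * ‖S f x‖ * ‖D j f x‖ := by
  rw [curr, norm_mul, norm_I, one_mul]
  refine (norm_sub_le _ _).trans ?_
  rw [norm_mul, norm_mul, RCLike.norm_conj, RCLike.norm_conj]
  linarith

theorem hasPot_curr {f : L2} {a b : ℝ} {j : Fin 2} (ha : HasHardy (S f) a) (hb : HasHardy (D j f) b) :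
    HasPot (curr f j) (2 * a * b) :=
  ha.two_mul_norm.hasPot hb (meas_curr f j) (Eventually.of_forall fun x => by
    rw [norm_real, Real.norm_of_nonneg (by positivity)]
    exact norm_curr_le f j x)

theorem hasPot_Apot_dens (β R : ℝ) {f : L2} {a : ℝ} (ha : HasHardy (S f) a) (j : Fin 2) :
    HasPot (fun x => 2 * β * (Apot R f j x : ℂ) * (‖S f x‖ : ℂ) ^ 2) (2 * |β| * (a * a) * (a * a)) :=
  (hasPot_dens ha).of_le (by have := ha.nonneg; positivity)
    ((aestronglyMeasurable_const.mul (meas_Apot R f j)).mul (meas_dens f))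
    (Eventually.of_forall fun x => by
      rw [norm_mul, norm_mul, norm_mul, norm_real, norm_real, Real.norm_eq_abs, Real.norm_eq_abs]
      gcongr
      · simp
      · exact abs_Apot_le R ha j x)

theorem hasPot_src (β R : ℝ) {f : L2} {a b : ℝ} (ha : HasHardy (S f) a) (j : Fin 2)
    (hb : HasHardy (D j f) b) :
    HasPot (src β R f j) (2 * |β| * (a * a) * (a * a) + 2 * a * b) :=
  (hasPot_Apot_dens β R ha j).add (hasPot_curr ha hb)

theorem norm_Vpot_le (β R : ℝ) {f : L2} {a b : ℝ} (ha : HasHardy (S f) a)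
    (hb : ∀ j, HasHardy (D j f) b) (y : Plane) :
    ‖Vpot β R f y‖ ≤ 2 * (2 * |β| * (a * a) * (a * a) + 2 * a * b) := by
  rw [Vpot, Fin.sum_univ_two, two_mul]
  exact (norm_add_le _ _).trans (add_le_add
    ((subCoulomb_kern R 0).norm_cv_le (hasPot_src β R ha 0 (hb 0)) y)
    ((subCoulomb_kern R 1).norm_cv_le (hasPot_src β R ha 1 (hb 1)) y))

theorem norm_Asq_le (β R : ℝ) {f : L2} {a : ℝ} (ha : HasHardy (S f) a) (y : Plane) :
    ‖(β : ℂ) ^ 2 * ∑ j, (Apot R f j y : ℂ) ^ 2‖ ≤ 2 * β ^ 2 * (a * a) ^ 2 := by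
  rw [norm_mul, norm_pow, norm_real, Real.norm_eq_abs, sq_abs, Fin.sum_univ_two]
  have h : ∀ j, ‖(Apot R f j y : ℂ) ^ 2‖ ≤ (a * a) ^ 2 := fun j => by
    rw [norm_pow, norm_real, Real.norm_eq_abs]
    exact pow_le_pow_left₀ (abs_nonneg _) (abs_Apot_le R ha j y) 2
  calc β ^ 2 * ‖(Apot R f 0 y : ℂ) ^ 2 + (Apot R f 1 y : ℂ) ^ 2‖
      ≤ β ^ 2 * ((a * a) ^ 2 + (a * a) ^ 2) := by
        gcongr
        exact (norm_add_le _ _).trans (add_le_add (h 0) (h 1))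
    _ = _ := by ring

theorem norm_Wpot_le (β R : ℝ) {f : L2} {a b : ℝ} (ha : HasHardy (S f) a)
    (hb : ∀ j, HasHardy (D j f) b) (y : Plane) :
    ‖Wpot β R f y‖ ≤ 2 * β ^ 2 * (a * a) ^ 2
      + |β| * (2 * (2 * |β| * (a * a) * (a * a) + 2 * a * b)) := by
  refine (norm_sub_le _ _).trans (add_le_add (norm_Asq_le β R ha y) ?_)
  rw [norm_mul, norm_real, Real.norm_eq_abs]
  gcongr
  exact norm_Vpot_le β R ha hb y

theorem memLp_Apot (c : ℂ) (R : ℝ) (f : L2) (j : Fin 2) :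
    MemLp (fun x => c * (Apot R f j x : ℂ)) ∞ (volume : Measure Plane) :=
  memLp_top_of_bound (aestronglyMeasurable_const.mul (meas_Apot R f j))
    (‖c‖ * (40 * ‖f‖ * (40 * ‖f‖)))
    (Eventually.of_forall fun x => by
      rw [norm_mul, norm_real]
      gcongr
      exact abs_Apot_le R (hardy_S_le f) j x)

theorem memLp_Wpot (β R : ℝ) (f : L2) : MemLp (Wpot β R f) ∞ (volume : Measure Plane) :=
  memLp_top_of_bound (meas_Wpot β R f) _
    (Eventually.of_forall fun x => norm_Wpot_le β R (hardy_S_le f) (fun j => hardy_D_le j f) x)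

/-- The magnetic part of the Hamiltonian. -/
def pert (β R : ℝ) (f : L2) : L2 →L[ℂ] L2 :=
  ∑ j, (mulOp fun x => -2 * I * β * (Apot R f j x : ℂ)) ∘L D j + mulOp (Wpot β R f) ∘L S

/-- The Hamiltonian `S g ↦ (-i∇ + βA)² S g + β V S g` with the potentials of `S f`. -/
def ham (β R : ℝ) (f : L2) : L2 →L[ℂ] L2 :=
  ((4 * Real.pi ^ 2 : ℝ) : ℂ) • (ContinuousLinearMap.id ℂ L2 - S) + pert β R f

theorem ham_apply (β R : ℝ) (f g : L2) :
    ham β R f g = ((4 * Real.pi ^ 2 : ℝ) : ℂ) • (g - S g) + pert β R f g := rfl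

theorem pert_ae (β R : ℝ) (f g : L2) : pert β R f g =ᵐ[volume] fun x =>
    ∑ j, -2 * I * β * (Apot R f j x : ℂ) * D j g x + Wpot β R f x * S g x := by
  have h : pert β R f g = mulOp (fun x => -2 * I * β * (Apot R f 0 x : ℂ)) (D 0 g)
      + mulOp (fun x => -2 * I * β * (Apot R f 1 x : ℂ)) (D 1 g) + mulOp (Wpot β R f) (S g) := by
    simp [pert]
  rw [h]
  filter_upwards [Lp.coeFn_add (mulOp (fun x => -2 * I * β * (Apot R f 0 x : ℂ)) (D 0 g)
      + mulOp (fun x => -2 * I * β * (Apot R f 1 x : ℂ)) (D 1 g)) (mulOp (Wpot β R f) (S g)),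
    Lp.coeFn_add (mulOp (fun x => -2 * I * β * (Apot R f 0 x : ℂ)) (D 0 g))
      (mulOp (fun x => -2 * I * β * (Apot R f 1 x : ℂ)) (D 1 g)),
    mulOp_ae (memLp_Apot (-2 * I * β) R f 0) (D 0 g), mulOp_ae (memLp_Apot (-2 * I * β) R f 1) (D 1 g),
    mulOp_ae (memLp_Wpot β R f) (S g)] with x h1 h2 h3 h4 h5
  rw [h1, Pi.add_apply, h2, Pi.add_apply, h3, h4, h5, Fin.sum_univ_two]

end

end CSS

open MeasureTheory Complex Filter Topology Set FourierTransform
open scoped LineDeriv SchwartzMap ComplexConjugate ENNReal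

namespace CSS

noncomputable section

/-! ### Symmetry and boundedness of the Hamiltonian -/

theorem conj_two : conj (2 : ℂ) = 2 := map_ofNat _ 2

theorem conj_cv (k : Plane → ℝ) (ρ : Plane → ℂ) (y : Plane) :
    conj (cv k ρ y) = cv k (fun x => conj (ρ x)) y := by
  rw [cv, cv, ← integral_conj]
  simp

theorem conj_curr (f : L2) (j : Fin 2) (x : Plane) : conj (curr f j x) = curr f j x := by
  simp only [curr, map_mul, map_sub, conj_I, conj_conj]
  ring

theorem conj_src (β R : ℝ) (f : L2) (j : Fin 2) (x : Plane) :
    conj (src β R f j x) = src β R f j x := by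
  simp only [src, map_add, conj_curr, map_mul, map_pow, conj_ofReal, conj_two]

theorem conj_Wpot (β R : ℝ) (f : L2) (y : Plane) : conj (Wpot β R f y) = Wpot β R f y := by
  simp only [Wpot, Vpot, map_sub, map_mul, map_sum, map_pow, conj_ofReal, conj_cv, conj_src]

theorem hasPot_pair {u v : L2} {du dv : Fin 2 → L2} {a b : ℝ} (hu : HasHardy u a) (hv : HasHardy v b)
    {a' b' : ℝ} (hdu : ∀ j, HasHardy (du j) a') (hdv : ∀ j, HasHardy (dv j) b') (j : Fin 2) :
    HasPot (fun x => conj (du j x) * v x + conj (u x) * dv j x) (a' * b + a * b') :=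
  ((hdu j).hasPot hv ((meas_conj (meas_coe _)).mul (meas_coe _))
    (Eventually.of_forall fun _ => norm_conj_mul_le _ _)).add
  (hu.hasPot (hdv j) ((meas_conj (meas_coe _)).mul (meas_coe _))
    (Eventually.of_forall fun _ => norm_conj_mul_le _ _))

theorem integrable_dens (f : L2) : Integrable fun x => (‖S f x‖ : ℂ) ^ 2 := by
  have h := ((Lp.memLp (S f)).integrable_norm_pow (by norm_num)).ofReal (𝕜 := ℂ)
  refine h.congr (Eventually.of_forall fun x => ?_)
  simp

/-- The vector potential is divergence free. -/
theorem sum_integral_Apot (R : ℝ) (f : L2) {u v : L2} {du dv : Fin 2 → L2} (hu : IsH1 u du)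
    (hv : IsH1 v dv) {B : ℝ}
    (h : ∀ j, HasPot (fun x => conj (du j x) * v x + conj (u x) * dv j x) B) :
    ∑ j, ∫ y, (Apot R f j y : ℂ) * (conj (du j y) * v y + conj (u y) * dv j y) = 0 := by
  -- Fubini moves the kernel onto the gradient of `ū v`, where it vanishes for each position of the
  -- singularity.
  have hF := fun j => (subCoulomb_kern R j).integral_cv_mul (integrable_dens f) (h j)
  simp only [ofReal_Apot, fun j => (hF j).2]
  rw [Fin.sum_univ_two, ← integral_add (hF 0).1 (hF 1).1]
  refine integral_eq_zero_of_ae (Eventually.of_forall fun x => ?_)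
  simp only [Pi.zero_apply]
  rw [← mul_add]
  have := sum_integral_kern hu hv h R x
  rw [Fin.sum_univ_two] at this
  rw [this, mul_zero]

theorem integrable_coeff {a : Plane → ℂ} (ha : MemLp a ∞ (volume : Measure Plane)) (f g : L2) :
    Integrable fun x => a x * (conj (f x) * g x) := by
  have h := L2.integrable_inner (𝕜 := ℂ) f (mulOp a g)
  refine h.congr ?_
  filter_upwards [mulOp_ae ha g] with x hx
  rw [hx, RCLike.inner_apply]
  ring

theorem memLp_Apot_one (R : ℝ) (f : L2) (j : Fin 2) :
    MemLp (fun x => (Apot R f j x : ℂ)) ∞ (volume : Measure Plane) := by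
  simpa using memLp_Apot 1 R f j

theorem sum_inner_Apot (R : ℝ) (f : L2) {u v : L2} {du dv : Fin 2 → L2} (hu : IsH1 u du)
    (hv : IsH1 v dv) {B : ℝ}
    (h : ∀ j, HasPot (fun x => conj (du j x) * v x + conj (u x) * dv j x) B) :
    ∑ j, (inner ℂ (du j) (mulOp (fun x => Apot R f j x) v)
      + inner ℂ u (mulOp (fun x => Apot R f j x) (dv j))) = 0 := by
  rw [← sum_integral_Apot R f hu hv h]
  refine Finset.sum_congr rfl fun j _ => ?_
  rw [inner_mulOp_eq_integral (memLp_Apot_one R f j), inner_mulOp_eq_integral (memLp_Apot_one R f j),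
    ← integral_add (integrable_coeff (memLp_Apot_one R f j) _ _)
      (integrable_coeff (memLp_Apot_one R f j) _ _)]
  simp only [mul_add]

theorem pert_apply (β R : ℝ) (f g : L2) : pert β R f g
    = (-2 * I * β : ℂ) • ∑ j, mulOp (fun x => Apot R f j x) (D j g) + mulOp (Wpot β R f) (S g) := by
  have h := fun j => mulOp_const_mul (memLp_Apot_one R f j) (-2 * I * β) (D j g)
  simp only [pert, add_apply, sum_apply,
    ContinuousLinearMap.comp_apply, h, Finset.smul_sum]

/-- The Laplacian part is symmetric because `S` is, the zeroth order part because `Wpot` is real,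
and the first order part `-2iβ A·∇` because `A` is divergence free. -/
theorem ham_symm (β R : ℝ) (f x y : L2) : inner ℂ (S x) (ham β R f y) = inner ℂ (ham β R f x) (S y) := by
  have h1 := sum_inner_Apot R f (isH1_S x) (isH1_S y)
    (hasPot_pair (hardy_S_le x) (hardy_S_le y) (fun j => hardy_D_le j x) fun j => hardy_D_le j y)
  have h2 : ∀ j, inner ℂ (mulOp (fun z => (Apot R f j z : ℂ)) (D j x)) (S y)
      = inner ℂ (D j x) (mulOp (fun z => (Apot R f j z : ℂ)) (S y)) := fun j => by
    rw [inner_mulOp (memLp_Apot_one R f j)]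
    simp only [conj_ofReal]
  have h3 : inner ℂ (mulOp (Wpot β R f) (S x)) (S y) = inner ℂ (S x) (mulOp (Wpot β R f) (S y)) := by
    rw [inner_mulOp (memLp_Wpot β R f)]
    simp only [conj_Wpot]
  rw [ham_apply, ham_apply, pert_apply, pert_apply]
  simp only [inner_add_left, inner_add_right, inner_smul_left, inner_smul_right, inner_sub_left,
    inner_sub_right, sum_inner, inner_sum, h3, h2, S_symm x y]
  rw [Finset.sum_add_distrib] at h1
  have hc : conj (-2 * I * β : ℂ) = 2 * I * β := by simp [conj_two]
  rw [hc, conj_ofReal]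
  linear_combination (-2 * I * β) * h1

theorem norm_pert_le (β R : ℝ) {f : L2} {a b : ℝ} (ha : HasHardy (S f) a)
    (hb : ∀ j, HasHardy (D j f) b) (g : L2) :
    ‖pert β R f g‖ ≤ 2 * |β| * (a * a) * ∑ j, ‖D j g‖ + (2 * β ^ 2 * (a * a) ^ 2
      + |β| * (2 * (2 * |β| * (a * a) * (a * a) + 2 * a * b))) * ‖S g‖ := by
  rw [pert_apply]
  refine (norm_add_le _ _).trans (add_le_add ?_ (norm_mulOp_le (memLp_Wpot β R f)
    (fun x => norm_Wpot_le β R ha hb x) _))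
  rw [norm_smul]
  have h1 : ‖(-2 * I * β : ℂ)‖ = 2 * |β| := by simp
  rw [h1, mul_assoc (2 * |β|), Finset.mul_sum]
  gcongr
  refine norm_sum_le_of_le _ fun j _ => norm_mulOp_le (memLp_Apot_one R f j) (fun x => ?_) _
  rw [norm_real]
  exact abs_Apot_le R ha j x

end

end CSS

open MeasureTheory Complex Filter Topology Set FourierTransform
open scoped LineDeriv SchwartzMap ComplexConjugate ENNReal

namespace CSS

noncomputable section

/-! ### Lipschitz estimates for the potentials -/

theorem cv_congr_ae {k : Plane → ℝ} {ρ σ : Plane → ℂ} (h : ρ =ᵐ[volume] σ) (y : Plane) :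
    cv k ρ y = cv k σ y := by
  refine integral_congr_ae ?_
  filter_upwards [h] with x hx
  rw [hx]

theorem cv_const_mul (k : Plane → ℝ) (c : ℂ) (ρ : Plane → ℂ) (y : Plane) :
    cv k (fun x => c * ρ x) y = c * cv k ρ y := by
  rw [cv, cv, ← integral_const_mul]
  refine integral_congr_ae (Eventually.of_forall fun x => ?_)
  simp only
  ring

theorem S_sub_ae (f f' : L2) : ∀ᵐ x, S (f - f') x = S f x - S f' x := by
  rw [map_sub]
  exact Lp.coeFn_sub _ _

theorem D_sub_ae (f f' : L2) (j : Fin 2) : ∀ᵐ x, D j (f - f') x = D j f x - D j f' x := by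
  rw [map_sub]
  exact Lp.coeFn_sub _ _

theorem norm_normSq_sub_le (u v : ℂ) :
    ‖(‖u‖ : ℂ) ^ 2 - (‖v‖ : ℂ) ^ 2‖ ≤ ‖u - v‖ * (‖u‖ + ‖v‖) := by
  have e : (‖u‖ : ℂ) ^ 2 - (‖v‖ : ℂ) ^ 2 = (((‖u‖ - ‖v‖) * (‖u‖ + ‖v‖) : ℝ) : ℂ) := by
    push_cast; ring
  rw [e, norm_real, Real.norm_eq_abs, abs_mul, abs_of_nonneg (a := ‖u‖ + ‖v‖) (by positivity)]
  gcongr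
  exact abs_norm_sub_norm_le u v

/-- From `| |u|² - |v|² | ≤ |u - v| (|u| + |v|)`: the difference takes the `L²` slot and the sum
takes the Hardy slot. -/
theorem l2Le_Apot_sub (R : ℝ) {f f' : L2} {a c : ℝ} (ha : HasHardy (S f) a)
    (ha' : HasHardy (S f') a) {h : Plane → ℂ} (hh : HasHardy h c) (j : Fin 2) :
    L2Le (fun y => ((Apot R f j y : ℂ) - Apot R f' j y) * h y) (‖S (f - f')‖ * (2 * (a + a)) * c) := by
  have e : ∀ y, (Apot R f j y : ℂ) - Apot R f' j y
      = cv (kern R j) (fun x => (‖S f x‖ : ℂ) ^ 2 - (‖S f' x‖ : ℂ) ^ 2) y := fun y => by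
    rw [ofReal_Apot, ofReal_Apot, (subCoulomb_kern R j).cv_sub (hasPot_dens ha) (hasPot_dens ha')]
  simp only [e]
  refine L2Le.cv (subCoulomb_kern R j) (L2Le.coe (S (f - f'))) (ha.add_norm ha') hh
    ((meas_dens f).sub (meas_dens f')) ?_
  filter_upwards [S_sub_ae f f'] with x hx
  rw [hx, norm_real, Real.norm_of_nonneg (by positivity)]
  exact norm_normSq_sub_le _ _

/-- The sources of the quadratic and of the quartic part of the scalar potential. -/
def quart (R : ℝ) (f : L2) (j : Fin 2) (x : Plane) : ℂ := (Apot R f j x : ℂ) * (‖S f x‖ : ℂ) ^ 2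

theorem meas_quart (R : ℝ) (f : L2) (j : Fin 2) :
    AEStronglyMeasurable (quart R f j) (volume : Measure Plane) :=
  (meas_Apot R f j).mul (meas_dens f)

theorem hasPot_quart (R : ℝ) {f : L2} {a : ℝ} (ha : HasHardy (S f) a) (j : Fin 2) :
    HasPot (quart R f j) ((a * a) * (a * a)) :=
  (hasPot_dens ha).of_le (by have := ha.nonneg; positivity) (meas_quart R f j)
    (Eventually.of_forall fun x => by
      rw [quart, norm_mul, norm_real, Real.norm_eq_abs]
      gcongr
      exact abs_Apot_le R ha j x)

theorem Vpot_eq (β R : ℝ) (f : L2) (y : Plane) : Vpot β R f y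
    = 2 * β * (∑ j, cv (kern R j) (quart R f j) y) + ∑ j, cv (kern R j) (curr f j) y := by
  rw [Vpot, Finset.mul_sum, ← Finset.sum_add_distrib]
  refine Finset.sum_congr rfl fun j _ => ?_
  have h : HasPot (fun x => 2 * β * quart R f j x) _ :=
    (hasPot_quart R (hardy_S_le f) j).of_le (norm_nonneg (2 * β : ℂ))
      (aestronglyMeasurable_const.mul (meas_quart R f j)) (Eventually.of_forall fun x => norm_mul_le _ _)
  rw [← cv_const_mul, ← (subCoulomb_kern R j).cv_add h (hasPot_curr (hardy_S_le f) (hardy_D_le j f))]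
  refine cv_congr_ae (Eventually.of_forall fun x => ?_) y
  simp only [src, quart]
  ring

/-- Telescoping. In the term with the difference of the vector potentials, one factor `|S f|` makes
that difference square integrable and the other remains for the Hardy slot. -/
theorem l2Le_quart_sub (R : ℝ) {f f' : L2} {a c : ℝ} (ha : HasHardy (S f) a)
    (ha' : HasHardy (S f') a) {h : Plane → ℂ} (hh : HasHardy h c) (j : Fin 2) :
    L2Le (fun y => (cv (kern R j) (quart R f j) y - cv (kern R j) (quart R f' j) y) * h y)
      ((1 * (‖S (f - f')‖ * (2 * (a + a)) * a) + (a * a) * ‖S (f - f')‖) * (2 * (a + a)) * c) := by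
  have haa := ha.nonneg
  simp only [← (subCoulomb_kern R j).cv_sub (hasPot_quart R ha j) (hasPot_quart R ha' j)]
  have h1 := l2Le_Apot_sub R ha ha' ha j
  have h2 : L2Le (fun x => ((‖((Apot R f j x : ℂ) - Apot R f' j x) * S f x‖ : ℝ) : ℂ))
      (1 * (‖S (f - f')‖ * (2 * (a + a)) * a)) :=
    h1.of_le zero_le_one (continuous_ofReal.comp_aestronglyMeasurable h1.meas.norm)
      (Eventually.of_forall fun x => by rw [norm_real, norm_norm, one_mul])
  have h3 : L2Le (fun x => ((a * a * ‖S (f - f') x‖ : ℝ) : ℂ)) ((a * a) * ‖S (f - f')‖) :=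
    (L2Le.coe (S (f - f'))).of_le (by positivity)
      (continuous_ofReal.comp_aestronglyMeasurable ((meas_coe _).norm.const_mul _))
      (Eventually.of_forall fun x => by rw [norm_real, Real.norm_of_nonneg (by positivity)])
  refine L2Le.cv (subCoulomb_kern R j) (h2.add h3) (ha.add_norm ha') hh
    ((meas_quart R f j).sub (meas_quart R f' j)) ?_
  filter_upwards [S_sub_ae f f'] with x hx
  rw [← ofReal_add, norm_real, norm_real, Real.norm_of_nonneg (by positivity),
    Real.norm_of_nonneg (by positivity)]
  have e : quart R f j x - quart R f' j x = ((Apot R f j x : ℂ) - Apot R f' j x) * (‖S f x‖ : ℂ) ^ 2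
      + (Apot R f' j x : ℂ) * ((‖S f x‖ : ℂ) ^ 2 - (‖S f' x‖ : ℂ) ^ 2) := by
    simp only [quart]; ring
  have h4 := norm_normSq_sub_le (S f x) (S f' x)
  have h5 := abs_Apot_le R ha' j x
  rw [e]
  refine (norm_add_le _ _).trans ?_
  rw [norm_mul, norm_mul, norm_mul, norm_pow, norm_real ‖S f x‖, norm_norm, norm_real (Apot R f' j x),
    Real.norm_eq_abs, hx]
  have h6 := mul_le_mul h5 h4 (norm_nonneg _) (by positivity)
  have h7 : 0 ≤ ‖(Apot R f j x : ℂ) - Apot R f' j x‖ * ‖S f x‖ * ‖S f' x‖ := by positivity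
  nlinarith

/-- The difference of the currents contains derivatives of `w = f - f'`, which `‖S w‖` does not
control. Adding multiples of the gradients of `conj (S w) * S f'` and `conj (S f') * S w` shifts all
derivatives onto `f` and `f'`. These gradients contribute nothing, because the kernels are
divergence free. -/
theorem sum_cv_curr_sub (R : ℝ) (f f' : L2) (y : Plane) :
    ∑ j, cv (kern R j) (curr f j) y - ∑ j, cv (kern R j) (curr f' j) y
      = ∑ j, cv (kern R j) (fun x => I * (S (f - f') x * conj (D j f x) - conj (S (f - f') x) * D j f' x
        - conj (S (f - f') x) * D j f x + S (f - f') x * conj (D j f' x))) y := by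
  set w := f - f' with hw
  set a : ℝ := 40 * max ‖w‖ (max ‖f‖ ‖f'‖) with ha
  have Hw : HasHardy (S w) a := (hardy_S_le w).mono (by simp only [ha]; gcongr; exact le_max_left _ _)
  have Hf : HasHardy (S f') a := (hardy_S_le f').mono (by
    simp only [ha]; gcongr; exact (le_max_right _ _).trans (le_max_right _ _))
  have Hdw : ∀ j, HasHardy (D j w) a := fun j => (hardy_D_le j w).mono (by
    simp only [ha]; gcongr; exact le_max_left _ _)
  have Hdf' : ∀ j, HasHardy (D j f') a := fun j => (hardy_D_le j f').mono (by
    simp only [ha]; gcongr; exact (le_max_right _ _).trans (le_max_right _ _))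
  have Hdf : ∀ j, HasHardy (D j f) a := fun j => (hardy_D_le j f).mono (by
    simp only [ha]; gcongr; exact (le_max_left _ _).trans (le_max_right _ _))
  set ρ : Fin 2 → Plane → ℂ := fun j x => I * (S w x * conj (D j f x) - conj (S w x) * D j f' x
        - conj (S w x) * D j f x + S w x * conj (D j f' x)) with hρ
  have hρm : ∀ j, AEStronglyMeasurable (ρ j) (volume : Measure Plane) := fun j =>
    aestronglyMeasurable_const.mul (((((meas_coe _).mul (meas_conj (meas_coe _))).sub
      ((meas_conj (meas_coe _)).mul (meas_coe _))).sub ((meas_conj (meas_coe _)).mul (meas_coe _))).add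
      ((meas_coe _).mul (meas_conj (meas_coe _))))
  have hρb : ∀ j x, ‖ρ j x‖ ≤ 2 * ‖S w x‖ * (‖D j f x‖ + ‖D j f' x‖) := fun j x => by
    simp only [hρ]
    rw [norm_mul, norm_I, one_mul]
    refine (norm_add_le _ _).trans ?_
    refine (add_le_add_left (norm_sub_le _ _) _).trans ?_
    refine (add_le_add_left (add_le_add_left (norm_sub_le _ _) _) _).trans ?_
    simp only [norm_mul, RCLike.norm_conj]
    linarith
  have hρP : ∀ j, HasPot (ρ j) (2 * a * (2 * (a + a))) := fun j =>
    Hw.two_mul_norm.hasPot ((Hdf j).add_norm (Hdf' j)) (hρm j) (Eventually.of_forall fun x => by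
      rw [norm_real, norm_real, Real.norm_of_nonneg (by positivity), Real.norm_of_nonneg (by positivity)]
      exact hρb j x)
  have P1 := hasPot_pair Hw Hf Hdw Hdf'
  have P2 := hasPot_pair Hf Hw Hdf' Hdw
  set θ₁ : Fin 2 → Plane → ℂ := fun j x => conj (D j w x) * S f' x + conj (S w x) * D j f' x with hθ₁
  set θ₂ : Fin 2 → Plane → ℂ := fun j x => conj (D j f' x) * S w x + conj (S f' x) * D j w x with hθ₂
  have Z1 : ∑ j, cv (kern R j) (θ₁ j) y = 0 := sum_cv_kern (isH1_S w) (isH1_S f') P1 R y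
  have Z2 : ∑ j, cv (kern R j) (θ₂ j) y = 0 := sum_cv_kern (isH1_S f') (isH1_S w) P2 R y
  have hS : ∀ᵐ x, S w x = S f x - S f' x := S_sub_ae f f'
  have hD : ∀ j, ∀ᵐ x, D j w x = D j f x - D j f' x := D_sub_ae f f'
  have hc : ∀ {σ : Plane → ℂ} {B : ℝ} (c : ℂ), HasPot σ B → HasPot (fun x => c * σ x) (‖c‖ * B) :=
    fun c hσ => hσ.of_le (norm_nonneg c) (aestronglyMeasurable_const.mul hσ.meas)
      (Eventually.of_forall fun x => norm_mul_le _ _)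
  have key : ∀ j, cv (kern R j) (curr f j) y - cv (kern R j) (curr f' j) y
      = cv (kern R j) (ρ j) y + (I * cv (kern R j) (θ₁ j) y + -I * cv (kern R j) (θ₂ j) y) := fun j => by
    have hk := subCoulomb_kern R j
    rw [← hk.cv_sub (hasPot_curr (hardy_S_le f) (hardy_D_le j f))
      (hasPot_curr (hardy_S_le f') (hardy_D_le j f')), ← cv_const_mul, ← cv_const_mul,
      ← hk.cv_add (hc I (P1 j)) (hc (-I) (P2 j)),
      ← hk.cv_add (hρP j) ((hc I (P1 j)).add (hc (-I) (P2 j)))]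
    refine cv_congr_ae ?_ y
    filter_upwards [hS, hD j] with x h1 h2
    simp only [curr, hρ, h1, h2, map_sub]
    ring
  rw [← Finset.sum_sub_distrib]
  simp only [key, Finset.sum_add_distrib, ← Finset.mul_sum, Z1, Z2, mul_zero, add_zero]
  rfl

theorem l2Le_sum_curr_sub (R : ℝ) {f f' : L2} {b c : ℝ} (hb : ∀ j, HasHardy (D j f) b)
    (hb' : ∀ j, HasHardy (D j f') b) {h : Plane → ℂ} (hh : HasHardy h c) :
    L2Le (fun y => (∑ j, cv (kern R j) (curr f j) y - ∑ j, cv (kern R j) (curr f' j) y) * h y)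
      (2 * (‖S (f - f')‖ * (2 * (2 * (b + b))) * c)) := by
  simp only [sum_cv_curr_sub, Finset.sum_mul]
  refine L2Le.sum fun j => ?_
  refine L2Le.cv (subCoulomb_kern R j) (L2Le.coe (S (f - f'))) ((hb j).add_norm (hb' j)).two_mul_norm hh
    ?_ (Eventually.of_forall fun x => ?_)
  · exact aestronglyMeasurable_const.mul (((((meas_coe _).mul (meas_conj (meas_coe _))).sub
      ((meas_conj (meas_coe _)).mul (meas_coe _))).sub ((meas_conj (meas_coe _)).mul (meas_coe _))).add
      ((meas_coe _).mul (meas_conj (meas_coe _))))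
  · have e : ∀ p : ℝ, 0 ≤ p → ‖((2 * ‖(p : ℂ)‖ : ℝ) : ℂ)‖ = 2 * p := fun p hp => by
      rw [norm_real p, norm_real, Real.norm_of_nonneg hp, Real.norm_of_nonneg (by positivity)]
    rw [norm_mul, norm_I, one_mul, e _ (by positivity)]
    refine (norm_add_le _ _).trans ?_
    refine (add_le_add_left (norm_sub_le _ _) _).trans ?_
    refine (add_le_add_left (add_le_add_left (norm_sub_le _ _) _) _).trans ?_
    simp only [norm_mul, RCLike.norm_conj]
    linarith

/-- The Lipschitz bound that closes the energy estimate: the difference enters only through the `L²`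
norm of `S (f - f')`, at the price of a full `‖x‖` in the second argument, which pays for the Hardy
bounds of `S x` and `D j x`. -/
theorem norm_pert_sub_le {β : ℝ} (hβ : |β| ≤ 1) (R : ℝ) {f f' : L2} {a : ℝ} (ha : HasHardy (S f) a)
    (ha' : HasHardy (S f') a) (hb : ∀ j, HasHardy (D j f) a) (hb' : ∀ j, HasHardy (D j f') a) (x : L2) :
    ‖pert β R f x - pert β R f' x‖ ≤ 40 * (100 * a + 100 * a ^ 3) * ‖x‖ * ‖S (f - f')‖ := by
  have haa := ha.nonneg
  set η := ‖S (f - f')‖ with hη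
  have hη0 : 0 ≤ η := norm_nonneg _
  set c := 40 * ‖x‖ with hc
  have hc0 : 0 ≤ c := by positivity
  have hmA : ∀ j, AEStronglyMeasurable (fun y => (Apot R f j y : ℂ) - Apot R f' j y)
      (volume : Measure Plane) := fun j => (meas_Apot R f j).sub (meas_Apot R f' j)
  have F1 : ∀ j, L2Le (fun y => -2 * I * β * (((Apot R f j y : ℂ) - Apot R f' j y) * D j x y))
      (2 * (η * (2 * (a + a)) * c)) := fun j =>
    (l2Le_Apot_sub R ha ha' (hardy_D_le j x) j).of_le zero_le_two
      (aestronglyMeasurable_const.mul ((hmA j).mul (meas_coe _)))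
      (Eventually.of_forall fun y => by
        rw [norm_mul]
        gcongr
        simpa using hβ)
  have F2 : ∀ j, L2Le (fun y => (β : ℂ) ^ 2 * (((Apot R f j y : ℂ) + Apot R f' j y) *
      (((Apot R f j y : ℂ) - Apot R f' j y) * S x y))) (2 * (a * a) * (η * (2 * (a + a)) * c)) := fun j =>
    (l2Le_Apot_sub R ha ha' (hardy_S_le x) j).of_le (by positivity)
      (aestronglyMeasurable_const.mul (((meas_Apot R f j).add (meas_Apot R f' j)).mul
        ((hmA j).mul (meas_coe _))))
      (Eventually.of_forall fun y => by
        rw [norm_mul, norm_mul, ← mul_assoc]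
        refine mul_le_mul_of_nonneg_right ?_ (norm_nonneg _)
        have h1 := abs_Apot_le R ha j y
        have h2 := abs_Apot_le R ha' j y
        have h3 : ‖(β : ℂ) ^ 2‖ ≤ 1 := by
          rw [norm_pow, norm_real, Real.norm_eq_abs]
          exact pow_le_one₀ (abs_nonneg _) hβ
        have h4 : ‖(Apot R f j y : ℂ) + Apot R f' j y‖ ≤ 2 * (a * a) := by
          refine (norm_add_le _ _).trans ?_
          rw [norm_real, norm_real, Real.norm_eq_abs, Real.norm_eq_abs]
          linarith
        calc _ ≤ 1 * (2 * (a * a)) := mul_le_mul h3 h4 (norm_nonneg _) zero_le_one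
          _ = _ := one_mul _)
  have F3 : ∀ j, L2Le (fun y => -2 * (β : ℂ) ^ 2 *
      ((cv (kern R j) (quart R f j) y - cv (kern R j) (quart R f' j) y) * S x y))
      (2 * ((1 * (η * (2 * (a + a)) * a) + (a * a) * η) * (2 * (a + a)) * c)) := fun j =>
    (l2Le_quart_sub R ha ha' (hardy_S_le x) j).of_le zero_le_two
      (aestronglyMeasurable_const.mul (l2Le_quart_sub R ha ha' (hardy_S_le x) j).meas)
      (Eventually.of_forall fun y => by
        rw [norm_mul]
        gcongr
        have h3 : ‖(β : ℂ) ^ 2‖ ≤ 1 := by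
          rw [norm_pow, norm_real, Real.norm_eq_abs]
          exact pow_le_one₀ (abs_nonneg _) hβ
        rw [norm_mul]
        have : ‖(-2 : ℂ)‖ = 2 := by simp
        rw [this]
        linarith)
  have F4 : L2Le (fun y => -(β : ℂ) *
      ((∑ j, cv (kern R j) (curr f j) y - ∑ j, cv (kern R j) (curr f' j) y) * S x y))
      (1 * (2 * (η * (2 * (2 * (a + a))) * c))) :=
    (l2Le_sum_curr_sub R hb hb' (hardy_S_le x)).of_le zero_le_one
      (aestronglyMeasurable_const.mul (l2Le_sum_curr_sub R hb hb' (hardy_S_le x)).meas)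
      (Eventually.of_forall fun y => by
        rw [norm_mul]
        gcongr
        simpa using hβ)
  have F := (((L2Le.sum F1).add (L2Le.sum F2)).add (L2Le.sum F3)).add F4
  refine (F.norm_le (w := pert β R f x - pert β R f' x) ?_).trans ?_
  · filter_upwards [Lp.coeFn_sub (pert β R f x) (pert β R f' x), pert_ae β R f x, pert_ae β R f' x]
      with y h1 h2 h3
    rw [h1, Pi.sub_apply, h2, h3, Wpot, Wpot, Vpot_eq, Vpot_eq]
    simp only [Fin.sum_univ_two]
    ring
  · have h3 : 0 ≤ η * c * a ^ 3 := by positivity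
    have h4 : 0 ≤ η * c * a := by positivity
    have e : 40 * (100 * a + 100 * a ^ 3) * ‖x‖ * η = 100 * (η * c * a) + 100 * (η * c * a ^ 3) := by
      rw [hc]; ring
    rw [e]
    nlinarith

end

end CSS

open MeasureTheory Complex Filter Topology Set FourierTransform
open scoped LineDeriv SchwartzMap ComplexConjugate ENNReal

namespace CSS

noncomputable section

/-! ### Admissibility of the Hamiltonian -/

theorem norm_lap (g : L2) : ‖((4 * Real.pi ^ 2 : ℝ) : ℂ) • (g - S g)‖ = lapNorm g := by
  rw [norm_smul, norm_real, Real.norm_of_nonneg (by positivity), lapNorm]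

theorem norm_D_le_sqrt (g : L2) (j : Fin 2) : ‖D j g‖ ≤ Real.sqrt (‖S g‖ * lapNorm g) := by
  refine Real.le_sqrt_of_sq_le (le_trans ?_ (sum_norm_D_sq_le g))
  exact Finset.single_le_sum (f := fun j => ‖D j g‖ ^ 2) (fun _ _ => sq_nonneg _) (Finset.mem_univ j)

theorem norm_le_lapNorm (g : L2) : ‖g‖ ≤ ‖S g‖ + lapNorm g / 2 := by
  have h1 : ‖g‖ ≤ ‖S g‖ + ‖g - S g‖ := by
    calc ‖g‖ = ‖S g + (g - S g)‖ := by rw [add_sub_cancel]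
      _ ≤ _ := norm_add_le _ _
  have h2 : ‖g - S g‖ ≤ lapNorm g / 2 := by
    rw [lapNorm]
    have h3 : 2 ≤ 4 * Real.pi ^ 2 := by nlinarith [Real.pi_gt_three]
    linarith [mul_le_mul_of_nonneg_right h3 (norm_nonneg (g - S g))]
  linarith

/-- The perturbation is relatively small for small coupling. -/
theorem norm_pert_self_le {β m : ℝ} (hβ : |β| * m ^ 2 ≤ 1 / 100) (R : ℝ) {f : L2} (hf : ‖S f‖ ≤ m) :
    ‖pert β R f f‖ ≤ lapNorm f / 2 := by
  have hm : 0 ≤ m := (norm_nonneg _).trans hf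
  set L := lapNorm f with hL
  have hL0 : 0 ≤ L := lapNorm_nonneg f
  -- `d` bounds the first derivatives by interpolation, and `a² = 4 m d` is the resulting Hardy
  -- constant of `S f`. Thus `a² d = 4 m² L`, and every term below is linear in `L` with a
  -- coefficient depending on `|β| m²`.
  set d := Real.sqrt (m * L) with hd
  have hd0 : 0 ≤ d := Real.sqrt_nonneg _
  have hdd : d * d = m * L := Real.mul_self_sqrt (by positivity)
  have hDd : ∀ j, ‖D j f‖ ≤ d := fun j =>
    (norm_D_le_sqrt f j).trans (Real.sqrt_le_sqrt (mul_le_mul_of_nonneg_right hf hL0))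
  set a := Real.sqrt (4 * m * d) with ha
  have haa : a * a = 4 * m * d := Real.mul_self_sqrt (by positivity)
  have ha0 : 0 ≤ a := Real.sqrt_nonneg _
  have H : HasHardy (S f) a := (hardy_S f).mono (Real.sqrt_le_sqrt (by
    rw [Fin.sum_univ_two]
    calc 2 * ‖S f‖ * (‖D 0 f‖ + ‖D 1 f‖) ≤ 2 * m * (d + d) := by
          gcongr
          · exact hDd 0
          · exact hDd 1
      _ = 4 * m * d := by ring))
  have F1 : ∀ j, L2Le (fun y => -2 * I * β * (Apot R f j y : ℂ) * D j f y)
      (2 * |β| * (a * a) * d) := fun j =>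
    ((L2Le.coe (D j f)).mono (hDd j)).of_le (by positivity)
      ((aestronglyMeasurable_const.mul (meas_Apot R f j)).mul (meas_coe _))
      (Eventually.of_forall fun y => by
        rw [norm_mul, norm_mul, norm_real, Real.norm_eq_abs]
        gcongr
        · simp
        · exact abs_Apot_le R H j y)
  have F2 : L2Le (fun y => ((β : ℂ) ^ 2 * ∑ j, (Apot R f j y : ℂ) ^ 2
      - β * (2 * β * ∑ j, cv (kern R j) (quart R f j) y)) * S f y)
      ((2 * β ^ 2 * (a * a) ^ 2 + |β| * (2 * |β| * (2 * ((a * a) * (a * a))))) * m) := by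
    refine ((L2Le.coe (S f)).mono hf).of_le (by positivity) ?_ (Eventually.of_forall fun y => ?_)
    · refine AEStronglyMeasurable.mul ?_ (meas_coe _)
      have h1 : AEStronglyMeasurable (fun y => ∑ j, cv (kern R j) (quart R f j) y)
          (volume : Measure Plane) := by
        simp only [Fin.sum_univ_two]
        exact ((subCoulomb_kern R 0).aestronglyMeasurable_cv (meas_quart R f 0)).add
          ((subCoulomb_kern R 1).aestronglyMeasurable_cv (meas_quart R f 1))
      have h2 : AEStronglyMeasurable (fun y => ∑ j, (Apot R f j y : ℂ) ^ 2)
          (volume : Measure Plane) := by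
        simp only [Fin.sum_univ_two]
        exact ((meas_Apot R f 0).pow 2).add ((meas_Apot R f 1).pow 2)
      exact (aestronglyMeasurable_const.mul h2).sub
        (aestronglyMeasurable_const.mul (aestronglyMeasurable_const.mul h1))
    · rw [norm_mul]
      gcongr
      refine (norm_sub_le _ _).trans (add_le_add (norm_Asq_le β R H y) ?_)
      have h1 : ‖∑ j, cv (kern R j) (quart R f j) y‖ ≤ 2 * ((a * a) * (a * a)) := by
        rw [Fin.sum_univ_two, two_mul]
        exact (norm_add_le _ _).trans (add_le_add
          ((subCoulomb_kern R 0).norm_cv_le (hasPot_quart R H 0) y)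
          ((subCoulomb_kern R 1).norm_cv_le (hasPot_quart R H 1) y))
      rw [norm_mul, norm_mul, norm_mul, norm_real, Real.norm_eq_abs, norm_ofNat]
      gcongr
  -- The derivative in the current takes the `L²` slot, so that both Hardy slots are filled by `S f`
  -- and second derivatives do not occur.
  have F3 : ∀ j, L2Le (fun y => -(β : ℂ) * (cv (kern R j) (curr f j) y * S f y))
      (|β| * (d * (2 * a) * a)) := fun j => by
    have h := L2Le.cv (subCoulomb_kern R j) ((L2Le.coe (D j f)).mono (hDd j)) H.two_mul_norm H
      (meas_curr f j) (Eventually.of_forall fun x => by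
        rw [norm_real, Real.norm_of_nonneg (by positivity), mul_comm]
        exact norm_curr_le f j x)
    exact h.of_le (abs_nonneg _) (aestronglyMeasurable_const.mul h.meas)
      (Eventually.of_forall fun y => by rw [norm_mul, norm_neg, norm_real, Real.norm_eq_abs])
  have F := ((L2Le.sum F1).add F2).add (L2Le.sum F3)
  refine (F.norm_le (w := pert β R f f) ?_).trans ?_
  · filter_upwards [pert_ae β R f f] with y h
    rw [h, Wpot, Vpot_eq]
    simp only [Fin.sum_univ_two]
    ring
  · have e : 2 * (2 * |β| * (a * a) * d)
        + (2 * β ^ 2 * (a * a) ^ 2 + |β| * (2 * |β| * (2 * ((a * a) * (a * a))))) * m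
        + 2 * (|β| * (d * (2 * a) * a))
        = (32 * (|β| * m ^ 2) + 96 * (|β| * m ^ 2) ^ 2) * L := by
      have hβ2 : β ^ 2 = |β| ^ 2 := (sq_abs β).symm
      calc _ = 8 * |β| * (a * a) * d + 6 * |β| ^ 2 * (a * a) ^ 2 * m := by rw [hβ2]; ring
        _ = 32 * |β| * m * (d * d) + 96 * |β| ^ 2 * m ^ 3 * (d * d) := by rw [haa]; ring
        _ = _ := by rw [hdd]; ring
    rw [e]
    -- For `|β| m² ≤ 1/100` the coefficient is at most `0.32 + 0.0096`, below `1/2`.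
    have h0 : 0 ≤ |β| * m ^ 2 := by positivity
    nlinarith [mul_nonneg h0 hL0]

/-- Interpolation followed by the inequality of arithmetic and geometric means, arranged so that
first derivatives are absorbed into half of the Laplacian. No smallness of the coupling is needed,
in contrast to coercivity. -/
theorem sum_norm_D_le (g : L2) (a : ℝ) :
    2 * a ^ 2 * ∑ j, ‖D j g‖ ≤ lapNorm g / 2 + 4 * a ^ 4 * ‖S g‖ := by
  have h := sum_norm_D_sq_le g
  have hL := lapNorm_nonneg g
  have hX := norm_nonneg (S g)
  rw [Fin.sum_univ_two] at h ⊢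
  refine abs_le_of_sq_le_sq' ?_ (by positivity) |>.2
  set p := ‖D 0 g‖
  set q := ‖D 1 g‖
  set X := ‖S g‖
  set L := lapNorm g
  have h1 : (p + q) ^ 2 ≤ 2 * (X * L) := by nlinarith [sq_nonneg (p - q)]
  have h2 : 4 * a ^ 4 * (p + q) ^ 2 ≤ 4 * a ^ 4 * (2 * (X * L)) := by gcongr
  nlinarith [sq_nonneg (L / 2 - 4 * a ^ 4 * X)]

theorem norm_pert_le_self {β : ℝ} (hβ : |β| ≤ 1) (R : ℝ) {f : L2} {a : ℝ} (ha : HasHardy (S f) a)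
    (hb : ∀ j, HasHardy (D j f) a) (g : L2) :
    ‖pert β R f g‖ ≤ 2 * a ^ 2 * ∑ j, ‖D j g‖ + (6 * a ^ 4 + 4 * a ^ 2) * ‖S g‖ := by
  have ha0 := ha.nonneg
  refine (norm_pert_le β R ha hb g).trans ?_
  have hs : 0 ≤ ∑ j, ‖D j g‖ := Finset.sum_nonneg fun _ _ => norm_nonneg _
  have hβ2 : β ^ 2 ≤ 1 := by rw [← sq_abs]; exact pow_le_one₀ (abs_nonneg _) hβ
  calc _ ≤ 2 * 1 * (a * a) * ∑ j, ‖D j g‖ + (2 * 1 * (a * a) ^ 2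
      + 1 * (2 * (2 * 1 * (a * a) * (a * a) + 2 * a * a))) * ‖S g‖ := by gcongr
    _ = _ := by ring

theorem admissible_ham {β m : ℝ} (hβ : |β| ≤ 1) (hm : |β| * m ^ 2 ≤ 1 / 100) (R : ℝ) :
    Admissible planeFrame m m
      (fun M => 8 * Real.pi ^ 2 + (8 * Real.pi * (40 * M) ^ 2 + 6 * (40 * M) ^ 4 + 4 * (40 * M) ^ 2))
      (fun M => 40 * (100 * |40 * M| + 100 * |40 * M| ^ 3))
      (fun M => 1 + 10 * (40 * M) ^ 4 + 4 * (40 * M) ^ 2) (ham β R) := by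
  have Hf : ∀ {M : ℝ} {f : L2}, ‖f‖ ≤ M → HasHardy (S f) (40 * M) := fun {M f} h =>
    (hardy_S_le f).mono (by gcongr)
  have Hd : ∀ {M : ℝ} {f : L2}, ‖f‖ ≤ M → ∀ j, HasHardy (D j f) (40 * M) := fun {M f} h j =>
    (hardy_D_le j f).mono (by gcongr)
  refine ⟨fun M => by positivity, fun f x y => ham_symm β R f x y, fun M f x hf => ?_,
    fun M f f' x hf hf' => ?_, fun n f hf hP => ?_, fun M f x hf => ?_⟩
  · have hp := norm_pert_le_self hβ R (Hf hf) (Hd hf) x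
    rw [ham_apply]
    refine (norm_add_le _ _).trans ?_
    rw [norm_lap, lapNorm]
    have h1 : ‖x - S x‖ ≤ 2 * ‖x‖ := (norm_sub_le _ _).trans (by linarith [norm_S_le x])
    have h2 := norm_S_le x
    rw [Fin.sum_univ_two] at hp
    have h3 := norm_D_le 0 x
    have h4 := norm_D_le 1 x
    calc _ ≤ 4 * Real.pi ^ 2 * (2 * ‖x‖) + (2 * (40 * M) ^ 2 * (2 * Real.pi * ‖x‖ + 2 * Real.pi * ‖x‖)
        + (6 * (40 * M) ^ 4 + 4 * (40 * M) ^ 2) * ‖x‖) := by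
          refine add_le_add (by gcongr) (hp.trans ?_)
          gcongr
      _ = _ := by ring
  · have hM : 0 ≤ 40 * M := by have := (norm_nonneg f).trans hf; positivity
    have h := norm_pert_sub_le hβ R (Hf hf) (Hf hf') (Hd hf) (Hd hf') x
    rw [ham_apply, ham_apply, add_sub_add_left_eq_sub, abs_of_nonneg hM]
    rwa [map_sub] at h
  -- Coercivity, where the smallness of `|β| m²` enters. The projection commutes with the Laplacian,
  -- so `lapNorm f ≤ ‖P n (H f f)‖ + lapNorm f / 2`, and `‖f‖ ≤ ‖S f‖ + lapNorm f / 2` gives the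
  -- additive constant `m`.
  · have hP1 : planeFrame.P n (f - S f) = f - S f := by
      rw [map_sub, hP]
      congr 1
      have h1 := planeFrame.S_P n f
      rw [hP] at h1
      exact h1.symm
    have h1 := norm_le_lapNorm f
    have h2 := norm_pert_self_le hm R hf
    have h3 := (planeFrame.P_le n (pert β R f f)).trans h2
    have h4 : lapNorm f ≤ ‖planeFrame.P n (ham β R f f)‖ + ‖planeFrame.P n (pert β R f f)‖ := by
      rw [← norm_lap, ← hP1, ← map_smul, ham_apply, map_add]
      calc _ = ‖planeFrame.P n (((4 * Real.pi ^ 2 : ℝ) : ℂ) • (f - S f)) + planeFrame.P n (pert β R f f)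
            - planeFrame.P n (pert β R f f)‖ := by rw [add_sub_cancel_right]
        _ ≤ _ := norm_sub_le _ _
    change ‖S f‖ ≤ m at hf
    linarith
  · have hp := norm_pert_le_self hβ R (Hf hf) (Hd hf) x
    have hs := sum_norm_D_le x (40 * M)
    have h1 := norm_le_lapNorm x
    have h2 : lapNorm x ≤ ‖ham β R f x‖ + ‖pert β R f x‖ := by
      rw [← norm_lap, ham_apply]
      calc _ = ‖((4 * Real.pi ^ 2 : ℝ) : ℂ) • (x - S x) + pert β R f x - pert β R f x‖ := by
            rw [add_sub_cancel_right]
        _ ≤ _ := norm_sub_le _ _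
    change ‖x‖ ≤ ‖ham β R f x‖ + _ * ‖S x‖
    linarith

end

end CSS

open MeasureTheory Complex Filter Topology Set FourierTransform
open scoped LineDeriv SchwartzMap ComplexConjugate ENNReal

namespace CSS

noncomputable section

/-! ### The smeared Coulomb potential -/

/-- The circle mean of `log |z - a|` is `log max(r, |a|)`, which is the source of Newton's theorem.
Periodicity reconciles the angular interval of polar coordinates with that of the circle average. -/
theorem integral_circle_log {r : ℝ} (hr : 0 < r) (a : ℂ) :
    ∫ θ in Ioo (-Real.pi) Real.pi, Real.log ‖Complex.polarCoord.symm (r, θ) - a‖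
      = 2 * Real.pi * Real.log (max r ‖a‖) := by
  have h := circleAverage_log_norm_sub_const_eq_log_radius_add_posLog (a := a) (c := 0) hr.ne'
  rw [Real.circleAverage_def, smul_eq_mul, inv_mul_eq_iff_eq_mul₀ (by positivity)] at h
  have h1 : Real.log r + Real.posLog (r⁻¹ * ‖0 - a‖) = Real.log (max r ‖a‖) := by
    rw [zero_sub, norm_neg, Real.posLog_eq_log_max_one (by positivity),
      ← Real.log_mul hr.ne' (by positivity), mul_max_of_nonneg _ _ hr.le, mul_one,
      mul_inv_cancel_left₀ hr.ne']
  rw [h1] at h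
  rw [← integral_Ioc_eq_integral_Ioo, ← intervalIntegral.integral_of_le (by linarith [Real.pi_pos]), ← h]
  have hper : Function.Periodic (fun θ : ℝ => Real.log ‖circleMap 0 r θ - a‖) (2 * Real.pi) :=
    (periodic_circleMap 0 r).comp fun z : ℂ => Real.log ‖z - a‖
  have h2 := hper.intervalIntegral_add_eq (-Real.pi) 0
  rw [zero_add, show -Real.pi + 2 * Real.pi = Real.pi by ring] at h2
  rw [← h2]
  refine intervalIntegral.integral_congr fun θ _ => ?_
  simp only [Complex.polarCoord_symm_apply, circleMap, zero_add, Complex.exp_mul_I, ofReal_cos, ofReal_sin]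

theorem integrableOn_log_norm (R : ℝ) (a : ℂ) :
    IntegrableOn (fun z : ℂ => Real.log ‖z - a‖) (Metric.ball 0 R) := by
  have h1 : IntegrableOn (fun z : ℂ => Real.log ‖z‖) (Metric.ball 0 (R + ‖a‖)) := by
    rw [integrableOn_fun_norm_addHaar, Complex.finrank_real_complex]
    rcases le_or_gt (R + ‖a‖) 0 with h | h
    · rw [Ioo_eq_empty (by linarith)]; exact integrableOn_empty
    · have hc : Continuous fun y : ℝ => y * Real.log y := Real.continuous_mul_log
      have h2 : IntegrableOn (fun y : ℝ => y * Real.log y) (Icc 0 (R + ‖a‖)) :=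
        hc.continuousOn.integrableOn_Icc
      simpa using h2.mono_set Ioo_subset_Icc_self
  have h2 := (measurePreserving_sub_right (volume : Measure ℂ) a).integrableOn_comp_preimage
    (MeasurableEquiv.subRight a).measurableEmbedding (f := fun z => Real.log ‖z‖)
    (s := Metric.ball 0 (R + ‖a‖))
  refine (h2.2 h1).mono_set fun z hz => ?_
  simp only [mem_preimage, Metric.mem_ball, dist_zero_right] at hz ⊢
  exact (norm_sub_le _ _).trans_lt (by linarith)

theorem integral_ball_log {R : ℝ} (hR : 0 < R) (a : ℂ) :
    ∫ z in Metric.ball (0 : ℂ) R, Real.log ‖z - a‖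
      = 2 * Real.pi * ∫ r in (0 : ℝ)..R, r * Real.log (max r ‖a‖) := by
  set f : ℂ → ℝ := (Metric.ball (0 : ℂ) R).indicator fun z => Real.log ‖z - a‖ with hf
  have hfi : Integrable f := (integrable_indicator_iff measurableSet_ball).2 (integrableOn_log_norm R a)
  have hfm : Measurable f := Measurable.indicator (by fun_prop) measurableSet_ball
  have hpm : Measurable fun p : ℝ × ℝ => Complex.polarCoord.symm p := by
    simp only [Complex.polarCoord_symm_apply]; fun_prop
  have hint : IntegrableOn (fun p : ℝ × ℝ => p.1 * f (Complex.polarCoord.symm p))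
      (Ioi (0 : ℝ) ×ˢ Ioo (-Real.pi) Real.pi) (volume.prod volume) := by
    refine ⟨Measurable.aestronglyMeasurable (measurable_fst.mul (hfm.comp hpm)), ?_⟩
    have h := Complex.lintegral_comp_polarCoord_symm fun z => ‖f z‖ₑ
    have h2 := hfi.2
    rw [HasFiniteIntegral, ← h] at h2
    rw [HasFiniteIntegral]
    refine lt_of_le_of_lt (le_of_eq ?_) h2
    refine setLIntegral_congr_fun (measurableSet_Ioi.prod measurableSet_Ioo) fun p hp => ?_
    simp only [enorm_mul, smul_eq_mul]
    rw [Real.enorm_of_nonneg (le_of_lt hp.1)]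
  rw [← integral_indicator measurableSet_ball, ← Complex.integral_comp_polarCoord_symm]
  simp only [smul_eq_mul]
  change ∫ p in Ioi (0 : ℝ) ×ˢ Ioo (-Real.pi) Real.pi, p.1 * f (Complex.polarCoord.symm p)
    ∂(volume.prod volume) = _
  rw [setIntegral_prod _ hint]
  have e : ∀ r ∈ Ioi (0 : ℝ), ∫ θ in Ioo (-Real.pi) Real.pi, r * f (Complex.polarCoord.symm (r, θ))
      = (Ioo (0 : ℝ) R).indicator (fun r => 2 * Real.pi * (r * Real.log (max r ‖a‖))) r := fun r hr => by
    have hr' : 0 < r := hr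
    rw [integral_const_mul]
    by_cases h : r < R
    · rw [indicator_of_mem (show r ∈ Ioo 0 R from ⟨hr', h⟩), mul_left_comm (2 * Real.pi),
        ← integral_circle_log hr']
      congr 1
      refine integral_congr_ae (Eventually.of_forall fun θ => ?_)
      simp only [hf]
      rw [indicator_of_mem]
      rw [Metric.mem_ball, dist_zero_right, Complex.norm_polarCoord_symm, abs_of_pos hr']
      exact h
    · rw [indicator_of_notMem (fun h' => h h'.2)]
      have : ∀ θ : ℝ, f (Complex.polarCoord.symm (r, θ)) = 0 := fun θ => by
        simp only [hf]
        rw [indicator_of_notMem]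
        rw [Metric.mem_ball, dist_zero_right, Complex.norm_polarCoord_symm, abs_of_pos hr']
        exact h
      simp only [this, integral_zero, mul_zero]
  rw [setIntegral_congr_fun measurableSet_Ioi e, setIntegral_indicator measurableSet_Ioo,
    inter_eq_self_of_subset_right Ioo_subset_Ioi_self, integral_const_mul,
    intervalIntegral.integral_of_le hR.le, integral_Ioc_eq_integral_Ioo]

theorem integral_mul_log_max {R ρ : ℝ} (hρ : 0 < ρ) (h : ρ ≤ R) :
    ∫ r in (0 : ℝ)..R, r * Real.log (max r ρ) = R ^ 2 / 2 * Real.log R - R ^ 2 / 4 + ρ ^ 2 / 4 := by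
  have hc : Continuous fun r : ℝ => r * Real.log (max r ρ) :=
    continuous_id.mul ((continuous_id.max continuous_const).log fun r => (hρ.trans_le (le_max_right _ _)).ne')
  rw [← intervalIntegral.integral_add_adjacent_intervals (hc.intervalIntegrable 0 ρ)
    (hc.intervalIntegrable ρ R)]
  have h1 : ∫ r in (0 : ℝ)..ρ, r * Real.log (max r ρ) = ρ ^ 2 / 2 * Real.log ρ := by
    rw [intervalIntegral.integral_congr (g := fun r => r * Real.log ρ),
      intervalIntegral.integral_mul_const, integral_id]
    · ring
    · intro r hr
      rw [uIcc_of_le hρ.le] at hr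
      simp only [max_eq_right hr.2]
  have h2 : ∫ r in ρ..R, r * Real.log (max r ρ)
      = (R ^ 2 / 2 * Real.log R - R ^ 2 / 4) - (ρ ^ 2 / 2 * Real.log ρ - ρ ^ 2 / 4) := by
    refine intervalIntegral.integral_eq_sub_of_hasDerivAt
      (f := fun r => r ^ 2 / 2 * Real.log r - r ^ 2 / 4) (fun r hr => ?_) (hc.intervalIntegrable _ _)
    rw [uIcc_of_le h] at hr
    have hr0 : r ≠ 0 := (hρ.trans_le hr.1).ne'
    rw [max_eq_left hr.1]
    have h3 := ((((hasDerivAt_id r).pow 2).div_const 2).mul (Real.hasDerivAt_log hr0)).sub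
      (((hasDerivAt_id r).pow 2).div_const 4)
    refine h3.congr_deriv ?_
    simp
    field_simp
    ring
  rw [h1, h2]
  ring

theorem integral_mul_log_max_of_le {R ρ : ℝ} (hR : 0 < R) (h : R ≤ ρ) :
    ∫ r in (0 : ℝ)..R, r * Real.log (max r ρ) = R ^ 2 / 2 * Real.log ρ := by
  rw [intervalIntegral.integral_congr (g := fun r => r * Real.log ρ),
    intervalIntegral.integral_mul_const, integral_id]
  · ring
  · intro r hr
    rw [uIcc_of_le hR.le] at hr
    simp only [max_eq_right (hr.2.trans h)]

/-- Identify the plane isometrically with `ℂ` and use polar coordinates. -/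
theorem coulomb_eq_integral {R : ℝ} (hR : 0 < R) (x : Plane) :
    coulomb R x = 2 / R ^ 2 * ∫ r in (0 : ℝ)..R, r * Real.log (max r ‖x‖) := by
  set e := Complex.orthonormalBasisOneI.repr with he
  have h1 : ∫ y in Metric.ball (0 : Plane) R, Real.log ‖x - y‖
      = ∫ z in Metric.ball (0 : ℂ) R, Real.log ‖z - e.symm x‖ := by
    have h2 := (LinearIsometryEquiv.measurePreserving e).setIntegral_preimage_emb
      e.toHomeomorph.measurableEmbedding (fun y => Real.log ‖x - y‖) (Metric.ball 0 R)
    rw [← h2]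
    have h3 : e ⁻¹' Metric.ball 0 R = Metric.ball 0 R := by
      ext z; simp [Metric.mem_ball]
    rw [h3]
    refine integral_congr_ae (Eventually.of_forall fun z => ?_)
    simp only
    rw [norm_sub_rev, ← e.symm.norm_map, map_sub, e.symm_apply_apply]
  rw [coulomb, if_neg hR.ne', h1, integral_ball_log hR, e.symm.norm_map]
  have := Real.pi_pos
  field_simp

/-- **Newton's theorem**, outside of the disc. -/
theorem coulomb_of_le {R : ℝ} (hR : 0 ≤ R) {x : Plane} (h : R ≤ ‖x‖) : coulomb R x = Real.log ‖x‖ := by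
  rcases hR.eq_or_lt with h0 | h0
  · rw [coulomb, if_pos h0.symm]
  · rw [coulomb_eq_integral h0, integral_mul_log_max_of_le h0 h]
    field_simp

theorem coulomb_of_lt {R : ℝ} {x : Plane} (hx : x ≠ 0) (h : ‖x‖ < R) :
    coulomb R x = Real.log R - 1 / 2 + ‖x‖ ^ 2 / (2 * R ^ 2) := by
  have hx0 : 0 < ‖x‖ := norm_pos_iff.2 hx
  have h0 : 0 < R := hx0.trans h
  rw [coulomb_eq_integral h0, integral_mul_log_max hx0 h.le]
  field_simp
  ring

theorem hasGradientAt_norm_sq {F : ℝ → ℝ} {c : ℝ} {x : Plane} (hF : HasDerivAt F c (‖x‖ ^ 2)) :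
    HasGradientAt (fun z : Plane => F (‖z‖ ^ 2)) ((2 * c) • x) x := by
  rw [hasGradientAt_iff_hasFDerivAt]
  have h := hF.comp_hasFDerivAt x (hasStrictFDerivAt_norm_sq x).hasFDerivAt
  refine h.congr_fderiv ?_
  ext v
  simp
  ring

/-- The potential is `log |x|` outside the disc and `|x|²/(2R²)` plus a constant inside, so its
gradient is `x / max(|x|², R²)`. The origin and the circle `|x| = R` form a null set, which no
convolution sees. -/
theorem gradPerp_eq {R : ℝ} (hR : 0 ≤ R) {x : Plane} (hx : x ≠ 0) (hxR : ‖x‖ ≠ R) (j : Fin 2) :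
    gradPerp R x j = kern R j x := by
  have hx0 : 0 < ‖x‖ := norm_pos_iff.2 hx
  have key : gradient (coulomb R) x = (max (‖x‖ ^ 2) (R ^ 2))⁻¹ • x := by
    rcases lt_or_gt_of_ne hxR with h | h
    · have h1 : HasDerivAt (fun s : ℝ => Real.log R - 1 / 2 + s / (2 * R ^ 2)) (1 / (2 * R ^ 2)) (‖x‖ ^ 2) :=
        ((hasDerivAt_id _).div_const _).const_add _
      have h2 := (hasGradientAt_norm_sq h1).congr_of_eventuallyEq (f₁ := coulomb R) (by
        filter_upwards [isOpen_ne.mem_nhds hx, (isOpen_lt continuous_norm continuous_const).mem_nhds h]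
          with z hz hzR
        exact coulomb_of_lt hz hzR)
      rw [h2.gradient, max_eq_right (by gcongr)]
      congr 1
      have : R ≠ 0 := (hx0.trans h).ne'
      field_simp
    · have h1 : HasDerivAt (fun s : ℝ => 1 / 2 * Real.log s) (1 / 2 * (‖x‖ ^ 2)⁻¹) (‖x‖ ^ 2) :=
        (Real.hasDerivAt_log (by positivity)).const_mul _
      have h2 := (hasGradientAt_norm_sq h1).congr_of_eventuallyEq (f₁ := coulomb R) (by
        filter_upwards [(isOpen_lt continuous_const continuous_norm).mem_nhds h] with z hz
        rw [coulomb_of_le hR (le_of_lt hz), Real.log_pow]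
        push_cast
        ring)
      rw [h2.gradient, max_eq_left (by gcongr)]
      congr 1
      ring
  rw [gradPerp, key, kern]
  fin_cases j <;> simp [perp, mul_comm]

theorem gradPerp_ae {R : ℝ} (hR : 0 ≤ R) (y : Plane) :
    ∀ᵐ x : Plane, ∀ j, gradPerp R (y - x) j = kern R j (y - x) := by
  have h1 : volume (Metric.sphere y R : Set Plane) = 0 := Measure.addHaar_sphere _ _ _
  have h2 : volume ({y} : Set Plane) = 0 := measure_singleton _
  filter_upwards [compl_mem_ae_iff.2 h1, compl_mem_ae_iff.2 h2] with x hx hxy j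
  refine gradPerp_eq hR (fun h => hxy ?_) (fun h => hx ?_) j
  · rw [mem_singleton_iff, ← sub_eq_zero, ← neg_sub, h, neg_zero]
  · rw [mem_sphere_iff_norm, norm_sub_rev]; exact h

end

end CSS

open MeasureTheory Complex Filter Topology Set FourierTransform
open scoped LineDeriv SchwartzMap ComplexConjugate ENNReal

namespace CSS

noncomputable section

/-! ### The equation in terms of the Hamiltonian -/

theorem gaugeField_eq {R : ℝ} (hR : 0 ≤ R) (f : L2) (y : Plane) (j : Fin 2) :
    gaugeField R (S f) y j = Apot R f j y := by
  have hi : ∀ j, Integrable fun x => ‖S f x‖ ^ 2 * kern R j (y - x) := fun j => by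
    have h := ((subCoulomb_kern R j).integrable (hasPot_dens (hardy_S_le f)) y).re
    refine h.congr (Eventually.of_forall fun x => ?_)
    simp only
    rw [← ofReal_pow, ← ofReal_mul, RCLike.re_eq_complex_re, ofReal_re, mul_comm]
  have e : gaugeField R (S f) y
      = ∫ x, ((‖S f x‖ ^ 2 * kern R 0 (y - x)) • basisVec 0 + (‖S f x‖ ^ 2 * kern R 1 (y - x)) • basisVec 1) := by
    refine integral_congr_ae ?_
    filter_upwards [gradPerp_ae hR y] with x hx
    ext k
    fin_cases k
    · simp [basisVec, ← hx 0]
    · simp [basisVec, ← hx 1]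
  rw [e, integral_add ((hi 0).smul_const _) ((hi 1).smul_const _), integral_smul_const,
    integral_smul_const]
  fin_cases j <;> simp [basisVec, Apot]

theorem scalarPotential_eq (β : ℝ) {R : ℝ} (hR : 0 ≤ R) (f : L2) (y : Plane) :
    scalarPotential β R (S f) y = Vpot β R f y := by
  have hs : ∀ j x, 2 * β * (gaugeField R (S f) x j : ℂ) * (‖S f x‖ : ℂ) ^ 2 + current (S f) j x
      = src β R f j x := fun j x => by
    rw [gaugeField_eq hR, current, weakDeriv_S, src, curr]
  simp only [scalarPotential, hs, Vpot, cv]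
  rw [← integral_finsetSum _ fun j _ => (subCoulomb_kern R j).integrable
    (hasPot_src β R (hardy_S_le f) j (hardy_D_le j f)) y]
  refine integral_congr_ae ?_
  filter_upwards [gradPerp_ae hR y] with x hx
  simp only [hx]

theorem isH1_schwartz (ψ : 𝓢(Plane, ℂ)) :
    IsH1 (ψ.toLp 2) fun j => (∂_{basisVec j} ψ).toLp 2 :=
  ⟨fun _ => ψ, tendsto_const_nhds, fun _ => tendsto_const_nhds⟩

theorem exists_schwartz_conj (ψ : 𝓢(Plane, ℂ)) : ∃ χ : 𝓢(Plane, ℂ), (∀ x, χ x = conj (ψ x)) ∧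
    ∀ j x, (∂_{basisVec j} χ) x = conj ((∂_{basisVec j} ψ) x) := by
  refine ⟨ψ.postcompCLM (conjCLE : ℂ →L[ℝ] ℂ), fun x => ?_, fun j x => ?_⟩
  · rw [SchwartzMap.postcompCLM_apply]; rfl
  · rw [SchwartzMap.lineDerivOp_apply_eq_fderiv, SchwartzMap.lineDerivOp_apply_eq_fderiv]
    have h := conjCLE.hasFDerivAt.comp x (ψ.differentiableAt (x := x)).hasFDerivAt
    have e : (⇑(ψ.postcompCLM (conjCLE : ℂ →L[ℝ] ℂ)) : Plane → ℂ) = conjCLE ∘ ψ := by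
      funext z; rw [SchwartzMap.postcompCLM_apply]; rfl
    rw [e, h.fderiv]
    rfl

/-- The weak form of `div (A u) = A·∇u`, tested against Schwartz functions. Distributions pair
bilinearly and the inner product is sesquilinear, hence the conjugate `χ` of the test function. -/
theorem sum_distDeriv_Apot (R : ℝ) (f g : L2) :
    ∑ j, distDeriv j (mulOp (fun x => (Apot R f j x : ℂ)) (S g))
      = ((∑ j, mulOp (fun x => (Apot R f j x : ℂ)) (D j g) : L2) : 𝓢'(Plane, ℂ)) := by
  ext ψ
  obtain ⟨χ, hχ, hχd⟩ := exists_schwartz_conj ψ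
  have hH1 := isH1_schwartz χ
  have hh := hardy hH1
  have hhd := fun k => hardy (isH1_schwartz (∂_{basisVec k} χ))
  set B := max (Real.sqrt (2 * ‖((∂_{basisVec 0} χ).toLp 2 : L2)‖ * ∑ j, ‖((∂_{basisVec j} (∂_{basisVec 0} χ)).toLp 2 : L2)‖))
    (Real.sqrt (2 * ‖((∂_{basisVec 1} χ).toLp 2 : L2)‖ * ∑ j, ‖((∂_{basisVec j} (∂_{basisVec 1} χ)).toLp 2 : L2)‖))
    with hB
  have hhB : ∀ j, HasHardy ((∂_{basisVec j} χ).toLp 2 : L2) B := fun j => by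
    fin_cases j
    · exact (hhd 0).mono (le_max_left _ _)
    · exact (hhd 1).mono (le_max_right _ _)
  have h := sum_inner_Apot R f hH1 (isH1_S g)
    (hasPot_pair hh (hardy_S_le g) hhB fun j => hardy_D_le j g)
  have e1 : ∀ (ξ η : 𝓢(Plane, ℂ)) (w : L2), (∀ x, η x = conj (ξ x)) →
      (w : 𝓢'(Plane, ℂ)) η = inner ℂ (ξ.toLp 2 : L2) w := fun ξ η w hξ => by
    rw [Lp.toTemperedDistribution_apply, L2.inner_def]
    refine integral_congr_ae ?_
    filter_upwards [ξ.coeFn_toLp 2] with x hx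
    rw [hx, RCLike.inner_apply, smul_eq_mul, hξ, mul_comm]
  have hψ : ∀ x, ψ x = conj (χ x) := fun x => by rw [hχ, conj_conj]
  have hψd : ∀ j x, (∂_{basisVec j} ψ) x = conj ((∂_{basisVec j} χ) x) := fun j x => by
    rw [hχd, conj_conj]
  rw [e1 χ ψ _ hψ, inner_sum]
  have e2 : ∀ j, distDeriv j (mulOp (fun x => (Apot R f j x : ℂ)) (S g)) ψ
      = -inner ℂ ((∂_{basisVec j} χ).toLp 2 : L2) (mulOp (fun x => (Apot R f j x : ℂ)) (S g)) := fun j => by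
    rw [distDeriv, TemperedDistribution.lineDerivOp_apply_apply, map_neg]
    change -((mulOp (fun x => (Apot R f j x : ℂ)) (S g) : L2) : 𝓢'(Plane, ℂ)) (∂_{basisVec j} ψ) = _
    rw [e1 _ _ _ (hψd j)]
  rw [Finset.sum_add_distrib] at h
  rw [Fin.sum_univ_two, add_apply, e2, e2, Fin.sum_univ_two]
  rw [Fin.sum_univ_two, Fin.sum_univ_two] at h
  linear_combination -h

theorem toTD_add (f g : L2) : ((f + g : L2) : 𝓢'(Plane, ℂ)) = (f : 𝓢'(Plane, ℂ)) + g :=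
  map_add (Lp.toTemperedDistributionCLM ℂ (volume : Measure Plane) 2) f g

theorem toTD_smul (c : ℂ) (f : L2) : ((c • f : L2) : 𝓢'(Plane, ℂ)) = c • (f : 𝓢'(Plane, ℂ)) :=
  map_smul (Lp.toTemperedDistributionCLM ℂ (volume : Measure Plane) 2) c f

theorem toTD_sum (f : Fin 2 → L2) : ((∑ j, f j : L2) : 𝓢'(Plane, ℂ)) = ∑ j, (f j : 𝓢'(Plane, ℂ)) :=
  map_sum (Lp.toTemperedDistributionCLM ℂ (volume : Measure Plane) 2) f Finset.univ

theorem distDeriv_add (j : Fin 2) (f g : L2) : distDeriv j (f + g) = distDeriv j f + distDeriv j g := by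
  simp only [distDeriv, toTD_add, LineDeriv.lineDerivOp_add]

theorem distDeriv_smul (j : Fin 2) (c : ℂ) (f : L2) : distDeriv j (c • f) = c • distDeriv j f := by
  simp only [distDeriv, toTD_smul, LineDeriv.lineDerivOp_smul]

theorem memLp_Vpot (β R : ℝ) (f : L2) : MemLp (Vpot β R f) ∞ (volume : Measure Plane) :=
  memLp_top_of_bound (meas_Vpot β R f) _
    (Eventually.of_forall fun x => norm_Vpot_le β R (hardy_S_le f) (fun j => hardy_D_le j f) x)

/-- The covariant derivative of `S f`. -/
def covD (β R : ℝ) (f : L2) (j : Fin 2) : L2 :=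
  (-I) • D j f + (β : ℂ) • mulOp (fun x => (Apot R f j x : ℂ)) (S f)

/-- The terms without an outer derivative. -/
def lowerOrder (β R : ℝ) (f : L2) : L2 :=
  (β : ℂ) • ∑ j, mulOp (fun x => (Apot R f j x : ℂ)) (covD β R f j) + (-β : ℂ) • mulOp (Vpot β R f) (S f)

theorem mulOp_Wpot (β R : ℝ) (f g : L2) : mulOp (Wpot β R f) g
    = (β : ℂ) ^ 2 • ∑ j, mulOp (fun x => (Apot R f j x : ℂ)) (mulOp (fun x => (Apot R f j x : ℂ)) g)
      + (-β : ℂ) • mulOp (Vpot β R f) g := by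
  rw [Fin.sum_univ_two]
  set A0 := mulOp (fun x => (Apot R f 0 x : ℂ)) with hA0
  set A1 := mulOp (fun x => (Apot R f 1 x : ℂ)) with hA1
  ext1
  filter_upwards [mulOp_ae (memLp_Wpot β R f) g, mulOp_ae (memLp_Vpot β R f) g,
    mulOp_ae (memLp_Apot_one R f 0) (A0 g), mulOp_ae (memLp_Apot_one R f 1) (A1 g),
    mulOp_ae (memLp_Apot_one R f 0) g, mulOp_ae (memLp_Apot_one R f 1) g,
    Lp.coeFn_add ((β : ℂ) ^ 2 • (A0 (A0 g) + A1 (A1 g))) ((-β : ℂ) • mulOp (Vpot β R f) g),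
    Lp.coeFn_smul ((β : ℂ) ^ 2) (A0 (A0 g) + A1 (A1 g)), Lp.coeFn_add (A0 (A0 g)) (A1 (A1 g)),
    Lp.coeFn_smul (-β : ℂ) (mulOp (Vpot β R f) g)] with x h1 h2 h3 h4 h5 h6 h7 h8 h9 h10
  rw [h7, Pi.add_apply, h8, h10, Pi.smul_apply, Pi.smul_apply, h9, Pi.add_apply, h1, h2, h3, h4, h5, h6,
    Wpot, Fin.sum_univ_two, smul_eq_mul, smul_eq_mul]
  ring

/-- Expanding the magnetic square, the first order term `-iβ A·∇` appears once from the outer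
derivative, by `div A = 0`, and once from `A` times the covariant derivative. Together they give the
coefficient `-2iβ` of `pert`. -/
theorem ham_toTemperedDistribution (β R : ℝ) (f : L2) : (ham β R f f : 𝓢'(Plane, ℂ))
    = ∑ j, (-I) • distDeriv j (covD β R f j) + (lowerOrder β R f : 𝓢'(Plane, ℂ)) := by
  have h1 : ∑ j, (-I) • distDeriv j (covD β R f j)
      = ((-(∑ j, DD j j f) + (-I * β : ℂ) • ∑ j, mulOp (fun x => (Apot R f j x : ℂ)) (D j f) : L2) :
        𝓢'(Plane, ℂ)) := by
    have h2 : ∀ j, (-I) • distDeriv j (covD β R f j) = (-1 : ℂ) • (DD j j f : 𝓢'(Plane, ℂ))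
        + (-I * β : ℂ) • distDeriv j (mulOp (fun x => (Apot R f j x : ℂ)) (S f)) := fun j => by
      rw [covD, distDeriv_add, distDeriv_smul, distDeriv_smul, distDeriv_D, smul_add, smul_smul, smul_smul,
        neg_mul_neg, I_mul_I]
    simp only [h2, Finset.sum_add_distrib, ← Finset.smul_sum, sum_distDeriv_Apot]
    rw [toTD_add, toTD_smul, ← neg_one_smul ℂ (∑ j, DD j j f), toTD_smul, toTD_sum (fun j => DD j j f)]
  rw [h1, ← toTD_add, ham_apply, pert_apply, sum_DD, mulOp_Wpot, lowerOrder]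
  congr 1
  simp only [covD, map_add, map_smul, Fin.sum_univ_two]
  module

theorem covD_ae {β R : ℝ} (hR : 0 ≤ R) (f : L2) (j : Fin 2) : ∀ᵐ x : Plane, covD β R f j x
    = -I * weakDeriv j (S f) x + β * (gaugeField R (S f) x j : ℂ) * S f x := by
  filter_upwards [Lp.coeFn_add ((-I) • D j f) ((β : ℂ) • mulOp (fun x => (Apot R f j x : ℂ)) (S f)),
    Lp.coeFn_smul (-I) (D j f), Lp.coeFn_smul (β : ℂ) (mulOp (fun x => (Apot R f j x : ℂ)) (S f)),
    mulOp_ae (memLp_Apot_one R f j) (S f)] with x h1 h2 h3 h4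
  rw [covD, h1, Pi.add_apply, h2, h3, Pi.smul_apply, Pi.smul_apply, h4, weakDeriv_S, gaugeField_eq hR,
    smul_eq_mul, smul_eq_mul]
  ring

theorem lowerOrder_ae {β R : ℝ} (hR : 0 ≤ R) (f : L2) : ∀ᵐ x : Plane, lowerOrder β R f x
    = ∑ j, β * (gaugeField R (S f) x j : ℂ) * covD β R f j x
      - β * scalarPotential β R (S f) x * S f x := by
  rw [lowerOrder, Fin.sum_univ_two]
  set B0 := mulOp (fun x => (Apot R f 0 x : ℂ)) (covD β R f 0) with hB0
  set B1 := mulOp (fun x => (Apot R f 1 x : ℂ)) (covD β R f 1) with hB1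
  filter_upwards [Lp.coeFn_add ((β : ℂ) • (B0 + B1)) ((-β : ℂ) • mulOp (Vpot β R f) (S f)),
    Lp.coeFn_smul (β : ℂ) (B0 + B1), Lp.coeFn_smul (-β : ℂ) (mulOp (Vpot β R f) (S f)),
    Lp.coeFn_add B0 B1, mulOp_ae (memLp_Apot_one R f 0) (covD β R f 0),
    mulOp_ae (memLp_Apot_one R f 1) (covD β R f 1), mulOp_ae (memLp_Vpot β R f) (S f)]
    with x h1 h2 h3 h4 h5 h6 h7
  rw [h1, Pi.add_apply, h2, h3, Pi.smul_apply, Pi.smul_apply, h4, Pi.add_apply, h5, h6, h7,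
    scalarPotential_eq β hR, Fin.sum_univ_two, gaugeField_eq hR, gaugeField_eq hR, smul_eq_mul, smul_eq_mul]
  ring

/-- The auxiliary fields of `IsRHS` are determined almost everywhere, and `L²` embeds injectively
into distributions, so the right-hand side is unique. -/
theorem isRHS_iff {β R : ℝ} (hR : 0 ≤ R) (f F : L2) : IsRHS β R (S f) F ↔ F = ham β R f f := by
  constructor
  · rintro ⟨E, N, hE, hN, hF⟩
    have h1 : ∀ j, E j = covD β R f j := fun j => by
      ext1
      filter_upwards [hE j, covD_ae hR f j] with x h1 h2
      rw [h1, h2]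
    have h2 : N = lowerOrder β R f := by
      ext1
      filter_upwards [hN, lowerOrder_ae hR f] with x h3 h4
      rw [h3, h4]
      simp only [h1]
    apply toTemperedDistribution_injective
    simp only
    rw [hF, ham_toTemperedDistribution, h2]
    simp only [h1]
  · rintro rfl
    exact ⟨covD β R f, lowerOrder β R f, covD_ae hR f, lowerOrder_ae hR f,
      ham_toTemperedDistribution β R f⟩

end

end CSS

open MeasureTheory Complex Filter Topology Set FourierTransform
open scoped LineDeriv SchwartzMap ComplexConjugate ENNReal

namespace CSS

noncomputable section

/-! ### Sobolev norms -/

theorem h2Norm_S (g : L2) : h2Norm (S g)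
    = Real.sqrt (‖S g‖ ^ 2 + ∑ j, ‖D j g‖ ^ 2 + ∑ j, ∑ k, ‖DD j k g‖ ^ 2) := by
  simp only [h2Norm, weakDeriv_S, weakDeriv_D]

theorem h2Norm_S_le (g : L2) : h2Norm (S g) ≤ 100 * ‖g‖ := by
  rw [h2Norm_S]
  refine Real.sqrt_le_iff.2 ⟨by positivity, ?_⟩
  have h0 := pow_le_pow_left₀ (norm_nonneg _) (norm_S_le g) 2
  have h1 := fun j => pow_le_pow_left₀ (norm_nonneg _) (norm_D_le j g) 2
  have h2 := fun j k => pow_le_pow_left₀ (norm_nonneg _) (norm_DD_le j k g) 2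
  simp only [Fin.sum_univ_two]
  have hπ := Real.pi_lt_d2
  have hπ0 := Real.pi_pos
  have h3 : Real.pi ^ 2 ≤ 3.15 ^ 2 := by gcongr
  have h4 : Real.pi ^ 4 ≤ 3.15 ^ 4 := by gcongr
  have h5 := mul_le_mul_of_nonneg_right h3 (sq_nonneg ‖g‖)
  have h6 := mul_le_mul_of_nonneg_right h4 (sq_nonneg ‖g‖)
  have e1 := h1 0
  have e2 := h1 1
  have e3 := h2 0 0
  have e4 := h2 0 1
  have e5 := h2 1 0
  have e6 := h2 1 1
  have a1 : (2 * Real.pi * ‖g‖) ^ 2 = 4 * (Real.pi ^ 2 * ‖g‖ ^ 2) := by ring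
  have a2 : (4 * Real.pi ^ 2 * ‖g‖) ^ 2 = 16 * (Real.pi ^ 4 * ‖g‖ ^ 2) := by ring
  have a3 : (100 * ‖g‖) ^ 2 = 10000 * ‖g‖ ^ 2 := by ring
  rw [a1] at e1 e2
  rw [a2] at e3 e4 e5 e6
  rw [a3]
  nlinarith [sq_nonneg ‖g‖]

/-- Together with `h2Norm_S_le`, this makes continuity of `S g` in `H²` the same as continuity of
`g` in `L²`. -/
theorem norm_le_h2Norm (g : L2) : ‖g‖ ≤ 2 * h2Norm (S g) := by
  have h1 := norm_le_lapNorm g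
  have hD : 0 ≤ ∑ j, ‖D j g‖ ^ 2 := Finset.sum_nonneg fun _ _ => sq_nonneg _
  have h2 : ‖S g‖ ≤ h2Norm (S g) := by
    rw [h2Norm_S, sum_norm_DD_sq]
    exact Real.le_sqrt_of_sq_le (by nlinarith [sq_nonneg (lapNorm g)])
  have h3 : lapNorm g ≤ h2Norm (S g) := by
    rw [h2Norm_S, sum_norm_DD_sq]
    exact Real.le_sqrt_of_sq_le (by nlinarith [sq_nonneg ‖S g‖])
  linarith [lapNorm_nonneg g]

theorem norm_le_h1Norm (f : L2) : ‖f‖ ≤ h1Norm f :=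
  Real.le_sqrt_of_sq_le (le_add_of_nonneg_right (Finset.sum_nonneg fun _ _ => sq_nonneg _))

/-! ### The embedding of `H²` in `L^∞` -/

theorem memLp_bessel_two : MemLp bessel 2 (volume : Measure Plane) := by
  refine (memLp_two_iff_integrable_sq_norm memLp_bessel.1).2 ?_
  have h := integrable_rpow_neg_one_add_norm_sq (μ := (volume : Measure Plane)) (r := 4)
    (by rw [finrank_euclideanSpace_fin]; norm_num)
  refine h.congr (Eventually.of_forall fun x => ?_)
  simp only
  rw [norm_bessel, show (-4 / 2 : ℝ) = -((2 : ℕ) : ℝ) by norm_num, Real.rpow_neg (by positivity),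
    Real.rpow_natCast, inv_pow]

/-- The symbol `bessel` is square integrable in two dimensions, so by Cauchy-Schwarz and Plancherel
the Fourier transform of `S φ` is integrable with norm at most `‖b‖ ‖φ‖`. An almost everywhere
convergent subsequence extends the bound from Schwartz functions. -/
theorem exists_sup_bound : ∃ C : ℝ, 0 ≤ C ∧ ∀ f : L2, ∀ᵐ x, ‖S f x‖ ≤ C * ‖f‖ := by
  set b : L2 := memLp_bessel_two.toLp bessel with hb
  have hS : ∀ φ : 𝓢(Plane, ℂ), ∀ᵐ x, ‖S (φ.toLp 2) x‖ ≤ ‖b‖ * ‖(φ.toLp 2 : L2)‖ := fun φ => by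
    rw [S, fmul_toLp memLp_bessel hasTemperateGrowth_bessel]
    filter_upwards [(SchwartzMap.fourierMultiplierCLM ℂ bessel φ).coeFn_toLp 2] with x hx
    rw [hx, SchwartzMap.fourierMultiplierCLM_apply, SchwartzMap.fourierInv_coe]
    have h1 : ‖𝓕⁻ (⇑(SchwartzMap.smulLeftCLM ℂ bessel (𝓕 φ))) x‖
        ≤ ∫ ξ, ‖SchwartzMap.smulLeftCLM ℂ bessel (𝓕 φ) ξ‖ :=
      VectorFourier.norm_fourierIntegral_le_integral_norm _ _ _ _ _
    refine h1.trans ?_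
    have h2 : ∫ ξ, ‖SchwartzMap.smulLeftCLM ℂ bessel (𝓕 φ) ξ‖ = ∫ ξ, ‖b ξ‖ * ‖((𝓕 φ).toLp 2 : L2) ξ‖ := by
      refine integral_congr_ae ?_
      filter_upwards [memLp_bessel_two.coeFn_toLp, (𝓕 φ).coeFn_toLp 2] with ξ h1 h2
      rw [SchwartzMap.smulLeftCLM_apply_apply hasTemperateGrowth_bessel, norm_smul, hb, h1, h2]
    have h3 : ‖((𝓕 φ).toLp 2 : L2)‖ = ‖(φ.toLp 2 : L2)‖ := SchwartzMap.norm_fourier_toL2_eq φ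
    rw [h2, ← h3]
    have h4 := integral_mul_norm_le_Lp_mul_Lq (μ := (volume : Measure Plane)) (f := b)
      (g := ((𝓕 φ).toLp 2 : L2)) Real.HolderConjugate.two_two (by simpa using Lp.memLp b)
      (by simpa using Lp.memLp ((𝓕 φ).toLp 2 : L2))
    refine h4.trans (le_of_eq ?_)
    have h5 : ∀ g : L2, (∫ ξ, ‖g ξ‖ ^ (2 : ℝ)) ^ ((1 : ℝ) / 2) = ‖g‖ := fun g => by
      rw [Lp.norm_def, (Lp.memLp g).eLpNorm_eq_integral_rpow_norm (by norm_num) (by norm_num),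
        ENNReal.toReal_ofReal (by positivity)]
      simp
    rw [h5, h5]
  refine ⟨‖b‖, norm_nonneg _, fun f => ?_⟩
  obtain ⟨φ, hφ⟩ := exists_schwartz_seq f
  have h1 : Tendsto (fun n => S ((φ n).toLp 2)) atTop (𝓝 (S f)) := (S.continuous.tendsto f).comp hφ
  obtain ⟨ns, hns, hlim⟩ := (tendstoInMeasure_of_tendsto_Lp h1).exists_seq_tendsto_ae
  have h2 : Tendsto (fun n => ‖b‖ * ‖((φ (ns n)).toLp 2 : L2)‖) atTop (𝓝 (‖b‖ * ‖f‖)) :=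
    ((hφ.comp hns.tendsto_atTop).norm).const_mul _
  filter_upwards [hlim, ae_all_iff.2 fun n => hS (φ (ns n))] with x hx hb
  exact le_of_tendsto_of_tendsto hx.norm h2 (Eventually.of_forall hb)

/-! ### Short range kernels -/

/-- The weight `1_{|x - y| < R} / |x - y|`. -/
def near (R : ℝ) (t : ℝ) : ℝ := (Iio R).indicator (fun t => t⁻¹) t

theorem near_nonneg (R : ℝ) {t : ℝ} (ht : 0 ≤ t) : 0 ≤ near R t := by
  by_cases h : t ∈ Iio R
  · rw [near, indicator_of_mem h]; positivity
  · rw [near, indicator_of_notMem h]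

theorem measurable_near (R : ℝ) : Measurable (near R) := by
  unfold near
  exact measurable_inv.indicator measurableSet_Iio

/-- In polar coordinates the Jacobian `r` cancels the singularity. The first power of `R` obtained
here becomes the rate of convergence. -/
theorem lintegral_near {R : ℝ} (hR : 0 ≤ R) (y : Plane) :
    ∫⁻ x, ENNReal.ofReal (near R ‖x - y‖) = ENNReal.ofReal (2 * Real.pi * R) := by
  have e : ∀ t ∈ Ioi (0 : ℝ), t ^ (Module.finrank ℝ Plane - 1) • near R t = (Ioo 0 R).indicator (fun _ => 1) t := by
    intro t ht
    have ht0 : t ≠ 0 := (mem_Ioi.1 ht).ne'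
    rw [finrank_euclideanSpace_fin]
    by_cases h : t < R
    · rw [near, indicator_of_mem (show t ∈ Iio R from h), indicator_of_mem (show t ∈ Ioo 0 R from ⟨ht, h⟩)]
      simp [ht0]
    · rw [near, indicator_of_notMem (by simpa using h), indicator_of_notMem (fun h' => h h'.2), smul_zero]
  have hi : Integrable (fun x : Plane => near R ‖x‖) := by
    rw [integrable_fun_norm_addHaar, integrableOn_congr_fun e measurableSet_Ioi]
    exact ((integrable_indicator_iff measurableSet_Ioo).2
      (integrableOn_const (by simp))).integrableOn
  rw [lintegral_sub_right_eq_self (fun x => ENNReal.ofReal (near R ‖x‖)),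
    ← ofReal_integral_eq_lintegral_ofReal hi
      (Eventually.of_forall fun x => near_nonneg R (norm_nonneg x)), integral_fun_norm_addHaar,
    setIntegral_congr_fun measurableSet_Ioi e, setIntegral_indicator measurableSet_Ioo,
    inter_eq_self_of_subset_right Ioo_subset_Ioi_self]
  congr 1
  have hv : (volume : Measure Plane).real (Metric.ball 0 1) = Real.pi := by
    rw [Measure.real, EuclideanSpace.volume_ball_fin_two]
    simp [Real.pi_nonneg]
  rw [hv, finrank_euclideanSpace_fin]
  simp [hR]
  ring

/-- A measurable kernel dominated by `1_{|x| < R} / |x|`. -/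
structure ShortRange (k : Plane → ℝ) (R : ℝ) : Prop where
  meas : Measurable k
  bound : ∀ x, |k x| ≤ near R ‖x‖

theorem ShortRange.subCoulomb {k : Plane → ℝ} {R : ℝ} (hk : ShortRange k R) : SubCoulomb k := by
  refine ⟨hk.meas, fun x => (hk.bound x).trans ?_⟩
  by_cases h : ‖x‖ ∈ Iio R
  · rw [near, indicator_of_mem h]
  · rw [near, indicator_of_notMem h]; positivity

theorem ShortRange.enorm_cv_le {k : Plane → ℝ} {R : ℝ} (hk : ShortRange k R) (ρ : Plane → ℂ) (y : Plane) :
    ‖cv k ρ y‖ₑ ≤ ∫⁻ x, ‖ρ x‖ₑ * ENNReal.ofReal (near R ‖x - y‖) := by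
  refine (enorm_integral_le_lintegral_enorm _).trans (lintegral_mono fun x => ?_)
  rw [enorm_mul, mul_comm]
  gcongr
  rw [← ofReal_norm]
  refine ENNReal.ofReal_le_ofReal ?_
  rw [norm_real, Real.norm_eq_abs, norm_sub_rev]
  exact hk.bound _

theorem ShortRange.norm_cv_le {k : Plane → ℝ} {R : ℝ} (hR : 0 ≤ R) (hk : ShortRange k R)
    {ρ : Plane → ℂ} {B : ℝ} (hB : 0 ≤ B) (h : ∀ᵐ x, ‖ρ x‖ ≤ B) (y : Plane) :
    ‖cv k ρ y‖ ≤ B * (2 * Real.pi * R) := by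
  have h1 : ‖cv k ρ y‖ₑ ≤ ENNReal.ofReal (B * (2 * Real.pi * R)) := by
    refine (hk.enorm_cv_le ρ y).trans ?_
    rw [ENNReal.ofReal_mul hB, ← lintegral_near hR y, ← lintegral_const_mul' _ _ ENNReal.ofReal_ne_top]
    refine lintegral_mono_ae ?_
    filter_upwards [h] with x hx
    gcongr
    rw [← ofReal_norm]
    exact ENNReal.ofReal_le_ofReal hx
  rw [← ofReal_norm] at h1
  exact (ENNReal.ofReal_le_ofReal_iff (by positivity)).1 h1

/-- Young's inequality: Cauchy-Schwarz against a weight of total mass `2πR`, then Tonelli. -/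
theorem ShortRange.l2Le_cv {k : Plane → ℝ} {R : ℝ} (hR : 0 ≤ R) (hk : ShortRange k R)
    {ρ : Plane → ℂ} {N : ℝ} (h : L2Le ρ N) : L2Le (cv k ρ) (2 * Real.pi * R * N) := by
  have hκ : 0 ≤ 2 * Real.pi * R := by positivity
  refine ⟨mul_nonneg hκ h.nonneg, hk.subCoulomb.aestronglyMeasurable_cv h.meas, ?_⟩
  have hsq : ∀ F : Plane → ℂ, eLpNorm F 2 volume ^ 2 = ∫⁻ x, ‖F x‖ₑ ^ 2 := fun F => by
    rw [eLpNorm_eq_lintegral_rpow_enorm_toReal two_ne_zero ENNReal.ofNat_ne_top, ← ENNReal.rpow_natCast,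
      ← ENNReal.rpow_mul]
    simp
  have key : eLpNorm (cv k ρ) 2 volume ≤ ENNReal.ofReal (2 * Real.pi * R) * eLpNorm ρ 2 volume := by
    refine (ENNReal.pow_le_pow_left_iff two_ne_zero).1 ?_
    rw [mul_pow, hsq, hsq]
    have hnm := measurable_near R
    have hmeas : AEMeasurable (fun p : Plane × Plane => ‖ρ p.2‖ₑ ^ 2 * ENNReal.ofReal (near R ‖p.2 - p.1‖))
        ((volume : Measure Plane).prod volume) := by
      refine (h.meas.comp_snd.enorm.pow_const 2).mul ?_
      exact Measurable.aemeasurable (by fun_prop)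
    calc ∫⁻ y, ‖cv k ρ y‖ₑ ^ 2
        ≤ ∫⁻ y, ENNReal.ofReal (2 * Real.pi * R) * ∫⁻ x, ‖ρ x‖ₑ ^ 2 * ENNReal.ofReal (near R ‖x - y‖) := by
          refine lintegral_mono fun y => ?_
          have h1 := sq_lintegral_mul_weight_le h.meas (aestronglyMeasurable_const (b := (1 : ℂ)))
            (w := fun x => near R ‖x - y‖) (by fun_prop) fun x => near_nonneg R (norm_nonneg _)
          simp only [enorm_one, mul_one, one_pow, one_mul, lintegral_near hR y] at h1
          rw [mul_comm]
          exact (pow_le_pow_left' (hk.enorm_cv_le ρ y) 2).trans h1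
      _ = ENNReal.ofReal (2 * Real.pi * R) * ∫⁻ x, ∫⁻ y, ‖ρ x‖ₑ ^ 2 * ENNReal.ofReal (near R ‖x - y‖) := by
          rw [lintegral_const_mul' _ _ ENNReal.ofReal_ne_top, lintegral_lintegral_swap hmeas]
      _ = ENNReal.ofReal (2 * Real.pi * R) * ∫⁻ x, ‖ρ x‖ₑ ^ 2 * ENNReal.ofReal (2 * Real.pi * R) := by
          congr 1
          refine lintegral_congr fun x => ?_
          rw [lintegral_const_mul' _ _ (by finiteness), ← lintegral_near hR x]
          simp only [norm_sub_rev x]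
      _ = _ := by
          rw [lintegral_mul_const' _ _ ENNReal.ofReal_ne_top]
          ring
  refine key.trans ?_
  rw [ENNReal.ofReal_mul hκ]
  gcongr
  exact h.bound

/-- The two kernels coincide for `|x| ≥ R`. Inside, `R⁻² ≤ |x|⁻²` keeps the difference of the radial
factors below `|x|⁻²`. -/
theorem shortRange_kern_sub {R : ℝ} (hR : 0 ≤ R) (j : Fin 2) :
    ShortRange (fun x => kern R j x - kern 0 j x) R := by
  refine ⟨(subCoulomb_kern R j).meas.sub (subCoulomb_kern 0 j).meas, fun x => ?_⟩
  rcases lt_or_ge ‖x‖ R with h | h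
  · rw [near, indicator_of_mem (show ‖x‖ ∈ Iio R from h)]
    rcases eq_or_ne x 0 with rfl | hx
    · have : perp (0 : Plane) j = 0 := by fin_cases j <;> simp [perp]
      simp [kern, this]
    · have hx0 : 0 < ‖x‖ := norm_pos_iff.2 hx
      have h1 : ‖x‖ ^ 2 ≤ R ^ 2 := by gcongr
      rw [kern, kern, max_eq_right h1, max_eq_left (by rw [zero_pow two_ne_zero]; positivity), ← mul_sub, abs_mul]
      have h2 : (R ^ 2)⁻¹ ≤ (‖x‖ ^ 2)⁻¹ := inv_anti₀ (by positivity) h1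
      have h3 : |(R ^ 2)⁻¹ - (‖x‖ ^ 2)⁻¹| ≤ (‖x‖ ^ 2)⁻¹ := by
        rw [abs_le]
        have : 0 ≤ (R ^ 2)⁻¹ := by positivity
        constructor <;> linarith
      calc |perp x j| * |(R ^ 2)⁻¹ - (‖x‖ ^ 2)⁻¹| ≤ ‖x‖ * (‖x‖ ^ 2)⁻¹ := by
            gcongr
            exact abs_perp_le j x
        _ = ‖x‖⁻¹ := by field_simp
  · have h1 : R ^ 2 ≤ ‖x‖ ^ 2 := by gcongr
    rw [kern, kern, max_eq_left h1, max_eq_left (by rw [zero_pow two_ne_zero]; positivity), sub_self, abs_zero]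
    exact near_nonneg R (norm_nonneg x)

theorem cv_kern_sub (R : ℝ) (j : Fin 2) {ρ : Plane → ℂ} {B : ℝ} (h : HasPot ρ B) (y : Plane) :
    cv (fun x => kern R j x - kern 0 j x) ρ y = cv (kern R j) ρ y - cv (kern 0 j) ρ y := by
  rw [cv, cv, cv, ← integral_sub ((subCoulomb_kern R j).integrable h y)
    ((subCoulomb_kern 0 j).integrable h y)]
  refine integral_congr_ae (Eventually.of_forall fun x => ?_)
  simp only
  push_cast
  ring

/-- Dependence of the Hamiltonian on the radius. -/
theorem norm_ham_sub_le {β : ℝ} (hβ : |β| ≤ 1) {R : ℝ} (hR : 0 ≤ R) {f : L2} {a U : ℝ} (hU : 0 ≤ U)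
    (hSf : ∀ᵐ x, ‖S f x‖ ≤ U) (ha : HasHardy (S f) a) :
    ‖ham β R f f - ham β 0 f f‖
      ≤ 2 * Real.pi * R * U ^ 2 * (4 * (‖D 0 f‖ + ‖D 1 f‖) + 12 * a ^ 2 * ‖S f‖) := by
  set κ := 2 * Real.pi * R with hκ
  have hκ0 : 0 ≤ κ := by positivity
  have ha0 := ha.nonneg
  set δ : Fin 2 → Plane → ℝ := fun j x => kern R j x - kern 0 j x with hδ
  have hδS : ∀ j, ShortRange (δ j) R := shortRange_kern_sub hR
  have hdens : ∀ᵐ x, ‖(‖S f x‖ : ℂ) ^ 2‖ ≤ U ^ 2 := by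
    filter_upwards [hSf] with x hx
    rw [norm_pow, norm_real, norm_norm]
    gcongr
  have hdA : ∀ j y, ‖(Apot R f j y : ℂ) - Apot 0 f j y‖ ≤ U ^ 2 * κ := fun j y => by
    rw [ofReal_Apot, ofReal_Apot, ← cv_kern_sub R j (hasPot_dens ha)]
    exact (hδS j).norm_cv_le hR (by positivity) hdens y
  have hmA : ∀ j, AEStronglyMeasurable (fun y => (Apot R f j y : ℂ) - Apot 0 f j y)
      (volume : Measure Plane) := fun j => (meas_Apot R f j).sub (meas_Apot 0 f j)
  have hβ2 : ‖(β : ℂ) ^ 2‖ ≤ 1 := by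
    rw [norm_pow, norm_real, Real.norm_eq_abs]
    exact pow_le_one₀ (abs_nonneg _) hβ
  have G1 : ∀ j, L2Le (fun y => -2 * I * β * ((Apot R f j y : ℂ) - Apot 0 f j y) * D j f y)
      (2 * (U ^ 2 * κ) * ‖D j f‖) := fun j =>
    (L2Le.coe (D j f)).of_le (by positivity) ((aestronglyMeasurable_const.mul (hmA j)).mul (meas_coe _))
      (Eventually.of_forall fun y => by
        rw [norm_mul, norm_mul]
        gcongr
        · simpa using hβ
        · exact hdA j y)
  have G2 : ∀ j, L2Le (fun y => (β : ℂ) ^ 2 * ((Apot R f j y : ℂ) + Apot 0 f j y) *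
      ((Apot R f j y : ℂ) - Apot 0 f j y) * S f y) (1 * (2 * (a * a)) * (U ^ 2 * κ) * ‖S f‖) := fun j =>
    (L2Le.coe (S f)).of_le (by positivity) (((aestronglyMeasurable_const.mul
      ((meas_Apot R f j).add (meas_Apot 0 f j))).mul (hmA j)).mul (meas_coe _))
      (Eventually.of_forall fun y => by
        rw [norm_mul, norm_mul, norm_mul]
        have h1 := abs_Apot_le R ha j y
        have h2 := abs_Apot_le 0 ha j y
        have h4 : ‖(Apot R f j y : ℂ) + Apot 0 f j y‖ ≤ 2 * (a * a) := by
          refine (norm_add_le _ _).trans ?_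
          rw [norm_real, norm_real, Real.norm_eq_abs, Real.norm_eq_abs]
          linarith
        have h5 := hdA j y
        gcongr)
  have hq : ∀ j, AEStronglyMeasurable (fun x => ((Apot R f j x : ℂ) - Apot 0 f j x) * (‖S f x‖ : ℂ) ^ 2)
      (volume : Measure Plane) := fun j => (hmA j).mul (meas_dens f)
  have hqP : ∀ j, HasPot (fun x => ((Apot R f j x : ℂ) - Apot 0 f j x) * (‖S f x‖ : ℂ) ^ 2)
      (U ^ 2 * κ * (a * a)) := fun j =>
    (hasPot_dens ha).of_le (by positivity) (hq j) (Eventually.of_forall fun x => by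
      rw [norm_mul]
      gcongr
      exact hdA j x)
  -- The radius enters twice, in the kernel and in the vector potential of the source; the two
  -- changes are separated.
  have hquart : ∀ j y, cv (kern R j) (quart R f j) y - cv (kern 0 j) (quart 0 f j) y
      = cv (kern R j) (fun x => ((Apot R f j x : ℂ) - Apot 0 f j x) * (‖S f x‖ : ℂ) ^ 2) y
        + cv (δ j) (quart 0 f j) y := fun j y => by
    rw [cv_kern_sub R j (hasPot_quart 0 ha j), ← sub_add_sub_cancel _ (cv (kern R j) (quart 0 f j) y),
      ← (subCoulomb_kern R j).cv_sub (hasPot_quart R ha j) (hasPot_quart 0 ha j)]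
    congr 1
    refine cv_congr_ae (Eventually.of_forall fun x => ?_) y
    simp only [quart]
    ring
  have hquartb : ∀ j y, ‖cv (kern R j) (quart R f j) y - cv (kern 0 j) (quart 0 f j) y‖
      ≤ 2 * (a * a) * (U ^ 2 * κ) := fun j y => by
    rw [hquart]
    refine (norm_add_le _ _).trans ?_
    have h1 := (subCoulomb_kern R j).norm_cv_le (hqP j) y
    have h2 := (hδS j).norm_cv_le hR (B := a * a * U ^ 2) (by positivity) (ρ := quart 0 f j) (by
      filter_upwards [hdens] with x hx
      rw [quart, norm_mul, norm_real, Real.norm_eq_abs]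
      gcongr
      exact abs_Apot_le 0 ha j x) y
    linarith
  have hqm : ∀ j, AEStronglyMeasurable
      (fun y => cv (kern R j) (quart R f j) y - cv (kern 0 j) (quart 0 f j) y)
      (volume : Measure Plane) := fun j =>
    ((subCoulomb_kern R j).aestronglyMeasurable_cv (meas_quart R f j)).sub
      ((subCoulomb_kern 0 j).aestronglyMeasurable_cv (meas_quart 0 f j))
  have G3 : ∀ j, L2Le (fun y => -2 * (β : ℂ) ^ 2 *
      (cv (kern R j) (quart R f j) y - cv (kern 0 j) (quart 0 f j) y) * S f y)
      (2 * (2 * (a * a) * (U ^ 2 * κ)) * ‖S f‖) := fun j =>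
    (L2Le.coe (S f)).of_le (by positivity)
      ((aestronglyMeasurable_const.mul (hqm j)).mul (meas_coe _))
      (Eventually.of_forall fun y => by
        rw [norm_mul, norm_mul]
        gcongr
        · rw [norm_mul, norm_neg, norm_ofNat]; linarith
        · exact hquartb j y)
  -- The current is only square integrable, so Young's inequality replaces the pointwise bound, and
  -- the supremum bound is spent on the outer factor `S f`.
  have G4 : ∀ j, L2Le (fun y => -(β : ℂ) * cv (δ j) (curr f j) y * S f y)
      (U * (κ * (2 * U * ‖D j f‖))) := fun j => by
    have h1 : L2Le (curr f j) (2 * U * ‖D j f‖) :=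
      (L2Le.coe (D j f)).of_le (by positivity) (meas_curr f j) (by
        filter_upwards [hSf] with x hx
        refine (norm_curr_le f j x).trans ?_
        gcongr)
    have h2 := (hδS j).l2Le_cv hR h1
    refine h2.of_le hU ((aestronglyMeasurable_const.mul h2.meas).mul (meas_coe _)) ?_
    filter_upwards [hSf] with y hy
    rw [norm_mul, norm_mul, norm_neg, norm_real, Real.norm_eq_abs]
    calc |β| * ‖cv (δ j) (curr f j) y‖ * ‖S f y‖ ≤ 1 * ‖cv (δ j) (curr f j) y‖ * U := by gcongr
      _ = _ := by ring
  have G := (((G1 0).add (G1 1)).add ((G2 0).add (G2 1))).add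
    (((G3 0).add (G3 1)).add ((G4 0).add (G4 1)))
  rw [ham_apply, ham_apply, add_sub_add_left_eq_sub]
  refine (G.norm_le (w := pert β R f f - pert β 0 f f) ?_).trans (le_of_eq ?_)
  · filter_upwards [Lp.coeFn_sub (pert β R f f) (pert β 0 f f), pert_ae β R f f, pert_ae β 0 f f]
      with y h1 h2 h3
    rw [h1, Pi.sub_apply, h2, h3, Wpot, Wpot, Vpot_eq, Vpot_eq]
    simp only [Fin.sum_univ_two]
    rw [cv_kern_sub R 0 (hasPot_curr (hardy_S_le f) (hardy_D_le 0 f)),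
      cv_kern_sub R 1 (hasPot_curr (hardy_S_le f) (hardy_D_le 1 f))]
    ring
  · ring

theorem exists_ham_sub_le (M : ℝ) : ∃ C : ℝ, 0 ≤ C ∧ ∀ β R : ℝ, |β| ≤ 1 → 0 ≤ R → ∀ f : L2, ‖f‖ ≤ M →
    ‖ham β R f f - ham β 0 f f‖ ≤ C * R := by
  obtain ⟨U, hU, hsup⟩ := exists_sup_bound
  rcases lt_or_ge M 0 with hM | hM
  · exact ⟨0, le_rfl, fun _ _ _ _ f hf => absurd ((norm_nonneg f).trans hf) (not_le.2 hM)⟩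
  refine ⟨2 * Real.pi * (U * M) ^ 2 * (4 * (2 * Real.pi * M + 2 * Real.pi * M) + 12 * (40 * M) ^ 2 * M),
    by positivity, fun β R hβ hR f hf => ?_⟩
  have h := norm_ham_sub_le hβ hR (f := f) (U := U * M) (a := 40 * M) (by positivity)
    (by filter_upwards [hsup f] with x hx; exact hx.trans (by gcongr))
    ((hardy_S_le f).mono (by gcongr))
  refine h.trans ?_
  have h0 := (norm_D_le 0 f).trans (mul_le_mul_of_nonneg_left hf (by positivity))
  have h1 := (norm_D_le 1 f).trans (mul_le_mul_of_nonneg_left hf (by positivity))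
  have h2 := (norm_S_le f).trans hf
  calc _ ≤ 2 * Real.pi * R * (U * M) ^ 2 * (4 * (2 * Real.pi * M + 2 * Real.pi * M)
        + 12 * (40 * M) ^ 2 * M) := by gcongr
    _ = _ := by ring

end

end CSS

open MeasureTheory Complex Filter Topology Set FourierTransform
open scoped LineDeriv SchwartzMap ComplexConjugate ENNReal

namespace CSS

/-! ### Solutions -/

/-- Pulling a solution back through `S` puts it in the form to which the abstract energy estimate
applies. -/
theorem IsSolution.exists_lift {β R T : ℝ} (hR : 0 ≤ R) {φ₀ : L2} {u : ℝ → L2}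
    (hu : IsSolution β R T φ₀ u) : ∃ g : ℝ → L2, (∀ t ∈ Icc 0 T, S (g t) = u t) ∧
      ContinuousOn g (Icc 0 T) ∧
      ∀ t ∈ Icc 0 T, HasDerivWithinAt u ((-I) • ham β R (g t) (g t)) (Icc 0 T) t := by
  have h1 : ∀ t, ∃ g : L2, t ∈ Icc 0 T → S g = u t := fun t => by
    by_cases ht : t ∈ Icc 0 T
    · obtain ⟨g, hg⟩ := (memH2_iff _).1 (hu.memH2 t ht)
      exact ⟨g, fun _ => hg⟩
    · exact ⟨0, fun h => absurd h ht⟩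
  choose g hg using h1
  refine ⟨g, fun t ht => hg t ht, fun t ht => ?_, fun t ht => ?_⟩
  · rw [ContinuousWithinAt, tendsto_iff_norm_sub_tendsto_zero]
    have h2 := (hu.continuous_h2 t ht).const_mul 2
    rw [mul_zero] at h2
    refine squeeze_zero' (Eventually.of_forall fun _ => norm_nonneg _) ?_ h2
    filter_upwards [self_mem_nhdsWithin] with s hs
    rw [← hg s hs, ← hg t ht, ← map_sub]
    exact norm_le_h2Norm _
  · obtain ⟨u', h2, h3⟩ := hu.equation t ht
    rw [← hg t ht, isRHS_iff hR] at h3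
    rwa [← h3, smul_smul, neg_mul, I_mul_I, neg_neg, one_smul]

theorem isSolution_of_lift {β R T : ℝ} (hR : 0 ≤ R) {f : ℝ → L2}
    (hc : ∀ t ∈ Icc 0 T, ContinuousAt f t)
    (hd : ∀ t ∈ Icc 0 T, HasDerivAt (fun s => S (f s)) ((-I) • ham β R (f t) (f t)) t) :
    IsSolution β R T (S (f 0)) fun t => S (f t) where
  memH2 t _ := (memH2_iff _).2 ⟨f t, rfl⟩
  continuous_h2 t ht := by
    have h1 := (tendsto_iff_norm_sub_tendsto_zero.1 (hc t ht)).const_mul 100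
    rw [mul_zero] at h1
    refine squeeze_zero (fun s => Real.sqrt_nonneg _) (fun s => ?_) (h1.mono_left nhdsWithin_le_nhds)
    rw [← map_sub]
    exact h2Norm_S_le _
  initial := rfl
  equation t ht := ⟨_, (hd t ht).hasDerivWithinAt, by
    rw [isRHS_iff hR, smul_smul, mul_neg, I_mul_I, neg_neg, one_smul]⟩

theorem Admissible.solution_unique {β R m b T : ℝ} {Bd Lip Rel : ℝ → ℝ}
    (hH : Admissible planeFrame m b Bd Lip Rel (ham β R)) (hR : 0 ≤ R) {φ₀ : L2} {u v : ℝ → L2}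
    (hu : IsSolution β R T φ₀ u) (hv : IsSolution β R T φ₀ v) : EqOn u v (Icc 0 T) := by
  obtain ⟨f, hf, hfc, hfd⟩ := hu.exists_lift hR
  obtain ⟨g, hg, hgc, hgd⟩ := hv.exists_lift hR
  -- Continuity in `H²` on a compact interval bounds both lifts, which fixes the Lipschitz constant;
  -- no a priori bound on the solutions is assumed.
  obtain ⟨A, hA⟩ := isCompact_Icc.exists_bound_of_continuousOn hfc
  obtain ⟨B, hB⟩ := isCompact_Icc.exists_bound_of_continuousOn hgc
  intro t ht
  set M := max A B with hM
  have hM0 : 0 ≤ M := (norm_nonneg _).trans ((hA t ht).trans (le_max_left _ _))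
  have hK : 0 ≤ 2 * (Lip M * M) := by have := hH.Lip_nonneg M; positivity
  have h := gronwall_forward (y := fun s => ‖u s - v s‖ ^ 2) (a := 0) (b := T) (ε := 0) hK le_rfl
    (fun s _ => sq_nonneg _) (fun s hs => hasDerivWithinAt_norm_sq ((hfd s hs).sub (hgd s hs)))
    (fun s hs => by
      have h1 := hH.energy ((hA s hs).trans (le_max_left A B)) ((hB s hs).trans (le_max_right A B))
      change |(inner ℂ (S (f s) - S (g s)) _).re| ≤ _ * ‖S (f s) - S (g s)‖ ^ 2 at h1
      rw [hf s hs, hg s hs, smul_sub] at h1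
      rw [abs_mul, abs_two]
      linarith) ht
  simp only [hu.initial, hv.initial, sub_self, norm_zero, ne_eq, OfNat.ofNat_ne_zero, not_false_eq_true,
    zero_pow, zero_mul, add_zero] at h
  have h1 : ‖u t - v t‖ = 0 := by
    have := sq_nonneg ‖u t - v t‖
    exact pow_eq_zero_iff two_ne_zero |>.1 (le_antisymm h this)
  exact sub_eq_zero.1 (norm_eq_zero.1 h1)

/-- The energy estimate for the difference of two solutions with different radii. -/
theorem Admissible.abs_re_inner_le {β R m b M C : ℝ} {Bd Lip Rel : ℝ → ℝ}
    (hH : Admissible planeFrame m b Bd Lip Rel (ham β R)) {f g : L2} (hf : ‖f‖ ≤ M) (hg : ‖g‖ ≤ M)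
    (hC : ‖ham β R f f - ham β 0 f f‖ ≤ C * R) :
    |2 * (inner ℂ (S f - S g) ((-I) • ham β 0 f f - (-I) • ham β R g g)).re|
      ≤ (2 * (Lip M * M) + 1) * ‖S f - S g‖ ^ 2 + C ^ 2 * R ^ 2 := by
  -- Both states are compared through the Hamiltonian of radius `R`; changing the radius at `f`
  -- produces a source of size `C R`.
  have e : (-I) • ham β 0 f f - (-I) • ham β R g g
      = (-I) • (ham β R f f - ham β R g g) + I • (ham β R f f - ham β 0 f f) := by module
  have h1 := hH.energy hf hg
  change |(inner ℂ (S f - S g) _).re| ≤ _ * ‖S f - S g‖ ^ 2 at h1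
  have h2 : |(inner ℂ (S f - S g) (I • (ham β R f f - ham β 0 f f))).re| ≤ ‖S f - S g‖ * (C * R) := by
    refine (abs_re_le_norm _).trans ((norm_inner_le_norm _ _).trans ?_)
    rw [norm_smul, norm_I, one_mul]
    gcongr
  rw [e, inner_add_right, add_re, abs_mul, abs_two]
  have h3 := abs_add_le (inner ℂ (S f - S g) ((-I) • (ham β R f f - ham β R g g))).re
    (inner ℂ (S f - S g) (I • (ham β R f f - ham β 0 f f))).re
  nlinarith [sq_nonneg (‖S f - S g‖ - C * R)]

end CSS

/-! ### Choice of the constants and comparison of the two radii. -/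

theorem lemma3p3 :
    ∀ M₁ : ℝ, ∃ c' : ℝ, 0 < c' ∧
    ∀ M₂ : ℝ, ∃ c T C : ℝ, 0 < c ∧ 0 < T ∧ 0 < C ∧
    ∀ φ₀ : CSS.L2, CSS.MemH2 φ₀ → CSS.h1Norm φ₀ ≤ M₁ → CSS.h2Norm φ₀ ≤ M₂ →
    ∀ β : ℝ, |β| ≤ c' →
      (∀ R : ℝ, 0 ≤ R → R ≤ c →
        ∃ u : ℝ → CSS.L2, CSS.IsSolution β R T φ₀ u ∧
          ∀ v : ℝ → CSS.L2, CSS.IsSolution β R T φ₀ v → Set.EqOn v u (Set.Icc 0 T)) ∧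
      (∀ R : ℝ, 0 < R → R ≤ c →
        ∀ φ φR : ℝ → CSS.L2, CSS.IsSolution β 0 T φ₀ φ → CSS.IsSolution β R T φ₀ φR →
          ∀ t : ℝ, 0 ≤ t → t < T →
            (∃ d : ℝ,
              HasDerivWithinAt (fun s => ‖φ s - φR s‖ ^ 2) d (Set.Icc 0 T) t ∧
              d ≤ C * R ^ 2 + C * ‖φ t - φR t‖ ^ 2) ∧
            ‖φ t - φR t‖ ^ 2 ≤ C * R ^ 2 * Real.exp (C * t)) := by
  intro M₁
  have hc' : (0 : ℝ) < 1 / (100 * (M₁ ^ 2 + 1)) := by positivity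
  -- This value gives both `|β| ≤ 1` and `|β| M₁² ≤ 1/100`. Of the `H¹` bound only the `L²` part is
  -- used, as the mass bound `m`.
  refine ⟨1 / (100 * (M₁ ^ 2 + 1)), hc', fun M₂ => ?_⟩
  set m := |M₁| with hm
  have hsmall : ∀ β : ℝ, |β| ≤ 1 / (100 * (M₁ ^ 2 + 1)) → |β| ≤ 1 ∧ |β| * m ^ 2 ≤ 1 / 100 := by
    intro β hβ
    rw [le_div_iff₀ (by positivity)] at hβ
    have h0 := abs_nonneg β
    have h1 : m ^ 2 = M₁ ^ 2 := sq_abs M₁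
    rw [h1]
    constructor <;> nlinarith [mul_nonneg h0 (sq_nonneg M₁)]
  set Bd : ℝ → ℝ := fun M => 8 * Real.pi ^ 2 + (8 * Real.pi * (40 * M) ^ 2 + 6 * (40 * M) ^ 4
    + 4 * (40 * M) ^ 2)
  set Lip : ℝ → ℝ := fun M => 40 * (100 * |40 * M| + 100 * |40 * M| ^ 3) with hLip
  have hLip0 : ∀ M, 0 ≤ Lip M := fun M => by positivity
  -- The factor `2` comes from `‖g₀‖ ≤ 2 ‖S g₀‖_{H²}`.
  obtain ⟨T, M, hT, hM, hex⟩ := CSS.Admissible.exists_strong_solution CSS.planeFrame m m Bd Lip hLip0 (2 * M₂)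
  obtain ⟨C₀, hC₀, hcmp⟩ := CSS.exists_ham_sub_le M
  set K := 2 * (Lip M * M) + 1 with hK
  have hK1 : 1 ≤ K := by have := hLip0 M; have : 0 ≤ Lip M * M := by positivity
                         linarith
  -- `K` and `C₀²` are the constants of the differential inequality; `C₀² T` absorbs the factor `t`
  -- that Grönwall's lemma produces.
  set C := K + C₀ ^ 2 + C₀ ^ 2 * T with hC
  have hCK : K ≤ C := by have : 0 ≤ C₀ ^ 2 * T := by positivity
                         nlinarith
  -- All estimates are uniform in `R ≥ 0`, so the threshold `1` for the radius is arbitrary.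
  refine ⟨1, T, C, one_pos, hT, by linarith, fun φ₀ hφ₀ h1 h2 β hβ => ?_⟩
  obtain ⟨hβ1, hβm⟩ := hsmall β hβ
  obtain ⟨g₀, rfl⟩ := (CSS.memH2_iff _).1 hφ₀
  have hsol : ∀ R : ℝ, 0 ≤ R → ∃ f : ℝ → CSS.L2, (∀ t ∈ Icc 0 T, ‖f t‖ ≤ M) ∧
      CSS.IsSolution β R T (CSS.S g₀) fun t => CSS.S (f t) := fun R hR => by
    obtain ⟨f, hf0, hf⟩ := hex _ _ (CSS.admissible_ham hβ1 hβm R) g₀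
      ((CSS.norm_le_h1Norm _).trans (h1.trans (le_abs_self M₁)))
      ((CSS.norm_le_h2Norm g₀).trans (by linarith))
    refine ⟨f, fun t ht => (hf t ht).1, ?_⟩
    rw [← hf0]
    exact CSS.isSolution_of_lift hR (fun t ht => (hf t ht).2.1) fun t ht => (hf t ht).2.2
  refine ⟨fun R hR _ => ?_, fun R hR _ φ φR hφ hφR t ht0 htT => ?_⟩
  · obtain ⟨f, -, hf⟩ := hsol R hR
    exact ⟨_, hf, fun v hv => (CSS.admissible_ham hβ1 hβm R).solution_unique hR hv hf⟩
  -- An arbitrary solution inherits the bound `M` of the constructed one, by uniqueness and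
  -- injectivity of `S`.
  · have hbound : ∀ (R : ℝ) (hR : 0 ≤ R) (u : ℝ → CSS.L2), CSS.IsSolution β R T (CSS.S g₀) u →
        ∃ g : ℝ → CSS.L2, ∀ t ∈ Icc 0 T, ‖g t‖ ≤ M ∧ CSS.S (g t) = u t ∧
          HasDerivWithinAt u ((-I) • CSS.ham β R (g t) (g t)) (Icc 0 T) t := fun R hR u hu => by
      obtain ⟨f, hfM, hf⟩ := hsol R hR
      obtain ⟨g, hg, -, hgd⟩ := hu.exists_lift hR
      refine ⟨g, fun t ht => ⟨?_, hg t ht, hgd t ht⟩⟩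
      have h3 := (CSS.admissible_ham hβ1 hβm R).solution_unique hR hu hf ht
      rw [← hg t ht] at h3
      rw [CSS.planeFrame.S_injective h3]
      exact hfM t ht
    obtain ⟨f, hf⟩ := hbound 0 le_rfl φ hφ
    obtain ⟨g, hg⟩ := hbound R hR.le φR hφR
    have hd : ∀ s ∈ Icc 0 T, HasDerivWithinAt (fun s => ‖φ s - φR s‖ ^ 2)
        (2 * (inner ℂ (φ s - φR s)
          ((-I) • CSS.ham β 0 (f s) (f s) - (-I) • CSS.ham β R (g s) (g s))).re) (Icc 0 T) s :=
      fun s hs => CSS.hasDerivWithinAt_norm_sq ((hf s hs).2.2.sub (hg s hs).2.2)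
    have hb : ∀ s ∈ Icc 0 T, |2 * (inner ℂ (φ s - φR s)
          ((-I) • CSS.ham β 0 (f s) (f s) - (-I) • CSS.ham β R (g s) (g s))).re|
        ≤ K * ‖φ s - φR s‖ ^ 2 + C₀ ^ 2 * R ^ 2 := fun s hs => by
      have h3 := (CSS.admissible_ham hβ1 hβm R).abs_re_inner_le (hf s hs).1 (hg s hs).1
        (hcmp β R hβ1 hR.le (f s) (hf s hs).1)
      rwa [(hf s hs).2.1, (hg s hs).2.1] at h3
    have ht : t ∈ Icc 0 T := ⟨ht0, htT.le⟩
    refine ⟨⟨_, hd t ht, ?_⟩, ?_⟩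
    · refine (le_abs_self _).trans ((hb t ht).trans ?_)
      have h3 : C₀ ^ 2 * R ^ 2 ≤ C * R ^ 2 := by
        gcongr
        have : 0 ≤ C₀ ^ 2 * T := by positivity
        linarith
      have h4 : K * ‖φ t - φR t‖ ^ 2 ≤ C * ‖φ t - φR t‖ ^ 2 := by gcongr
      linarith
    · have h3 := CSS.gronwall_forward (y := fun s => ‖φ s - φR s‖ ^ 2) (by linarith)
        (show 0 ≤ C₀ ^ 2 * R ^ 2 by positivity) (fun s _ => sq_nonneg _) hd hb ht
      simp only [hφ.initial, hφR.initial, sub_self, norm_zero, ne_eq, OfNat.ofNat_ne_zero,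
        not_false_eq_true, zero_pow, zero_add, sub_zero] at h3
      refine h3.trans ?_
      have h4 : C₀ ^ 2 * t ≤ C := by
        have : C₀ ^ 2 * t ≤ C₀ ^ 2 * T := by gcongr
        nlinarith [sq_nonneg C₀]
      calc C₀ ^ 2 * R ^ 2 * t * Real.exp (K * t) = C₀ ^ 2 * t * R ^ 2 * Real.exp (K * t) := by ring
        _ ≤ C * R ^ 2 * Real.exp (C * t) := by gcongr
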